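/- Let $d\ge 1$, let $\tilde I\subset\mathbb R$ be a compact interval, let $c>0$, and let $1\le p<\frac{d^2+d+2}{d^2+d}$, $\frac1p+\frac1{p'}=1$, $q=\frac{2p'}{d^2+d}$ (so $p'=q=\infty$ and $1/p'=0$ if $p=1$). Then there is a constant $C_p>0$, depending only on $d,\tilde I,c,p$, with the following property. Let $\gamma\in C^d(\tilde I;\mathbb R^d)$, let $I=[a,b]\subseteq\tilde I$ be a compact interval and let $k\in\mathbb Z$. For $m\ge 1$ and $h\in\mathbb R^m$ with $0\le h_1\le\dots\le h_m$, put $I_h=[a-h_1,\,b-h_m]$ (empty if $b-h_m<a-h_1$) and let $\gamma_h(t)=\frac1m\sum_{j=1}^m\gamma(t+h_j)$, $t\in I_h$, be the corresponding offspring curve. For a curve $\zeta$ in $\mathbb R^d$ write $\Phi_\zeta(t_1,\dots,t_d)=\zeta(t_1)+\dots+\zeta(t_d)$ and $J_{\Phi_\zeta}(t_1,\dots,t_d)=\det[\zeta'(t_1),\dots,\zeta'(t_d)]$, with one-sided derivatives at endpoints, and let $v(t_1,\dots,t_d)=\prod_{1\le i<j\le d}(t_j-t_i)$. Suppose that for every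 such $m$ and $h$: 1. $\Phi_{\gamma_h}$ is injective on $\{(t_1,\dots,t_d)\in I_h^d : t_1<\dots<t_d\}$; 2. if $I_h$ has more than one point, then $|J_{\Phi_{\gamma_h}}(t_1,\dots,t_d)|\ge c\,2^{-k}\,|v(t_1,\dots,t_d)|$ for all $(t_1,\dots,t_d)\in I_h^d$. Then for every such $m$ and $h$ and every $f\in L^p(\mathbb R^d)$, $$\|\hat f\circ\gamma_h\|_{L^q(I_h)}\le 2^{k/p'}\,C_p\,\|f\|_{L^p(\mathbb R^d)}.$$ Here $\hat f(\xi)=\int_{\mathbb R^d} e^{-ix\cdot\xi}f(x)\,dx$ for $f\in L^1(\mathbb R^d)$; for general $f\in L^p(\mathbb R^d)$, $\hat f\circ\gamma_h$ denotes the value at $f$ of the unique bounded linear extension $L^p(\mathbb R^d)\to L^q(I_h)$ of the map $f\mapsto\hat f\circ\gamma_h$ on $L^1\cap L^p$, whose existence is part of the assertion. -/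

import Mathlib

open MeasureTheory
open scoped ENNReal

/-- The parameters of an offspring curve: `0 ≤ h₁ ≤ ⋯ ≤ hₘ` with `m ≥ 1`
(written with `m + 1` entries `h 0, …, h (Fin.last m)`). -/
def IsOffspringParameter {m : ℕ} (h : Fin (m + 1) → ℝ) : Prop :=
  0 ≤ h 0 ∧ Monotone h

/-- The offspring curve `γ_h(t)`, the average of the translates `γ(t + h_j)`. -/
noncomputable def offspringCurve {d m : ℕ} (γ : ℝ → EuclideanSpace ℝ (Fin d))
    (h : Fin (m + 1) → ℝ) (t : ℝ) : EuclideanSpace ℝ (Fin d) :=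
  ((m : ℝ) + 1)⁻¹ • ∑ j, γ (t + h j)

/-- For `I = [a, b]`, the interval `I_h = [a - h₁, b - hₘ]` (empty if `b - hₘ < a - h₁`). -/
def offspringInterval {m : ℕ} (a b : ℝ) (h : Fin (m + 1) → ℝ) : Set ℝ :=
  Set.Icc (a - h 0) (b - h (Fin.last m))

/-- `Φ_ζ(t₁, …, t_d) = ζ(t₁) + ⋯ + ζ(t_d)`. -/
noncomputable def curveSum {d : ℕ} (ζ : ℝ → EuclideanSpace ℝ (Fin d)) (t : Fin d → ℝ) :
    EuclideanSpace ℝ (Fin d) :=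
  ∑ j, ζ (t j)

/-- The Jacobian `J_{Φ_ζ}(t₁, …, t_d) = det[ζ'(t₁), …, ζ'(t_d)]` of `Φ_ζ` for a curve `ζ` on the
interval `J`; the derivatives are one-sided at the endpoints of `J`. -/
noncomputable def curveSumJacobian {d : ℕ} (ζ : ℝ → EuclideanSpace ℝ (Fin d)) (J : Set ℝ)
    (t : Fin d → ℝ) : ℝ :=
  (Matrix.of fun i j : Fin d => derivWithin ζ J (t j) i).det

/-- The Vandermonde determinant, the product of `t_j - t_i` over `i < j`. -/
def vandermondeProduct {d : ℕ} (t : Fin d → ℝ) : ℝ :=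
  ∏ i, ∏ j ∈ Finset.Ioi i, (t j - t i)

/-- The Fourier transform `f̂(ξ) = ∫ e^{-i x·ξ} f(x) dx` of an integrable function. -/
noncomputable def fourierHat {d : ℕ} (f : EuclideanSpace ℝ (Fin d) → ℂ)
    (ξ : EuclideanSpace ℝ (Fin d)) : ℂ :=
  ∫ x, Complex.exp (-(Complex.I * ((inner ℝ x ξ : ℝ) : ℂ))) * f x

/-- The inequality `‖f̂ ∘ ζ‖_{L^q(J)} ≤ B ‖f‖_{L^p(ℝᵈ)}` for all `f ∈ L^p(ℝᵈ)`. Since `f̂` is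
defined pointwise only for integrable `f`, the function `f̂ ∘ ζ` for a general `f ∈ L^p` is the value
at `f` of the (by density unique) bounded linear extension of `f ↦ f̂ ∘ ζ` from `L¹ ∩ L^p`. -/
def FourierRestrictionBound {d : ℕ} (p q : ℝ≥0∞) (ζ : ℝ → EuclideanSpace ℝ (Fin d)) (J : Set ℝ)
    (B : ℝ) : Prop :=
  ∃ R : Lp ℂ p (volume : Measure (EuclideanSpace ℝ (Fin d))) →ₗ[ℂ]
      Lp ℂ q ((volume : Measure ℝ).restrict J),
    (∀ f : Lp ℂ p (volume : Measure (EuclideanSpace ℝ (Fin d))), Integrable f volume →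
      R f =ᵐ[(volume : Measure ℝ).restrict J] fun t => fourierHat f (ζ t)) ∧
    ∀ f, ‖R f‖ ≤ B * ‖f‖

/-! Restriction to a curve `ζ` is dual to the extension operator `g ↦ ∫ e^{-ix·ζ(t)} g(t) dt`, and
Drury's method bounds the latter by self-improvement. Put `u = 1/p'` and `D = d(d+1)/2`: the range
of `p` is `(D+1)u < 1`, and `q = 1/(Du)`. The estimates are of restricted type: `|g| ≤ 1` on a set
`E`, `g = 0` off it, and the extension is integrated over a set `A`.

The `d`-th power of the extension of `g` is `d!` times an oscillatory integral over increasing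
tuples with phase `x·Φ_ζ(t)` (`curveExtension_pow_eq`). The tuples are cut at `v = ρ`. Where `v >
ρ`, `Φ_ζ` is injective with Jacobian at least `δv`, so Plancherel in the variable `ξ = Φ_ζ(t)`
bounds the square of the `L²` norm by a multiple of `∫ 1/v`
(`lintegral_enorm_tupleExtension_sq_le`). Where `v ≤ ρ`, the gaps `κ` are frozen: the tuple `(s,
s+κ₁, …)` traces the curve `ζ(s) + ζ(s+κ₁) + ⋯`, a multiple of another offspring curve, to which the
bound being improved applies (`setLIntegral_tupleExtension_near_le`). This is why the hypotheses
concern all offspring curves at once and the iteration runs over a family closed under such sums.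
Powers of `v` are dominated by sums of star products `∏_{j≠i} |t_j - t_i|^{-b}`, whose integrals
reduce to one variable (`vandermondeProduct_rpow_neg_le_starSum`).

The best `ρ` turns the exponent `u` into `((1-θ)u + θ/2)/d` (`RestrictedBound.bootstrap`). For `d ≥
2` this affine map is a contraction whose fixed point tends to `1/(D+1)` as `b ↑ 1`, so iteration
from the trivial case `u = 0` reaches every `u < 1/(D+1)` (`exists_restrictedBound`); for `d = 1`
Plancherel alone suffices.

The open range leaves room to upgrade. A slightly larger exponent together with the sup bound `|E|`
gives a strong bound for the extension, duality gives a weak type restriction bound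
(`exists_setLIntegral_fourierHat_le_rpow`), Marcinkiewicz interpolation with `L¹ → L^∞` makes it
strong (`lintegral_enorm_fourierHat_rpow_le`), and density extends it to `L^p`. Every bound carries
the factor `N^u` with `N = (2π)^d/δ`; at `δ = c 2^{-k}` this produces `2^{k/p'}`. -/

/-! ### Plancherel's identity -/

open scoped FourierTransform SchwartzMap in
/-- Plancherel's identity for functions in `L¹ ∩ L²`. -/
theorem lintegral_enorm_fourier_sq_eq {V : Type*} [NormedAddCommGroup V] [InnerProductSpace ℝ V]
    [FiniteDimensional ℝ V] [MeasurableSpace V] [BorelSpace V] {φ : V → ℂ}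
    (h1 : Integrable φ) (h2 : MemLp φ 2) :
    ∫⁻ ξ, ‖𝓕 φ ξ‖ₑ ^ 2 = ∫⁻ x, ‖φ x‖ₑ ^ 2 := by
  have hcont : Continuous (𝓕 φ) :=
    VectorFourier.fourierIntegral_continuous Real.continuous_fourierChar
      (by exact continuous_inner) h1
  -- The `L²` Fourier transform, known as a tempered distribution, is identified with the Fourier
  -- integral by testing both against smooth compactly supported functions.
  have hae : ((𝓕 (h2.toLp φ) : Lp ℂ 2 (volume : Measure V)) : V → ℂ) =ᵐ[volume] 𝓕 φ := by
    have hloc : LocallyIntegrable ((𝓕 (h2.toLp φ) : Lp ℂ 2 (volume : Measure V)) : V → ℂ) volume :=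
      (Lp.memLp _).locallyIntegrable (by norm_num)
    refine ae_eq_of_integral_contDiff_smul_eq hloc hcont.locallyIntegrable ?_
    intro g hg hgs
    have hgs' : HasCompactSupport (fun x => ((g x : ℝ) : ℂ)) :=
      hgs.comp_left (g := fun x : ℝ => (x : ℂ)) (by simp)
    have hgd' : ContDiff ℝ ((⊤ : ℕ∞) : WithTop ℕ∞) (fun x => ((g x : ℝ) : ℂ)) :=
      Complex.ofRealCLM.contDiff.comp hg
    set ψ : 𝓢(V, ℂ) := hgs'.toSchwartzMap hgd' with hψ
    have hψv : ∀ x, ψ x = ((g x : ℝ) : ℂ) := fun x => rfl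
    have key := congrArg (fun T => T ψ) (Lp.fourier_toTemperedDistribution_eq (h2.toLp φ))
    simp only [TemperedDistribution.fourier_apply, Lp.toTemperedDistribution_apply] at key
    have e1 : ∫ x, g x • (𝓕 (h2.toLp φ) : Lp ℂ 2 (volume : Measure V)) x
        = ∫ x, (𝓕 ψ) x • φ x := by
      rw [show (∫ x, g x • (𝓕 (h2.toLp φ) : Lp ℂ 2 (volume : Measure V)) x)
        = ∫ x, ψ x • (𝓕 (h2.toLp φ) : Lp ℂ 2 (volume : Measure V)) x from by
          simp [hψv]]
      rw [← key]
      refine integral_congr_ae ?_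
      filter_upwards [h2.coeFn_toLp] with x hx
      rw [hx]
    rw [e1]
    have e2 := VectorFourier.integral_fourierIntegral_smul_eq_flip (f := (ψ : V → ℂ)) (g := φ)
      (μ := volume) (ν := volume) (L := innerₗ V) Real.continuous_fourierChar
      (by exact continuous_inner) ψ.integrable h1
    rw [flip_innerₗ] at e2
    calc ∫ x, (𝓕 ψ) x • φ x = ∫ x, ψ x • 𝓕 φ x := by
          rw [SchwartzMap.fourier_coe]; exact e2
      _ = _ := by simp [hψv]
  have hn : ‖(𝓕 (h2.toLp φ) : Lp ℂ 2 (volume : Measure V))‖ₑ = ‖h2.toLp φ‖ₑ := by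
    rw [← ofReal_norm, ← ofReal_norm, Lp.norm_fourier_eq]
  rw [Lp.enorm_def, Lp.enorm_def, eLpNorm_congr_ae hae, eLpNorm_congr_ae h2.coeFn_toLp] at hn
  rw [eLpNorm_eq_lintegral_rpow_enorm_toReal (by norm_num) (by norm_num),
    eLpNorm_eq_lintegral_rpow_enorm_toReal (by norm_num) (by norm_num)] at hn
  have := ENNReal.rpow_left_injective (by norm_num) hn
  simpa using this

open scoped FourierTransform in
theorem fourierHat_eq_fourier {d : ℕ} (φ : EuclideanSpace ℝ (Fin d) → ℂ)
    (ξ : EuclideanSpace ℝ (Fin d)) : fourierHat φ ((2 * Real.pi) • ξ) = 𝓕 φ ξ := by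
  rw [fourierHat, Real.fourier_eq']
  refine integral_congr_ae (.of_forall fun x => ?_)
  simp only [smul_eq_mul]
  congr 2
  rw [inner_smul_right]
  push_cast
  ring

/-- The dilation `ξ ↦ 2πξ` relating the two normalisations contributes the factor `(2π)^d`. -/
theorem lintegral_enorm_fourierHat_sq_eq {d : ℕ} {φ : EuclideanSpace ℝ (Fin d) → ℂ}
    (h1 : Integrable φ) (h2 : MemLp φ 2) :
    ∫⁻ ξ, ‖fourierHat φ ξ‖ₑ ^ 2 = ENNReal.ofReal ((2 * Real.pi) ^ d) * ∫⁻ x, ‖φ x‖ₑ ^ 2 := by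
  rw [← lintegral_enorm_fourier_sq_eq h1 h2]
  have hpi : (2 * Real.pi) ≠ 0 := by positivity
  have h := Measure.map_addHaar_smul (volume : Measure (EuclideanSpace ℝ (Fin d))) hpi
  simp_rw [← fourierHat_eq_fourier]
  have e : ∫⁻ ξ, ‖fourierHat φ ((2 * Real.pi) • ξ)‖ₑ ^ 2
      = ∫⁻ ξ, ‖fourierHat φ ξ‖ₑ ^ 2
        ∂(Measure.map (fun x => (2 * Real.pi) • x) (volume : Measure (EuclideanSpace ℝ (Fin d)))) :=
    (lintegral_map_equiv (μ := volume) (fun ξ => ‖fourierHat φ ξ‖ₑ ^ 2)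
      (Homeomorph.smulOfNeZero (2 * Real.pi) hpi).toMeasurableEquiv).symm
  rw [e]
  erw [h]
  rw [lintegral_smul_measure, smul_eq_mul, ← mul_assoc, ← ENNReal.ofReal_mul (by positivity)]
  rw [abs_of_nonneg (by positivity), finrank_euclideanSpace_fin, mul_inv_cancel₀ (by positivity)]
  simp

/-! ### The `L²` estimate through the change of variables `ξ = Φ_ζ(t)` -/

/-- The integral `∫ e^{-i x·Φ_ζ(t)} F(t) dt` over a set `Ω` of tuples. -/
noncomputable def tupleExtension {d : ℕ} (ζ : ℝ → EuclideanSpace ℝ (Fin d))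
    (Ω : Set (Fin d → ℝ)) (F : (Fin d → ℝ) → ℂ) (x : EuclideanSpace ℝ (Fin d)) : ℂ :=
  ∫ t in Ω, Complex.exp (-(Complex.I * ((inner ℝ x (curveSum ζ t) : ℝ) : ℂ))) * F t

/-- A derivative within `Ω` is all that the change of variables for injective maps needs, so
endpoints of `J`, with their one-sided derivatives, cause no trouble. -/
theorem hasFDerivWithinAt_curveSum {d : ℕ} {ζ : ℝ → EuclideanSpace ℝ (Fin d)} {J : Set ℝ}
    (hζ : DifferentiableOn ℝ ζ J) {Ω : Set (Fin d → ℝ)} (hΩ : ∀ t ∈ Ω, ∀ j, t j ∈ J)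
    {t : Fin d → ℝ} (ht : t ∈ Ω) :
    HasFDerivWithinAt (fun s => (curveSum ζ s).ofLp)
      (Matrix.toLin' (Matrix.of fun i j : Fin d => derivWithin ζ J (t j) i)).toContinuousLinearMap
      Ω t := by
  rw [hasFDerivWithinAt_pi']
  intro i
  have h1 : ∀ j : Fin d, HasFDerivWithinAt (fun s : Fin d → ℝ => (ζ (s j)).ofLp i)
      ((derivWithin ζ J (t j) i) • (ContinuousLinearMap.proj j : (Fin d → ℝ) →L[ℝ] ℝ)) Ω t := by
    intro j
    have h2 : HasDerivWithinAt (fun r => (ζ r).ofLp i) (derivWithin ζ J (t j) i) J (t j) := by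
      have h3 := (hζ (t j) (hΩ t ht j)).hasDerivWithinAt
      exact ((EuclideanSpace.proj (𝕜 := ℝ) i).hasFDerivAt.comp_hasDerivWithinAt (t j) h3)
    exact h2.comp_hasFDerivWithinAt t
      (ContinuousLinearMap.proj (R := ℝ) (φ := fun _ : Fin d => ℝ) j).hasFDerivWithinAt
      (fun s hs => hΩ s hs j)
  have h4 := HasFDerivWithinAt.fun_sum (u := Finset.univ) (fun j _ => h1 j)
  have e : (fun s => (curveSum ζ s).ofLp i) = fun s => ∑ j, (ζ (s j)).ofLp i := by
    ext s; simp [curveSum]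
  rw [e]
  refine h4.congr_fderiv ?_
  ext x
  simp [Matrix.mulVec, dotProduct]

theorem vandermondeProduct_pos {d : ℕ} {t : Fin d → ℝ} (ht : StrictMono t) :
    0 < vandermondeProduct t :=
  Finset.prod_pos fun i _ => Finset.prod_pos fun j hj => by
    have := ht (Finset.mem_Ioi.1 hj)
    linarith

/-- The `L²` bound obtained from Plancherel's identity by the change of variables `ξ = Φ_ζ(t)`. -/
theorem lintegral_enorm_tupleExtension_sq_le {d : ℕ} {ζ : ℝ → EuclideanSpace ℝ (Fin d)} {J : Set ℝ}
    (hζ : DifferentiableOn ℝ ζ J) {Ω : Set (Fin d → ℝ)} (hΩm : MeasurableSet Ω)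
    (hΩJ : ∀ t ∈ Ω, ∀ j, t j ∈ J) (hΩs : ∀ t ∈ Ω, StrictMono t)
    (hinj : Set.InjOn (curveSum ζ) Ω) {δ : ℝ} (hδ : 0 < δ)
    (hjac : ∀ t ∈ Ω, δ * |vandermondeProduct t| ≤ |curveSumJacobian ζ J t|)
    {F : (Fin d → ℝ) → ℂ} (hF : IntegrableOn F Ω) (hF1 : ∀ t, ‖F t‖ ≤ 1) :
    ∫⁻ x, ‖tupleExtension ζ Ω F x‖ₑ ^ 2 ≤ ENNReal.ofReal ((2 * Real.pi) ^ d / δ) *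
      ∫⁻ t in Ω, ENNReal.ofReal ((vandermondeProduct t)⁻¹) := by
  classical
  set Φ : (Fin d → ℝ) → (Fin d → ℝ) := fun s => (curveSum ζ s).ofLp with hΦ
  set Φ' : (Fin d → ℝ) → ((Fin d → ℝ) →L[ℝ] (Fin d → ℝ)) := fun t =>
    (Matrix.toLin' (Matrix.of fun i j : Fin d => derivWithin ζ J (t j) i)).toContinuousLinearMap
    with hΦ'
  have hder : ∀ t ∈ Ω, HasFDerivWithinAt Φ (Φ' t) Ω t := fun t ht =>
    hasFDerivWithinAt_curveSum hζ hΩJ ht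
  have hdet : ∀ t, (Φ' t).det = curveSumJacobian ζ J t := by
    intro t
    simp only [hΦ', curveSumJacobian, ContinuousLinearMap.det]
    exact LinearMap.det_toLin' _
  have hinj' : Set.InjOn Φ Ω := fun s hs t ht h => hinj hs ht (WithLp.ofLp_injective 2 h)
  have hpos : ∀ t ∈ Ω, 0 < |curveSumJacobian ζ J t| := fun t ht =>
    lt_of_lt_of_le (mul_pos hδ (abs_pos.2 (vandermondeProduct_pos (hΩs t ht)).ne')) (hjac t ht)
  have hIm : MeasurableSet (Φ '' Ω) := measurable_image_of_fderivWithin hΩm hder hinj'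
  -- The density on the image that makes `tupleExtension ζ Ω F` a Fourier transform: `F` transported
  -- by `Φ` and divided by the Jacobian. In its `L²` norm one factor of the Jacobian survives in the
  -- denominator, whence `1/(δv)`.
  set ψ : (Fin d → ℝ) → ℂ := fun y =>
    F (Function.invFunOn Φ Ω y) / (|curveSumJacobian ζ J (Function.invFunOn Φ Ω y)| : ℝ) with hψ
  have hψΦ : ∀ t ∈ Ω, ψ (Φ t) = F t / (|curveSumJacobian ζ J t| : ℝ) := by
    intro t ht
    simp only [hψ, hinj'.leftInvOn_invFunOn ht]
  set φ : EuclideanSpace ℝ (Fin d) → ℂ := fun ξ => (Φ '' Ω).indicator ψ ξ.ofLp with hφ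
  have mp := PiLp.volume_preserving_ofLp (Fin d)
  have me : MeasurableEmbedding (@WithLp.ofLp 2 (Fin d → ℝ)) :=
    (MeasurableEquiv.toLp 2 (Fin d → ℝ)).symm.measurableEmbedding
  have hψi : IntegrableOn ψ (Φ '' Ω) := by
    rw [integrableOn_image_iff_integrableOn_abs_det_fderiv_smul _ hΩm hder hinj']
    refine hF.congr_fun (fun t ht => ?_) hΩm
    have := (hpos t ht).ne'
    simp only [hdet]
    rw [hψΦ t ht, Complex.real_smul, mul_div_cancel₀]
    exact_mod_cast this
  have hφi : Integrable φ := by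
    have : Integrable ((Φ '' Ω).indicator ψ) := (integrable_indicator_iff hIm).2 hψi
    exact (mp.integrable_comp_emb me).2 this
  have hφ2 : ∫⁻ ξ, ‖φ ξ‖ₑ ^ 2 ≤ ENNReal.ofReal (1 / δ) *
      ∫⁻ t in Ω, ENNReal.ofReal ((vandermondeProduct t)⁻¹) := by
    calc ∫⁻ ξ, ‖φ ξ‖ₑ ^ 2 = ∫⁻ y, ‖(Φ '' Ω).indicator ψ y‖ₑ ^ 2 :=
          mp.lintegral_comp_emb me (fun y => ‖(Φ '' Ω).indicator ψ y‖ₑ ^ 2)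
      _ = ∫⁻ y, (Φ '' Ω).indicator (fun y => ‖ψ y‖ₑ ^ 2) y := by
          refine lintegral_congr fun y => ?_
          by_cases hy : y ∈ Φ '' Ω <;> simp [hy]
      _ = ∫⁻ y in Φ '' Ω, ‖ψ y‖ₑ ^ 2 := lintegral_indicator hIm _
      _ = ∫⁻ t in Ω, ENNReal.ofReal |(Φ' t).det| * ‖ψ (Φ t)‖ₑ ^ 2 :=
          lintegral_image_eq_lintegral_abs_det_fderiv_mul _ hΩm hder hinj' _
      _ ≤ ∫⁻ t in Ω, ENNReal.ofReal (1 / δ) * ENNReal.ofReal ((vandermondeProduct t)⁻¹) := by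
          refine setLIntegral_mono' hΩm fun t ht => ?_
          rw [hdet, hψΦ t ht, ← ofReal_norm, ← ENNReal.ofReal_pow (norm_nonneg _),
            ← ENNReal.ofReal_mul (abs_nonneg _), ← ENNReal.ofReal_mul (by positivity)]
          refine ENNReal.ofReal_le_ofReal ?_
          have hv := vandermondeProduct_pos (hΩs t ht)
          have hJ := hpos t ht
          have hj := hjac t ht
          rw [abs_of_pos hv] at hj
          rw [norm_div, Complex.norm_real, Real.norm_eq_abs, abs_abs, div_pow]
          have hF2 : ‖F t‖ ^ 2 ≤ 1 := pow_le_one₀ (norm_nonneg _) (hF1 t)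
          calc |curveSumJacobian ζ J t| * (‖F t‖ ^ 2 / |curveSumJacobian ζ J t| ^ 2)
              ≤ |curveSumJacobian ζ J t| * (1 / |curveSumJacobian ζ J t| ^ 2) := by gcongr
            _ = 1 / |curveSumJacobian ζ J t| := by field_simp
            _ ≤ 1 / (δ * vandermondeProduct t) := by
                apply one_div_le_one_div_of_le (mul_pos hδ hv) hj
            _ = 1 / δ * (vandermondeProduct t)⁻¹ := by field_simp
      _ = _ := lintegral_const_mul' _ _ ENNReal.ofReal_ne_top
  have hT : ∀ x, tupleExtension ζ Ω F x = fourierHat φ x := by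
    intro x
    have e1 : fourierHat φ x = ∫ y, Complex.exp
        (-(Complex.I * ((inner ℝ (WithLp.toLp 2 y) x : ℝ) : ℂ))) * (Φ '' Ω).indicator ψ y :=
      mp.integral_comp me (fun y => Complex.exp
        (-(Complex.I * ((inner ℝ (WithLp.toLp 2 y) x : ℝ) : ℂ))) * (Φ '' Ω).indicator ψ y)
    have e2 : ∀ y, Complex.exp
        (-(Complex.I * ((inner ℝ (WithLp.toLp 2 y) x : ℝ) : ℂ))) * (Φ '' Ω).indicator ψ y =
        (Φ '' Ω).indicator (fun y => Complex.exp
        (-(Complex.I * ((inner ℝ (WithLp.toLp 2 y) x : ℝ) : ℂ))) * ψ y) y := by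
      intro y
      by_cases hy : y ∈ Φ '' Ω <;> simp [hy]
    rw [e1]
    simp_rw [e2]
    rw [integral_indicator hIm, integral_image_eq_integral_abs_det_fderiv_smul _ hΩm hder hinj']
    refine setIntegral_congr_fun hΩm fun t ht => ?_
    have := (hpos t ht).ne'
    simp only [hdet]
    rw [hψΦ t ht, Complex.real_smul, real_inner_comm]
    have h' : ((|curveSumJacobian ζ J t| : ℝ) : ℂ) ≠ 0 := by exact_mod_cast this
    field_simp
    exact mul_comm _ _
  -- If the right side is infinite there is nothing to prove; if it is finite, `φ` lies in `L²` and
  -- Plancherel applies.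
  by_cases htop : ∫⁻ t in Ω, ENNReal.ofReal ((vandermondeProduct t)⁻¹) = ∞
  · rw [htop, ENNReal.mul_top]
    · exact le_top
    · simp; positivity
  have hφm : MemLp φ 2 := by
    refine ⟨hφi.1, ?_⟩
    rw [eLpNorm_lt_top_iff_lintegral_rpow_enorm_lt_top (by norm_num) (by norm_num)]
    have : ∫⁻ ξ, ‖φ ξ‖ₑ ^ 2 < ∞ := lt_of_le_of_lt hφ2
      (ENNReal.mul_lt_top ENNReal.ofReal_lt_top (lt_top_iff_ne_top.2 htop))
    simpa using this
  simp_rw [hT]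
  rw [lintegral_enorm_fourierHat_sq_eq hφi hφm]
  calc _ ≤ ENNReal.ofReal ((2 * Real.pi) ^ d) * (ENNReal.ofReal (1 / δ) *
      ∫⁻ t in Ω, ENNReal.ofReal ((vandermondeProduct t)⁻¹)) := by gcongr
    _ = _ := by
      rw [← mul_assoc, ← ENNReal.ofReal_mul (by positivity), mul_one_div]

/-! ### Integration over tuples: stars, diagonal slices, symmetrisation -/

theorem lintegral_pi_prod_eq_prod_lintegral {n : ℕ} {g : Fin n → ℝ → ℝ≥0∞}
    (hg : ∀ j, Measurable (g j)) :
    ∫⁻ y : Fin n → ℝ, ∏ j, g j (y j) = ∏ j, ∫⁻ s, g j s := by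
  induction n with
  | zero =>
    simp only [Finset.univ_eq_empty, Finset.prod_empty, lintegral_const, one_mul]
    rw [volume_pi, Measure.pi_univ]
    simp
  | succ n ih =>
    have mp := (volume_preserving_piFinSuccAbove (fun _ : Fin (n + 1) => ℝ) 0).symm
    rw [← mp.lintegral_comp_emb (MeasurableEquiv.measurableEmbedding _), Fin.prod_univ_succ]
    have e : ∀ z : ℝ × (Fin n → ℝ),
        ∏ j, g j ((MeasurableEquiv.piFinSuccAbove (fun _ : Fin (n + 1) => ℝ) 0).symm z j)
        = g 0 z.1 * ∏ j : Fin n, g j.succ (z.2 j) := by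
      intro z
      simp [Fin.prod_univ_succ, MeasurableEquiv.piFinSuccAbove, Fin.insertNthEquiv]
    simp_rw [e]
    rw [Measure.volume_eq_prod,
      lintegral_prod_mul (g := fun y : Fin n → ℝ => ∏ j : Fin n, g j.succ (y j))
        (hg 0).aemeasurable (Finset.measurable_prod _ fun j _ =>
          (hg j.succ).comp (measurable_pi_apply j)).aemeasurable, ih (fun j => hg j.succ)]

/-- Tonelli for a product in which every variable is coupled only to the `i`-th one. -/
theorem lintegral_star_eq {n : ℕ} (i : Fin (n + 1)) {F : ℝ → ℝ≥0∞} {G : Fin n → ℝ → ℝ → ℝ≥0∞}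
    (hF : Measurable F) (hG : ∀ j, Measurable (Function.uncurry (G j))) :
    ∫⁻ t : Fin (n + 1) → ℝ, F (t i) * ∏ j, G j (t i) (t (i.succAbove j))
      = ∫⁻ s, F s * ∏ j, ∫⁻ y, G j s y := by
  have mp := (volume_preserving_piFinSuccAbove (fun _ : Fin (n + 1) => ℝ) i).symm
  rw [← mp.lintegral_comp_emb (MeasurableEquiv.measurableEmbedding _)]
  have e : ∀ z : ℝ × (Fin n → ℝ),
      F ((MeasurableEquiv.piFinSuccAbove (fun _ : Fin (n + 1) => ℝ) i).symm z i) *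
      ∏ j, G j ((MeasurableEquiv.piFinSuccAbove (fun _ : Fin (n + 1) => ℝ) i).symm z i)
        ((MeasurableEquiv.piFinSuccAbove (fun _ : Fin (n + 1) => ℝ) i).symm z (i.succAbove j))
      = F z.1 * ∏ j : Fin n, G j z.1 (z.2 j) := by
    intro z
    simp [MeasurableEquiv.piFinSuccAbove, Fin.insertNthEquiv]
  simp_rw [e]
  have hm : Measurable fun z : ℝ × (Fin n → ℝ) => F z.1 * ∏ j : Fin n, G j z.1 (z.2 j) := by
    refine (hF.comp measurable_fst).mul (Finset.measurable_prod _ fun j _ => ?_)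
    exact (hG j).comp (measurable_fst.prodMk ((measurable_pi_apply j).comp measurable_snd))
  rw [Measure.volume_eq_prod, lintegral_prod _ hm.aemeasurable]
  refine lintegral_congr fun s => ?_
  have hGs : ∀ j, Measurable (G j s) := fun j => (hG j).comp measurable_prodMk_left
  dsimp only
  rw [lintegral_const_mul _ (by fun_prop), lintegral_pi_prod_eq_prod_lintegral hGs]

/-- The tuple `(s, s + κ₁, …, s + κₙ)`. -/
def baseTuple {n : ℕ} (s : ℝ) (κ : Fin n → ℝ) : Fin (n + 1) → ℝ :=
  fun j => s + (Fin.cons 0 κ : Fin (n + 1) → ℝ) j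

theorem measurable_baseTuple {n : ℕ} :
    Measurable fun z : (Fin n → ℝ) × ℝ => baseTuple z.2 z.1 := by
  rw [measurable_pi_iff]
  intro j
  refine Fin.cases ?_ (fun j => ?_) j
  · simpa [baseTuple] using measurable_snd
  · simp only [baseTuple, Fin.cons_succ]
    fun_prop

/-- The map is the shear `(s, y) ↦ (s, s + y)` after a swap of coordinates. -/
theorem measurePreserving_baseTuple (n : ℕ) :
    MeasurePreserving (fun z : (Fin n → ℝ) × ℝ => baseTuple z.2 z.1) := by
  have mp := (volume_preserving_piFinSuccAbove (fun _ : Fin (n + 1) => ℝ) 0).symm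
  have h1 : MeasurePreserving (fun z : ℝ × (Fin n → ℝ) => (z.1, (fun _ => z.1) + z.2)) := by
    rw [Measure.volume_eq_prod]
    refine MeasurePreserving.skew_product (g := fun s κ => (fun _ => s) + κ)
      (MeasurePreserving.id _) (by fun_prop) ?_
    exact .of_forall fun s => map_add_left_eq_self _ _
  have h2 : MeasurePreserving (Prod.swap : (Fin n → ℝ) × ℝ → ℝ × (Fin n → ℝ)) :=
    Measure.measurePreserving_swap
  have h3 := (mp.comp h1).comp h2
  convert h3 using 1
  ext z j
  refine Fin.cases ?_ (fun j => ?_) j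
  · simp [baseTuple, MeasurableEquiv.piFinSuccAbove, Fin.insertNthEquiv]
  · simp [baseTuple, MeasurableEquiv.piFinSuccAbove, Fin.insertNthEquiv]

theorem lintegral_baseTuple {n : ℕ} {f : (Fin (n + 1) → ℝ) → ℝ≥0∞} (hf : Measurable f) :
    ∫⁻ κ : Fin n → ℝ, ∫⁻ s, f (baseTuple s κ) = ∫⁻ t, f t := by
  rw [← (measurePreserving_baseTuple n).lintegral_comp hf, Measure.volume_eq_prod, lintegral_prod]
  exact (hf.comp measurable_baseTuple).aemeasurable

theorem integral_baseTuple {n : ℕ} {f : (Fin (n + 1) → ℝ) → ℂ} (hf : Integrable f) :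
    ∫ κ : Fin n → ℝ, ∫ s, f (baseTuple s κ) = ∫ t, f t := by
  have mp := measurePreserving_baseTuple n
  have h1 : ∫ t, f t = ∫ z : (Fin n → ℝ) × ℝ, f (baseTuple z.2 z.1) := by
    rw [← mp.map_eq, integral_map mp.aemeasurable (by rw [mp.map_eq]; exact hf.1)]
  rw [h1, Measure.volume_eq_prod, integral_prod]
  exact mp.integrable_comp_of_integrable hf

theorem measurableSet_strictMono (d : ℕ) : MeasurableSet {t : Fin d → ℝ | StrictMono t} := by
  have : {t : Fin d → ℝ | StrictMono t} = ⋂ i, ⋂ j, ⋂ _ : i < j, {t | t i < t j} := by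
    ext t; simp [StrictMono]
  rw [this]
  exact .iInter fun i => .iInter fun j => .iInter fun _ =>
    measurableSet_lt (measurable_pi_apply i) (measurable_pi_apply j)

theorem ae_injective_tuple (d : ℕ) : ∀ᵐ t : Fin d → ℝ, Function.Injective t := by
  have h : ∀ i j : Fin d, i ≠ j → ∀ᵐ t : Fin d → ℝ, t i ≠ t j := by
    intro i j hij
    set L : (Fin d → ℝ) →ₗ[ℝ] ℝ := LinearMap.proj (R := ℝ) (φ := fun _ => ℝ) i -
      LinearMap.proj (R := ℝ) (φ := fun _ => ℝ) j
    have hL : LinearMap.ker L ≠ ⊤ := by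
      intro h
      have : (Pi.single i 1 : Fin d → ℝ) ∈ LinearMap.ker L := by rw [h]; trivial
      simp [L, hij.symm] at this
    have h0 := Measure.addHaar_submodule (volume : Measure (Fin d → ℝ)) _ hL
    rw [ae_iff]
    refine measure_mono_null (fun t ht => ?_) h0
    simp only [ne_eq, not_not, Set.mem_ofPred_eq] at ht
    simp [L, ht]
  have h' : ∀ᵐ t : Fin d → ℝ, ∀ i j : Fin d, i ≠ j → t i ≠ t j := by
    rw [ae_all_iff]; intro i; rw [ae_all_iff]; intro j
    by_cases hij : i = j
    · simp [hij]
    · simpa [hij] using h i j hij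
  filter_upwards [h'] with t ht i j hij
  by_contra hne
  exact ht i j hne hij

theorem measurePreserving_comp_perm {d : ℕ} (σ : Equiv.Perm (Fin d)) :
    MeasurePreserving (fun t : Fin d → ℝ => t ∘ σ) := by
  have := volume_measurePreserving_piCongrLeft (fun _ : Fin d => ℝ) σ.symm
  have e : (fun t : Fin d → ℝ => t ∘ σ) =
      MeasurableEquiv.piCongrLeft (fun _ : Fin d => ℝ) σ.symm := by
    ext t j
    rw [MeasurableEquiv.coe_piCongrLeft, Equiv.piCongrLeft_apply, eq_rec_constant]
    rfl
  rw [e]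
  exact this

open Classical in
/-- The integral of a symmetric function is `d!` times its integral over increasing tuples. -/
theorem integral_eq_factorial_mul_setIntegral_strictMono {d : ℕ} {f : (Fin d → ℝ) → ℂ}
    (hf : Integrable f) (hsymm : ∀ (σ : Equiv.Perm (Fin d)) (t : Fin d → ℝ), f (t ∘ σ) = f t) :
    ∫ t, f t = (Nat.factorial d : ℂ) * ∫ t in {t | StrictMono t}, f t := by
  set S : Set (Fin d → ℝ) := {t | StrictMono t} with hS
  have hSm : MeasurableSet S := measurableSet_strictMono d
  -- Off the null set of tuples with ties, exactly one permutation sorts `t`, so exactly one summand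
  -- is nonzero.
  have h1 : ∀ᵐ t : Fin d → ℝ, f t = ∑ σ : Equiv.Perm (Fin d), S.indicator f (t ∘ σ) := by
    filter_upwards [ae_injective_tuple d] with t ht
    have huniq : ∀ σ : Equiv.Perm (Fin d), t ∘ σ ∈ S ↔ σ = Tuple.sort t := by
      intro σ
      have hs : StrictMono (t ∘ Tuple.sort t) :=
        (Tuple.monotone_sort t).strictMono_of_injective (ht.comp (Tuple.sort t).injective)
      constructor
      · intro hσ
        have h2 : t ∘ σ = t ∘ Tuple.sort t :=
          Tuple.unique_monotone (StrictMono.monotone hσ) (Tuple.monotone_sort t)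
        ext j
        exact congrArg _ (ht (congrFun h2 j))
      · rintro rfl; exact hs
    rw [Finset.sum_eq_single (Tuple.sort t)]
    · rw [Set.indicator_of_mem ((huniq _).2 rfl), hsymm]
    · intro σ _ hσ
      exact Set.indicator_of_notMem (fun h => hσ ((huniq σ).1 h)) _
    · simp
  have hi : Integrable (S.indicator f) := hf.indicator hSm
  rw [integral_congr_ae h1, integral_finsetSum]
  · have : ∀ σ : Equiv.Perm (Fin d), ∫ t, S.indicator f (t ∘ σ) = ∫ t in S, f t := by
      intro σ
      have mp := measurePreserving_comp_perm σ
      rw [← integral_indicator hSm]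
      conv_rhs => rw [← mp.map_eq]
      rw [integral_map mp.aemeasurable (by rw [mp.map_eq]; exact hi.1)]
    simp [this, Fintype.card_perm]
  · intro σ _
    exact (measurePreserving_comp_perm σ).integrable_comp_of_integrable hi

/-! ### One-dimensional power kernels -/

theorem lintegral_Ioc_rpow_neg {α b : ℝ} (hα : 0 < α) (hb : b < 1) :
    ∫⁻ y in Set.Ioc 0 α, ENNReal.ofReal (y ^ (-b)) = ENNReal.ofReal (α ^ (1 - b) / (1 - b)) := by
  have hi : IntervalIntegrable (fun y : ℝ => y ^ (-b)) volume 0 α :=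
    intervalIntegral.intervalIntegrable_rpow' (by linarith)
  rw [← ofReal_integral_eq_lintegral_ofReal]
  · rw [← intervalIntegral.integral_of_le hα.le, integral_rpow (Or.inl (by linarith)),
      Real.zero_rpow (by linarith)]
    congr 1
    rw [sub_zero]
    congr 1 <;> [congr 1; skip] <;> ring
  · exact (intervalIntegrable_iff_integrableOn_Ioc_of_le hα.le).1 hi
  · filter_upwards [ae_restrict_mem measurableSet_Ioc] with y hy
    exact Real.rpow_nonneg hy.1.le _

theorem lintegral_Ioi_rpow_neg {α e : ℝ} (hα : 0 < α) (he : 1 < e) :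
    ∫⁻ y in Set.Ioi α, ENNReal.ofReal (y ^ (-e)) = ENNReal.ofReal (α ^ (1 - e) / (e - 1)) := by
  rw [← ofReal_integral_eq_lintegral_ofReal]
  · rw [integral_Ioi_rpow_of_lt (by linarith) hα]
    congr 1
    rw [show -e + 1 = -(e - 1) by ring, show 1 - e = -(e - 1) by ring, neg_div_neg_eq]
  · exact integrableOn_Ioi_rpow_of_lt (by linarith) hα
  · filter_upwards [ae_restrict_mem measurableSet_Ioi] with y hy
    exact Real.rpow_nonneg (hα.trans hy).le _

theorem lintegral_comp_abs_eq (f : ℝ → ℝ≥0∞) :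
    ∫⁻ y, f |y| = 2 * ∫⁻ y in Set.Ioi 0, f y := by
  have h1 : ∫⁻ y in Set.Ioi 0, f |y| = ∫⁻ y in Set.Ioi 0, f y :=
    setLIntegral_congr_fun measurableSet_Ioi fun y hy => by
      rw [abs_of_pos hy]
  have h2 : ∫⁻ y in Set.Iic 0, f |y| = ∫⁻ y in Set.Ioi 0, f y := by
    have mp := (Measure.measurePreserving_neg (volume : Measure ℝ))
    have := mp.setLIntegral_comp_preimage_emb (MeasurableEquiv.neg ℝ).measurableEmbedding
      (fun y => f |y|) (Set.Ici 0)
    have e : (Neg.neg ⁻¹' Set.Ici (0:ℝ)) = Set.Iic 0 := by ext; simp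
    rw [e] at this
    simp only [abs_neg] at this
    rw [this, ← h1]
    exact setLIntegral_congr Ioi_ae_eq_Ici.symm
  rw [← lintegral_add_compl _ (measurableSet_Ioi (a := (0:ℝ))), Set.compl_Ioi, h1, h2, two_mul]

/-- `|y|^{-b}`, truncated to the constant `α^{-b}` for `|y| > α`. -/
noncomputable def nearKernel (b α y : ℝ) : ℝ≥0∞ :=
  ENNReal.ofReal (if |y| ≤ α then |y| ^ (-b) else α ^ (-b))

/-- `|y|^{-b}` for `|y| ≤ α`, continued with the faster decay `|y|^{-e}` for `|y| > α`. -/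
noncomputable def farKernel (b e α y : ℝ) : ℝ≥0∞ :=
  ENNReal.ofReal (if |y| ≤ α then |y| ^ (-b) else α ^ (e - b) * |y| ^ (-e))

theorem measurable_nearKernel (b α : ℝ) : Measurable (nearKernel b α) :=
  (Measurable.ite (measurableSet_le (by fun_prop) measurable_const) (by fun_prop)
    (by fun_prop)).ennreal_ofReal

theorem measurable_farKernel (b e α : ℝ) : Measurable (farKernel b e α) :=
  (Measurable.ite (measurableSet_le (by fun_prop) measurable_const) (by fun_prop)
    (by fun_prop)).ennreal_ofReal

/-- For `|y| ≤ α` both kernels equal `|y|^{-b}` and the weights add up to `1`. For `|y| > α` the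
right side exceeds the left by the factor `(|y|/α)^{b - ew} ≥ 1`. The splitting prepares an
application of Hölder's inequality with weights `1 - w` and `w`. -/
theorem rpow_neg_le_nearKernel_mul_farKernel {b e α w : ℝ} (hα : 0 < α)
    (hw0 : 0 ≤ w) (hw1 : w ≤ 1) (hew : e * w ≤ b) (y : ℝ) :
    ENNReal.ofReal (|y| ^ (-b)) ≤ nearKernel b α y ^ (1 - w) * farKernel b e α y ^ w := by
  unfold nearKernel farKernel
  split_ifs with h
  · rw [← ENNReal.rpow_add_of_nonneg _ _ (by linarith) hw0]
    simp
  · push Not at h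
    have hy : 0 < |y| := hα.trans h
    rw [ENNReal.ofReal_rpow_of_nonneg (by positivity) (by linarith),
      ENNReal.ofReal_rpow_of_nonneg (by positivity) (by linarith),
      ← ENNReal.ofReal_mul (by positivity)]
    refine ENNReal.ofReal_le_ofReal ?_
    have h1 : (α ^ (-b)) ^ (1 - w) * (α ^ (e - b) * |y| ^ (-e)) ^ w
        = |y| ^ (-b) * (|y| / α) ^ (b - e * w) := by
      rw [Real.mul_rpow (by positivity) (by positivity), Real.div_rpow hy.le hα.le,
        ← Real.rpow_mul hα.le, ← Real.rpow_mul hα.le, ← Real.rpow_mul hy.le, ← mul_assoc,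
        ← Real.rpow_add hα, div_eq_mul_inv, ← Real.rpow_neg hα.le, ← mul_assoc,
        ← Real.rpow_add hy, mul_comm]
      congr 2 <;> ring
    rw [h1]
    have h2 : 1 ≤ (|y| / α) ^ (b - e * w) :=
      Real.one_le_rpow ((one_le_div hα).2 h.le) (by linarith)
    exact le_mul_of_one_le_right (by positivity) h2

/-- The factor `α ^ (e - b)` makes the two branches of the kernel agree at `|y| = α`, so both pieces
scale like `α ^ (1 - b)`; `b < 1` gives convergence at `0` and `1 < e` at infinity. -/
theorem lintegral_farKernel {b e α : ℝ} (hα : 0 < α) (hb1 : b < 1) (he : 1 < e) :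
    ∫⁻ y, farKernel b e α y = ENNReal.ofReal ((2 / (1 - b) + 2 / (e - 1)) * α ^ (1 - b)) := by
  have h0 := lintegral_comp_abs_eq
    (fun y => ENNReal.ofReal (if y ≤ α then y ^ (-b) else α ^ (e - b) * y ^ (-e)))
  have hu : Set.Ioi (0:ℝ) = Set.Ioc 0 α ∪ Set.Ioi α := (Set.Ioc_union_Ioi_eq_Ioi hα.le).symm
  have h1 : ∫⁻ y in Set.Ioc 0 α,
      ENNReal.ofReal (if y ≤ α then y ^ (-b) else α ^ (e - b) * y ^ (-e))
      = ENNReal.ofReal (α ^ (1 - b) / (1 - b)) := by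
    rw [← lintegral_Ioc_rpow_neg hα hb1]
    exact setLIntegral_congr_fun measurableSet_Ioc fun y hy => by simp [hy.2]
  have h2 : ∫⁻ y in Set.Ioi α,
      ENNReal.ofReal (if y ≤ α then y ^ (-b) else α ^ (e - b) * y ^ (-e))
      = ENNReal.ofReal (α ^ (1 - b) / (e - 1)) := by
    have : ∀ y ∈ Set.Ioi α, ENNReal.ofReal (if y ≤ α then y ^ (-b) else α ^ (e - b) * y ^ (-e))
        = ENNReal.ofReal (α ^ (e - b)) * ENNReal.ofReal (y ^ (-e)) := fun y hy => by
      rw [if_neg (not_le.2 hy), ENNReal.ofReal_mul (by positivity)]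
    rw [setLIntegral_congr_fun measurableSet_Ioi this, lintegral_const_mul _ (by fun_prop),
      lintegral_Ioi_rpow_neg hα he, ← ENNReal.ofReal_mul (by positivity), ← mul_div_assoc,
      ← Real.rpow_add hα]
    congr 3; ring
  calc ∫⁻ y, farKernel b e α y = _ := h0
    _ = _ := by
      rw [hu, lintegral_union measurableSet_Ioi (Set.Ioc_disjoint_Ioi le_rfl), h1, h2,
        ← ENNReal.ofReal_add (by have : 0 < 1 - b := by linarith
                                 positivity) (by have : 0 < e - 1 := by linarith
                                                 positivity),
        show (2 : ℝ≥0∞) = ENNReal.ofReal 2 by simp, ← ENNReal.ofReal_mul (by norm_num)]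
      congr 1
      ring

/-- Within distance `α` of `s` the singularity is integrated without regard to `E`; beyond, the
kernel is the constant `α ^ (-b)` on a set of measure at most `α`. Both give `α ^ (1 - b)`,
uniformly in `s`. -/
theorem setLIntegral_nearKernel_sub_le {b α : ℝ} (hα : 0 < α) (hb1 : b < 1) {E : Set ℝ}
    (hEα : volume E ≤ ENNReal.ofReal α) (s : ℝ) :
    ∫⁻ y in E, nearKernel b α (y - s) ≤ ENNReal.ofReal ((2 / (1 - b) + 1) * α ^ (1 - b)) := by
  have hb : 0 < 1 - b := by linarith
  set k : ℝ → ℝ≥0∞ := fun y => ENNReal.ofReal (if y ≤ α then y ^ (-b) else 0) with hk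
  have h1 : ∀ y, nearKernel b α y ≤ k |y| + ENNReal.ofReal (α ^ (-b)) := by
    intro y
    simp only [nearKernel, hk]
    split_ifs with h
    · exact le_self_add
    · simp
  have h2 : ∫⁻ y, k |y| = ENNReal.ofReal (2 / (1 - b) * α ^ (1 - b)) := by
    rw [lintegral_comp_abs_eq, ← Set.Ioc_union_Ioi_eq_Ioi hα.le,
      lintegral_union measurableSet_Ioi (Set.Ioc_disjoint_Ioi le_rfl)]
    have e1 : ∫⁻ y in Set.Ioc 0 α, k y = ENNReal.ofReal (α ^ (1 - b) / (1 - b)) := by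
      rw [← lintegral_Ioc_rpow_neg hα hb1]
      exact setLIntegral_congr_fun measurableSet_Ioc fun y hy => by simp [hk, hy.2]
    have e2 : ∫⁻ y in Set.Ioi α, k y = 0 := by
      rw [setLIntegral_congr_fun (g := fun _ => 0) measurableSet_Ioi fun y hy => by
        simp [hk, not_le.2 (Set.mem_Ioi.1 hy)]]
      simp
    rw [e1, e2, add_zero, show (2 : ℝ≥0∞) = ENNReal.ofReal 2 by simp,
      ← ENNReal.ofReal_mul (by norm_num)]
    congr 1
    ring
  calc ∫⁻ y in E, nearKernel b α (y - s)
      ≤ ∫⁻ y in E, (k |y - s| + ENNReal.ofReal (α ^ (-b))) := lintegral_mono fun y => h1 _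
    _ = (∫⁻ y in E, k |y - s|) + ENNReal.ofReal (α ^ (-b)) * volume E := by
        rw [lintegral_add_right _ measurable_const, setLIntegral_const]
    _ ≤ (∫⁻ y, k |y - s|) + ENNReal.ofReal (α ^ (-b)) * ENNReal.ofReal α := by
        exact add_le_add (setLIntegral_le_lintegral _ _) (by gcongr)
    _ = (∫⁻ y, k |y|) + ENNReal.ofReal (α ^ (1 - b)) := by
        rw [lintegral_sub_right_eq_self (fun y => k |y|), ← ENNReal.ofReal_mul (by positivity)]
        nth_rw 2 [← Real.rpow_one α]
        rw [← Real.rpow_add hα, show -b + 1 = 1 - b by ring]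
    _ = _ := by
        rw [h2, ← ENNReal.ofReal_add (by positivity) (by positivity)]
        congr 1
        ring

/-! ### The Vandermonde product and star sums -/

/-- Each unordered pair is met twice, once from either end. -/
theorem prod_prod_succAbove_abs_sub {n : ℕ} (t : Fin (n + 1) → ℝ) :
    ∏ i, ∏ j : Fin n, |t (i.succAbove j) - t i| = |vandermondeProduct t| ^ 2 := by
  have h1 : ∀ i : Fin (n + 1), ∏ j : Fin n, |t (i.succAbove j) - t i|
      = (∏ j, if i < j then |t j - t i| else 1) * ∏ j, if j < i then |t j - t i| else 1 := by
    intro i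
    rw [← Finset.prod_mul_distrib, Fin.prod_univ_succAbove _ i]
    simp only [lt_irrefl, if_false, one_mul]
    refine Finset.prod_congr rfl fun j _ => ?_
    rcases lt_or_gt_of_ne (Fin.succAbove_ne i j) with h | h
    · simp [h, h.not_gt]
    · simp [h, h.not_gt]
  have h2 : ∏ i, ∏ j, (if i < j then |t j - t i| else 1) = |vandermondeProduct t| := by
    rw [vandermondeProduct, Finset.abs_prod]
    refine Finset.prod_congr rfl fun i _ => ?_
    rw [Finset.abs_prod, ← Finset.prod_filter]
    refine Finset.prod_congr ?_ fun _ _ => rfl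
    ext j; simp
  have h3 : ∏ i, ∏ j, (if j < i then |t j - t i| else 1) = |vandermondeProduct t| := by
    rw [Finset.prod_comm, ← h2]
    simp_rw [abs_sub_comm]
  rw [Finset.prod_congr rfl fun i _ => h1 i, Finset.prod_mul_distrib, h2, h3, sq]

/-- The sum over `i` of the products of `|t_j - t_i|^{-b}` over `j ≠ i`. -/
noncomputable def starSum {n : ℕ} (b : ℝ) (t : Fin (n + 1) → ℝ) : ℝ≥0∞ :=
  ∑ i, ∏ j : Fin n, ENNReal.ofReal (|t (i.succAbove j) - t i| ^ (-b))

theorem measurable_starSum {n : ℕ} (b : ℝ) :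
    Measurable (starSum b : (Fin (n + 1) → ℝ) → ℝ≥0∞) := by
  unfold starSum
  fun_prop

/-- The `n + 1` star products multiply to `v ^ (-2b)`, so the left side is their geometric mean,
which is at most their sum. A star couples every variable to its centre only, so its integral
factors; that of a power of `v` does not. -/
theorem vandermondeProduct_rpow_neg_le_starSum {n : ℕ} {b : ℝ} {t : Fin (n + 1) → ℝ}
    (ht : StrictMono t) :
    ENNReal.ofReal (vandermondeProduct t ^ (-(2 * b / (n + 1)))) ≤ starSum b t := by
  set a : Fin (n + 1) → ℝ := fun i => ∏ j : Fin n, |t (i.succAbove j) - t i| ^ (-b) with ha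
  have hpos : ∀ (i : Fin (n + 1)) (j : Fin n), 0 < |t (i.succAbove j) - t i| := fun i j =>
    abs_pos.2 (sub_ne_zero.2 fun h => Fin.succAbove_ne i j (ht.injective h))
  have ha0 : ∀ i, 0 < a i := fun i => Finset.prod_pos fun j _ => Real.rpow_pos_of_pos (hpos i j) _
  have e : starSum b t = ENNReal.ofReal (∑ i, a i) := by
    rw [ENNReal.ofReal_sum_of_nonneg fun i _ => (ha0 i).le, starSum]
    refine Finset.sum_congr rfl fun i _ => ?_
    rw [ENNReal.ofReal_prod_of_nonneg fun j _ => (Real.rpow_pos_of_pos (hpos i j) _).le]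
  rw [e]
  refine ENNReal.ofReal_le_ofReal ?_
  have hv := vandermondeProduct_pos ht
  have hprod : ∏ i, a i = vandermondeProduct t ^ (-(2 * b)) := by
    have : ∀ i, a i = (∏ j : Fin n, |t (i.succAbove j) - t i|) ^ (-b) := fun i =>
      Real.finsetProd_rpow _ _ (fun j _ => (hpos i j).le) _
    simp_rw [this]
    rw [Real.finsetProd_rpow _ _ (fun i _ => Finset.prod_nonneg fun j _ => (hpos i j).le),
      prod_prod_succAbove_abs_sub, abs_of_pos hv, ← Real.rpow_natCast, ← Real.rpow_mul hv.le]
    congr 1; push_cast; ring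
  have hn : (0:ℝ) < n + 1 := by positivity
  have hS : 0 < ∑ i, a i := Finset.sum_pos (fun i _ => ha0 i) Finset.univ_nonempty
  calc vandermondeProduct t ^ (-(2 * b / (n + 1))) = (∏ i, a i) ^ ((n + 1 : ℝ)⁻¹) := by
        rw [hprod, ← Real.rpow_mul hv.le]; congr 1; field_simp
    _ ≤ (∏ _i : Fin (n + 1), ∑ i, a i) ^ ((n + 1 : ℝ)⁻¹) := by
        refine Real.rpow_le_rpow (Finset.prod_nonneg fun i _ => (ha0 i).le) ?_ (by positivity)
        exact Finset.prod_le_prod (fun i _ => (ha0 i).le)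
          fun i _ => Finset.single_le_sum (fun i _ => (ha0 i).le) (Finset.mem_univ i)
    _ = ∑ i, a i := by
        rw [Finset.prod_const, Finset.card_univ, Fintype.card_fin, ← Real.rpow_natCast,
          ← Real.rpow_mul hS.le]
        push_cast
        rw [mul_inv_cancel₀ hn.ne', Real.rpow_one]

/-! ### Integrals of star sums over tuples in `E` and over the gaps `κ` -/

/-- The set of `s` for which all entries of the tuple `(s, s + κ₁, …, s + κₙ)` lie in `E`. -/
def baseSet {n : ℕ} (E : Set ℝ) (κ : Fin n → ℝ) : Set ℝ := {s | ∀ j, baseTuple s κ j ∈ E}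

theorem measurableSet_tuple_mem {d : ℕ} {E : Set ℝ} (hE : MeasurableSet E) :
    MeasurableSet {t : Fin d → ℝ | ∀ j, t j ∈ E} := by
  have : {t : Fin d → ℝ | ∀ j, t j ∈ E} = Set.univ.pi fun _ => E := by ext; simp
  rw [this]
  exact MeasurableSet.univ_pi fun _ => hE

theorem measurableSet_baseSet {n : ℕ} {E : Set ℝ} (hE : MeasurableSet E) (κ : Fin n → ℝ) :
    MeasurableSet (baseSet E κ) :=
  (measurable_baseTuple.comp measurable_prodMk_left) (measurableSet_tuple_mem hE)

theorem measurable_volume_baseSet {n : ℕ} {E : Set ℝ} (hE : MeasurableSet E) :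
    Measurable fun κ : Fin n → ℝ => volume (baseSet E κ) :=
  measurable_measure_prodMk_left (measurable_baseTuple (measurableSet_tuple_mem hE))

theorem indicator_tuple_mem_eq_prod {n : ℕ} {E : Set ℝ} (i : Fin (n + 1)) (t : Fin (n + 1) → ℝ) :
    {t : Fin (n + 1) → ℝ | ∀ j, t j ∈ E}.indicator (1 : (Fin (n + 1) → ℝ) → ℝ≥0∞) t
      = E.indicator 1 (t i) * ∏ j : Fin n, E.indicator (1 : ℝ → ℝ≥0∞) (t (i.succAbove j)) := by
  rw [← Fin.prod_univ_succAbove (fun j => E.indicator (1 : ℝ → ℝ≥0∞) (t j))]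
  by_cases h : ∀ j, t j ∈ E
  · rw [Set.indicator_of_mem (by exact h)]
    simp [h]
  · rw [Set.indicator_of_notMem (by exact h)]
    push Not at h
    obtain ⟨j, hj⟩ := h
    exact (Finset.prod_eq_zero (Finset.mem_univ j) (by simp [hj])).symm

/-- Integration of a translation invariant function of tuples in `E`. -/
theorem lintegral_volume_baseSet_mul {n : ℕ} {E : Set ℝ} (hE : MeasurableSet E)
    {f : (Fin (n + 1) → ℝ) → ℝ≥0∞} (hf : Measurable f)
    (hinv : ∀ s κ, f (baseTuple s κ) = f (baseTuple 0 κ)) :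
    ∫⁻ κ : Fin n → ℝ, volume (baseSet E κ) * f (baseTuple 0 κ)
      = ∫⁻ t in {t | ∀ j, t j ∈ E}, f t := by
  have hEm := measurableSet_tuple_mem (d := n + 1) hE
  rw [← lintegral_indicator hEm, ← lintegral_baseTuple (hf.indicator hEm)]
  refine lintegral_congr fun κ => ?_
  have : ∀ s, Set.indicator {t : Fin (n + 1) → ℝ | ∀ j, t j ∈ E} f (baseTuple s κ)
      = (baseSet E κ).indicator (fun _ => f (baseTuple 0 κ)) s := by
    intro s
    by_cases h : ∀ j, baseTuple s κ j ∈ E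
    · rw [Set.indicator_of_mem (by exact h), Set.indicator_of_mem (by exact h), hinv]
    · rw [Set.indicator_of_notMem (by exact h), Set.indicator_of_notMem (by exact h)]
  simp_rw [this]
  rw [lintegral_indicator (measurableSet_baseSet hE κ), setLIntegral_const, mul_comm]

/-- With the centre `t i` fixed the other `n` variables are independent and each contributes at most
`C`; the centre then contributes `volume E`. -/
theorem setLIntegral_prod_succAbove_le {n : ℕ} {E : Set ℝ} (hE : MeasurableSet E)
    {k : ℝ → ℝ≥0∞} (hk : Measurable k) {C : ℝ≥0∞} (hC : ∀ s, ∫⁻ y in E, k (y - s) ≤ C)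
    (i : Fin (n + 1)) :
    ∫⁻ t in {t : Fin (n + 1) → ℝ | ∀ j, t j ∈ E},
      ∏ j : Fin n, k (t (i.succAbove j) - t i) ≤ volume E * C ^ n := by
  have hEm := measurableSet_tuple_mem (d := n + 1) hE
  have e : ∀ t : Fin (n + 1) → ℝ, Set.indicator {t : Fin (n + 1) → ℝ | ∀ j, t j ∈ E}
      (fun t => ∏ j : Fin n, k (t (i.succAbove j) - t i)) t
      = E.indicator 1 (t i) *
        ∏ j : Fin n, (E.indicator 1 (t (i.succAbove j)) * k (t (i.succAbove j) - t i)) := by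
    intro t
    rw [Finset.prod_mul_distrib, ← mul_assoc, ← indicator_tuple_mem_eq_prod]
    by_cases h : ∀ j, t j ∈ E
    · rw [Set.indicator_of_mem (by exact h), Set.indicator_of_mem (by exact h)]; simp
    · rw [Set.indicator_of_notMem (by exact h), Set.indicator_of_notMem (by exact h)]; simp
  rw [← lintegral_indicator hEm]
  simp_rw [e]
  have hind : Measurable (E.indicator (1 : ℝ → ℝ≥0∞)) := measurable_one.indicator hE
  rw [lintegral_star_eq i (F := E.indicator 1) (G := fun _ s y => E.indicator 1 y * k (y - s)) hind
    (fun j => by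
      exact (hind.comp measurable_snd).mul (hk.comp (measurable_snd.sub measurable_fst)))]
  have e2 : ∀ s, ∫⁻ y, E.indicator 1 y * k (y - s) = ∫⁻ y in E, k (y - s) := by
    intro s
    rw [← lintegral_indicator hE]
    refine lintegral_congr fun y => ?_
    by_cases h : y ∈ E <;> simp [h]
  calc _ ≤ ∫⁻ s, E.indicator 1 s * C ^ n := by
        refine lintegral_mono fun s => ?_
        gcongr
        simp only [e2, Finset.prod_const, Finset.card_univ, Fintype.card_fin]
        gcongr
        exact hC s
    _ = volume E * C ^ n := by
        rw [lintegral_mul_const _ hind, lintegral_indicator_one hE]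

/-- Entry `0` is frozen, but the centre `i` may be another entry. Averaging over a base point in a
unit interval restores a star integral over all tuples, with a cutoff on entry `0`, and Tonelli may
then start from any centre. -/
theorem lintegral_prod_succAbove_baseTuple_zero {n : ℕ} {k : ℝ → ℝ≥0∞} (hk : Measurable k)
    (i : Fin (n + 1)) :
    ∫⁻ κ : Fin n → ℝ, ∏ j : Fin n, k (baseTuple 0 κ (i.succAbove j) - baseTuple 0 κ i)
      = (∫⁻ y, k y) ^ n := by
  set Q : Set ℝ := Set.Icc 0 1
  have hQ : MeasurableSet Q := measurableSet_Icc
  have hQ1 : volume Q = 1 := by simp [Q]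
  have hind : Measurable (Q.indicator (1 : ℝ → ℝ≥0∞)) := measurable_one.indicator hQ
  have h1 : ∫⁻ κ : Fin n → ℝ, ∏ j : Fin n, k (baseTuple 0 κ (i.succAbove j) - baseTuple 0 κ i)
      = ∫⁻ t : Fin (n + 1) → ℝ, Q.indicator 1 (t 0) *
        ∏ j : Fin n, k (t (i.succAbove j) - t i) := by
    have hm : Measurable fun t : Fin (n + 1) → ℝ => Q.indicator 1 (t 0) *
        ∏ j : Fin n, k (t (i.succAbove j) - t i) := by fun_prop
    rw [← lintegral_baseTuple hm]
    refine lintegral_congr fun κ => ?_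
    have : ∀ s, Q.indicator 1 (baseTuple s κ 0) *
        ∏ j : Fin n, k (baseTuple s κ (i.succAbove j) - baseTuple s κ i)
        = Q.indicator 1 s *
        ∏ j : Fin n, k (baseTuple 0 κ (i.succAbove j) - baseTuple 0 κ i) := by
      intro s
      congr 1
      · simp [baseTuple]
      · refine Finset.prod_congr rfl fun j _ => ?_
        simp [baseTuple]
    simp_rw [this]
    rw [lintegral_mul_const _ hind, lintegral_indicator_one hQ, hQ1, one_mul]
  have hks : ∀ s, ∫⁻ y, k (y - s) = ∫⁻ y, k y := fun s => lintegral_sub_right_eq_self k s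
  rw [h1]
  rcases eq_or_ne i 0 with rfl | hi
  · rw [lintegral_star_eq 0 (F := Q.indicator 1) (G := fun _ s y => k (y - s)) hind
      (fun j => hk.comp (measurable_snd.sub measurable_fst))]
    simp only [hks, Finset.prod_const, Finset.card_univ, Fintype.card_fin]
    rw [lintegral_mul_const _ hind, lintegral_indicator_one hQ, hQ1, one_mul]
  -- Entry `0` is now the leaf `j₀` of the star. It carries the cutoff, so the centre is integrated
  -- before this leaf.
  · obtain ⟨j₀, hj₀⟩ := Fin.exists_succAbove_eq hi.symm
    have e : ∀ t : Fin (n + 1) → ℝ, Q.indicator 1 (t 0) *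
        ∏ j : Fin n, k (t (i.succAbove j) - t i) = 1 *
        ∏ j : Fin n, ((if j = j₀ then Q.indicator 1 (t (i.succAbove j)) else 1) *
          k (t (i.succAbove j) - t i)) := by
      intro t
      rw [Finset.prod_mul_distrib, one_mul]
      congr 1
      rw [Finset.prod_ite_eq' Finset.univ j₀ (fun j => Q.indicator 1 (t (i.succAbove j)))]
      simp [hj₀]
    simp_rw [e]
    rw [lintegral_star_eq i (F := fun _ => 1)
      (G := fun j s y => (if j = j₀ then Q.indicator 1 y else 1) * k (y - s)) measurable_const
      (fun j => by
        refine Measurable.mul ?_ (hk.comp (measurable_snd.sub measurable_fst))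
        by_cases h : j = j₀
        · simp only [h, if_true]
          exact hind.comp measurable_snd
        · simp [h])]
    have e3 : ∀ s, ∏ j, ∫⁻ y, (if j = j₀ then Q.indicator 1 y else 1) * k (y - s)
        = (∫⁻ y, Q.indicator 1 y * k (y - s)) * (∫⁻ y, k y) ^ (n - 1) := by
      intro s
      rw [← Finset.mul_prod_erase _ _ (Finset.mem_univ j₀)]
      congr 1
      · simp
      · rw [Finset.prod_congr rfl (g := fun _ => ∫⁻ y, k y)
          (fun j hj => by simp [Finset.ne_of_mem_erase hj, hks])]
        simp
    simp_rw [e3, one_mul]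
    have hm2 : Measurable fun z : ℝ × ℝ => Q.indicator 1 z.2 * k (z.2 - z.1) :=
      (hind.comp measurable_snd).mul (hk.comp (measurable_snd.sub measurable_fst))
    rw [lintegral_mul_const _ (hm2.lintegral_prod_right'),
      lintegral_lintegral_swap hm2.aemeasurable]
    have e4 : ∀ y, ∫⁻ s, Q.indicator 1 y * k (y - s) = Q.indicator 1 y * ∫⁻ y, k y := by
      intro y
      rw [lintegral_const_mul _ (by fun_prop), lintegral_sub_left_eq_self k y]
    simp_rw [e4]
    rw [lintegral_mul_const _ hind, lintegral_indicator_one hQ, hQ1, one_mul]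
    have hn : n ≠ 0 := by rintro rfl; exact j₀.elim0
    rw [← pow_succ', Nat.sub_add_cancel (Nat.pos_of_ne_zero hn)]

theorem setLIntegral_starSum_le {n : ℕ} {b α : ℝ} (hα : 0 < α) (hb0 : 0 ≤ b) (hb1 : b < 1)
    {E : Set ℝ} (hE : MeasurableSet E) (hEα : volume E = ENNReal.ofReal α) :
    ∫⁻ t in {t : Fin (n + 1) → ℝ | ∀ j, t j ∈ E}, starSum b t ≤
      ENNReal.ofReal ((n + 1) * (2 / (1 - b) + 1) ^ n * α ^ (1 + n * (1 - b))) := by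
  have hb : 0 < 1 - b := by linarith
  have h1 : ∀ t : Fin (n + 1) → ℝ,
      starSum b t ≤ ∑ i, ∏ j : Fin n, nearKernel b α (t (i.succAbove j) - t i) := by
    intro t
    refine Finset.sum_le_sum fun i _ => Finset.prod_le_prod' fun j _ => ?_
    -- With weight `w = 0` the far kernel drops out, so the value `e = 0` plays no role.
    simpa using rpow_neg_le_nearKernel_mul_farKernel (b := b) (e := 0) (w := 0) hα le_rfl
      zero_le_one (by simpa using hb0) (t (i.succAbove j) - t i)
  have hm := measurable_nearKernel b α
  calc _ ≤ ∫⁻ t in {t : Fin (n + 1) → ℝ | ∀ j, t j ∈ E},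
        ∑ i, ∏ j : Fin n, nearKernel b α (t (i.succAbove j) - t i) := lintegral_mono h1
    _ = ∑ i, ∫⁻ t in {t : Fin (n + 1) → ℝ | ∀ j, t j ∈ E},
        ∏ j : Fin n, nearKernel b α (t (i.succAbove j) - t i) :=
        lintegral_finsetSum _ fun i _ => by fun_prop
    _ ≤ ∑ _i : Fin (n + 1), volume E *
        ENNReal.ofReal ((2 / (1 - b) + 1) * α ^ (1 - b)) ^ n :=
        Finset.sum_le_sum fun i _ => setLIntegral_prod_succAbove_le hE hm
          (fun s => setLIntegral_nearKernel_sub_le hα hb1 hEα.le s) i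
    _ = _ := by
        rw [Finset.sum_const, Finset.card_univ, Fintype.card_fin, hEα,
          ← ENNReal.ofReal_pow (by positivity), ← ENNReal.ofReal_mul hα.le,
          ← ENNReal.ofReal_nsmul, nsmul_eq_mul, Real.rpow_add hα, Real.rpow_one, mul_pow,
          ← Real.rpow_natCast (α ^ (1 - b)), ← Real.rpow_mul hα.le]
        congr 1
        push_cast
        rw [mul_comm (1 - b)]
        ring

/-- `E` may be widely spread, so `κ` ranges over an unbounded set, and only the first power of
`volume (baseSet E κ)` is controlled by Tonelli. Hölder with weights `1 - w` and `w` pairs that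
first power with the near kernels and leaves to the far kernels, integrable on the whole line, the
missing power `w`. -/
theorem lintegral_volume_baseSet_rpow_mul_starSum_le {n : ℕ} {b e w α : ℝ} (hα : 0 < α)
    (hb1 : b < 1) (he : 1 < e) (hw0 : 0 ≤ w) (hw1 : w ≤ 1) (hew : e * w ≤ b)
    {E : Set ℝ} (hE : MeasurableSet E) (hEα : volume E = ENNReal.ofReal α) :
    ∫⁻ κ : Fin n → ℝ, volume (baseSet E κ) ^ (1 - w) * starSum b (baseTuple 0 κ) ≤
      ENNReal.ofReal ((n + 1) * (((2 / (1 - b) + 1) ^ n) ^ (1 - w) *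
        ((2 / (1 - b) + 2 / (e - 1)) ^ n) ^ w) * α ^ (1 - w + n * (1 - b))) := by
  have hb : 0 < 1 - b := by linarith
  have he' : 0 < e - 1 := by linarith
  have hw1' : 0 ≤ 1 - w := by linarith
  have hm1 := measurable_nearKernel b α
  have hm2 := measurable_farKernel b e α
  have hmb : ∀ j : Fin (n + 1), Measurable fun κ : Fin n → ℝ => baseTuple 0 κ j := fun j =>
    (measurable_pi_apply j).comp (measurable_baseTuple.comp measurable_prodMk_right)
  have hmV := measurable_volume_baseSet (n := n) hE
  set Ψ₁ : Fin (n + 1) → (Fin n → ℝ) → ℝ≥0∞ := fun i κ =>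
    ∏ j : Fin n, nearKernel b α (baseTuple 0 κ (i.succAbove j) - baseTuple 0 κ i) with hΨ₁
  set Ψ₂ : Fin (n + 1) → (Fin n → ℝ) → ℝ≥0∞ := fun i κ =>
    ∏ j : Fin n, farKernel b e α (baseTuple 0 κ (i.succAbove j) - baseTuple 0 κ i) with hΨ₂
  have hΨ₁m : ∀ i, Measurable (Ψ₁ i) := fun i =>
    Finset.measurable_prod _ fun j _ => hm1.comp ((hmb _).sub (hmb _))
  have hΨ₂m : ∀ i, Measurable (Ψ₂ i) := fun i =>
    Finset.measurable_prod _ fun j _ => hm2.comp ((hmb _).sub (hmb _))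
  have h1 : ∀ κ : Fin n → ℝ, volume (baseSet E κ) ^ (1 - w) * starSum b (baseTuple 0 κ)
      ≤ ∑ i, (volume (baseSet E κ) * Ψ₁ i κ) ^ (1 - w) * Ψ₂ i κ ^ w := by
    intro κ
    rw [starSum, Finset.mul_sum]
    refine Finset.sum_le_sum fun i _ => ?_
    rw [ENNReal.mul_rpow_of_nonneg _ _ hw1', mul_assoc]
    gcongr
    simp only [hΨ₁, hΨ₂]
    rw [← ENNReal.prod_rpow_of_nonneg hw1', ← ENNReal.prod_rpow_of_nonneg hw0,
      ← Finset.prod_mul_distrib]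
    exact Finset.prod_le_prod' fun j _ => rpow_neg_le_nearKernel_mul_farKernel hα hw0 hw1 hew _
  have h2 : ∀ i, ∫⁻ κ : Fin n → ℝ, volume (baseSet E κ) * Ψ₁ i κ ≤
      volume E * ENNReal.ofReal ((2 / (1 - b) + 1) * α ^ (1 - b)) ^ n := by
    intro i
    have e1 := lintegral_volume_baseSet_mul hE
      (f := fun t => ∏ j : Fin n, nearKernel b α (t (i.succAbove j) - t i)) (by fun_prop)
      (fun s κ => by simp [baseTuple])
    rw [e1]
    exact setLIntegral_prod_succAbove_le hE hm1
      (fun s => setLIntegral_nearKernel_sub_le hα hb1 hEα.le s) i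
  have h3 : ∀ i, ∫⁻ κ : Fin n → ℝ, Ψ₂ i κ =
      ENNReal.ofReal ((2 / (1 - b) + 2 / (e - 1)) * α ^ (1 - b)) ^ n := by
    intro i
    rw [lintegral_prod_succAbove_baseTuple_zero hm2, lintegral_farKernel hα hb1 he]
  calc _ ≤ ∫⁻ κ : Fin n → ℝ, ∑ i, (volume (baseSet E κ) * Ψ₁ i κ) ^ (1 - w) * Ψ₂ i κ ^ w :=
        lintegral_mono h1
    _ = ∑ i, ∫⁻ κ : Fin n → ℝ, (volume (baseSet E κ) * Ψ₁ i κ) ^ (1 - w) * Ψ₂ i κ ^ w :=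
        lintegral_finsetSum _ fun i _ =>
          ((hmV.mul (hΨ₁m i)).pow_const _).mul ((hΨ₂m i).pow_const _)
    _ ≤ ∑ _i : Fin (n + 1),
        (volume E * ENNReal.ofReal ((2 / (1 - b) + 1) * α ^ (1 - b)) ^ n) ^ (1 - w) *
        (ENNReal.ofReal ((2 / (1 - b) + 2 / (e - 1)) * α ^ (1 - b)) ^ n) ^ w := by
        refine Finset.sum_le_sum fun i _ => ?_
        refine (ENNReal.lintegral_mul_norm_pow_le (hmV.mul (hΨ₁m i)).aemeasurable
          (hΨ₂m i).aemeasurable hw1' hw0 (by ring)).trans ?_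
        rw [h3]
        gcongr
        exact h2 i
    _ = _ := by
        rw [Finset.sum_const, Finset.card_univ, Fintype.card_fin, hEα,
          ← ENNReal.ofReal_pow (by positivity), ← ENNReal.ofReal_mul hα.le,
          ← ENNReal.ofReal_pow (by positivity),
          ENNReal.ofReal_rpow_of_nonneg (by positivity) hw1',
          ENNReal.ofReal_rpow_of_nonneg (by positivity) hw0, ← ENNReal.ofReal_mul (by positivity),
          ← ENNReal.ofReal_nsmul, nsmul_eq_mul]
        congr 1
        have e1 : (α ^ (1 - b)) ^ n = α ^ (n * (1 - b)) := by
          rw [← Real.rpow_natCast, ← Real.rpow_mul hα.le, mul_comm]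
        rw [mul_pow, mul_pow, e1, Real.mul_rpow hα.le (by positivity),
          Real.mul_rpow (by positivity) (by positivity),
          Real.mul_rpow (by positivity) (by positivity), ← Real.rpow_mul hα.le,
          ← Real.rpow_mul hα.le]
        have e2 : α ^ (1 - w + n * (1 - b)) =
            α ^ (1 - w) * (α ^ (n * (1 - b) * (1 - w)) * α ^ (n * (1 - b) * w)) := by
          rw [← Real.rpow_add hα, ← Real.rpow_add hα]; congr 1; ring
        rw [e2]
        push_cast
        ring

/-! ### The extension operator, its `d`-th power and its slices -/

/-- The extension operator `g ↦ ∫ e^{-i x·ζ(t)} g(t) dt` of the curve `ζ`. -/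
noncomputable def curveExtension {d : ℕ} (ζ : ℝ → EuclideanSpace ℝ (Fin d)) (g : ℝ → ℂ)
    (x : EuclideanSpace ℝ (Fin d)) : ℂ :=
  ∫ t, Complex.exp (-(Complex.I * ((inner ℝ x (ζ t) : ℝ) : ℂ))) * g t

theorem norm_exp_neg_I_mul_ofReal (r : ℝ) : ‖Complex.exp (-(Complex.I * (r : ℂ)))‖ = 1 := by
  rw [show -(Complex.I * (r : ℂ)) = ((-r : ℝ) : ℂ) * Complex.I by push_cast; ring]
  exact Complex.norm_exp_ofReal_mul_I _

theorem measurable_uncurry_exp_inner {X d : Type*} [MeasurableSpace X] [Fintype d]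
    {u v : X → EuclideanSpace ℝ d} (hu : Measurable u) (hv : Measurable v) :
    Measurable fun z => Complex.exp (-(Complex.I * ((inner ℝ (u z) (v z) : ℝ) : ℂ))) := by
  have : Measurable fun z => inner ℝ (u z) (v z) := hu.inner hv
  fun_prop

theorem measurable_curveSum {d : ℕ} {ζ : ℝ → EuclideanSpace ℝ (Fin d)} (hζ : Measurable ζ) :
    Measurable (curveSum ζ) := by
  unfold curveSum
  fun_prop

theorem integrable_exp_mul {X : Type*} [MeasurableSpace X] {μ : Measure X} {d : ℕ} {g : X → ℂ}
    (hg : Integrable g μ) (x : EuclideanSpace ℝ (Fin d)) {v : X → EuclideanSpace ℝ (Fin d)}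
    (hv : Measurable v) :
    Integrable (fun t => Complex.exp (-(Complex.I * ((inner ℝ x (v t) : ℝ) : ℂ))) * g t) μ := by
  refine hg.bdd_mul (c := 1)
    (measurable_uncurry_exp_inner measurable_const hv).aestronglyMeasurable ?_
  exact .of_forall fun t => (norm_exp_neg_I_mul_ofReal _).le

/-- The `d`-th power of an integral is the integral of the product over all tuples. The product is
symmetric in the tuple, so increasing tuples account for the fraction `1/d!`. -/
theorem curveExtension_pow_eq {d : ℕ} {ζ : ℝ → EuclideanSpace ℝ (Fin d)} (hζ : Measurable ζ)
    {g : ℝ → ℂ} (hg : Integrable g) (x : EuclideanSpace ℝ (Fin d)) :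
    curveExtension ζ g x ^ d = (Nat.factorial d : ℂ) *
      tupleExtension ζ {t | StrictMono t} (fun t => ∏ j, g (t j)) x := by
  have e : ∀ t : Fin d → ℝ, Complex.exp (-(Complex.I * ((inner ℝ x (curveSum ζ t) : ℝ) : ℂ))) *
      ∏ j, g (t j) = ∏ j, (Complex.exp (-(Complex.I * ((inner ℝ x (ζ (t j)) : ℝ) : ℂ))) *
        g (t j)) := by
    intro t
    rw [Finset.prod_mul_distrib, ← Complex.exp_sum]
    congr 2
    simp [curveSum, inner_sum, Finset.mul_sum]
  have hi : Integrable fun t : Fin d → ℝ =>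
      Complex.exp (-(Complex.I * ((inner ℝ x (curveSum ζ t) : ℝ) : ℂ))) * ∏ j, g (t j) :=
    integrable_exp_mul (Integrable.fintype_prod fun _ => hg) x (measurable_curveSum hζ)
  rw [tupleExtension, ← integral_eq_factorial_mul_setIntegral_strictMono hi]
  · simp_rw [e]
    rw [integral_fintype_prod_volume_eq_pow (fun t => Complex.exp
      (-(Complex.I * ((inner ℝ x (ζ t) : ℝ) : ℂ))) * g t), Fintype.card_fin]
    rfl
  · intro σ t
    rw [e t, e (t ∘ σ)]
    exact Equiv.prod_comp σ (fun j => Complex.exp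
      (-(Complex.I * ((inner ℝ x (ζ (t j)) : ℝ) : ℂ))) * g (t j))

/-- The curve `s ↦ ζ(s) + ζ(s + κ₁) + ⋯ + ζ(s + κₙ)`. -/
noncomputable def translateSum {n : ℕ} (ζ : ℝ → EuclideanSpace ℝ (Fin (n + 1)))
    (κ : Fin n → ℝ) (s : ℝ) : EuclideanSpace ℝ (Fin (n + 1)) :=
  curveSum ζ (baseTuple s κ)

theorem measurable_curveExtension {d : ℕ} {ζ : ℝ → EuclideanSpace ℝ (Fin d)} (hζ : Measurable ζ)
    {g : ℝ → ℂ} (hg : Measurable g) : Measurable (curveExtension ζ g) := by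
  have hm : Measurable fun z : EuclideanSpace ℝ (Fin d) × ℝ =>
      Complex.exp (-(Complex.I * ((inner ℝ z.1 (ζ z.2) : ℝ) : ℂ))) * g z.2 :=
    (measurable_uncurry_exp_inner measurable_fst (hζ.comp measurable_snd)).mul
      (hg.comp measurable_snd)
  exact hm.stronglyMeasurable.integral_prod_right'.measurable

theorem measurable_tupleExtension {d : ℕ} {ζ : ℝ → EuclideanSpace ℝ (Fin d)} (hζ : Measurable ζ)
    {F : (Fin d → ℝ) → ℂ} (hF : Measurable F) (Ω : Set (Fin d → ℝ)) :
    Measurable (tupleExtension ζ Ω F) := by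
  have hm : Measurable fun z : EuclideanSpace ℝ (Fin d) × (Fin d → ℝ) =>
      Complex.exp (-(Complex.I * ((inner ℝ z.1 (curveSum ζ z.2) : ℝ) : ℂ))) * F z.2 :=
    (measurable_uncurry_exp_inner measurable_fst ((measurable_curveSum hζ).comp measurable_snd)).mul
      (hF.comp measurable_snd)
  exact (hm.stronglyMeasurable.integral_prod_right' (ν := volume.restrict Ω)).measurable

/-- Slicing a translation invariant set of tuples along the diagonal direction. -/
theorem setLIntegral_enorm_tupleExtension_le {n : ℕ} {ζ : ℝ → EuclideanSpace ℝ (Fin (n + 1))}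
    (hζ : Measurable ζ) {g : ℝ → ℂ} (hgm : Measurable g) (hg : Integrable g)
    {Ω : Set (Fin (n + 1) → ℝ)} (hΩ : MeasurableSet Ω)
    (hinv : ∀ s κ, baseTuple s κ ∈ Ω ↔ baseTuple 0 κ ∈ Ω)
    (A : Set (EuclideanSpace ℝ (Fin (n + 1)))) :
    ∫⁻ x in A, ‖tupleExtension ζ Ω (fun t => ∏ j, g (t j)) x‖ₑ ≤
      ∫⁻ κ in {κ : Fin n → ℝ | baseTuple 0 κ ∈ Ω}, ∫⁻ x in A,
        ‖curveExtension (translateSum ζ κ) (fun s => ∏ j, g (baseTuple s κ j)) x‖ₑ := by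
  have hmb0 : Measurable fun κ : Fin n → ℝ => baseTuple 0 κ :=
    measurable_baseTuple.comp measurable_prodMk_right
  have hΩ0 : MeasurableSet {κ : Fin n → ℝ | baseTuple 0 κ ∈ Ω} := hmb0 hΩ
  have hpt : ∀ x, ‖tupleExtension ζ Ω (fun t => ∏ j, g (t j)) x‖ₑ ≤
      ∫⁻ κ in {κ : Fin n → ℝ | baseTuple 0 κ ∈ Ω},
        ‖curveExtension (translateSum ζ κ) (fun s => ∏ j, g (baseTuple s κ j)) x‖ₑ := by
    intro x
    have hi : Integrable fun t : Fin (n + 1) → ℝ =>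
        Complex.exp (-(Complex.I * ((inner ℝ x (curveSum ζ t) : ℝ) : ℂ))) * ∏ j, g (t j) :=
      integrable_exp_mul (Integrable.fintype_prod fun _ => hg) x (measurable_curveSum hζ)
    rw [tupleExtension, ← integral_indicator hΩ, ← integral_baseTuple (hi.indicator hΩ)]
    refine (enorm_integral_le_lintegral_enorm _).trans ?_
    rw [← lintegral_indicator hΩ0]
    refine lintegral_mono fun κ => ?_
    by_cases h : baseTuple 0 κ ∈ Ω
    · rw [Set.indicator_of_mem (by exact h)]
      refine le_of_eq ?_
      congr 1
      refine integral_congr_ae (.of_forall fun s => ?_)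
      simp only
      rw [Set.indicator_of_mem ((hinv s κ).2 h)]
      rfl
    · rw [Set.indicator_of_notMem (by exact h)]
      have : ∀ s, Ω.indicator (fun t : Fin (n + 1) → ℝ =>
        Complex.exp (-(Complex.I * ((inner ℝ x (curveSum ζ t) : ℝ) : ℂ))) * ∏ j, g (t j))
          (baseTuple s κ) = 0 := fun s =>
        Set.indicator_of_notMem (fun h' => h ((hinv s κ).1 h')) _
      simp [this]
  refine (lintegral_mono hpt).trans ?_
  refine (lintegral_lintegral_swap ?_).le
  have hm : Measurable fun z : (EuclideanSpace ℝ (Fin (n + 1)) × (Fin n → ℝ)) × ℝ =>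
      Complex.exp (-(Complex.I * ((inner ℝ z.1.1 (curveSum ζ (baseTuple z.2 z.1.2)) : ℝ) : ℂ))) *
        ∏ j, g (baseTuple z.2 z.1.2 j) := by
    have hb : Measurable fun z : (EuclideanSpace ℝ (Fin (n + 1)) × (Fin n → ℝ)) × ℝ =>
        baseTuple z.2 z.1.2 :=
      measurable_baseTuple.comp ((measurable_snd.comp measurable_fst).prodMk measurable_snd)
    refine (measurable_uncurry_exp_inner (measurable_fst.comp measurable_fst)
      ((measurable_curveSum hζ).comp hb)).mul ?_
    exact Finset.measurable_prod _ fun j _ => hgm.comp ((measurable_pi_apply j).comp hb)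
  exact hm.stronglyMeasurable.integral_prod_right'.measurable.enorm.aemeasurable

/-! ### Admissible families and restricted bounds -/

/-- A family of curves, closed under the formation of sums of translates, all of whose members
satisfy the injectivity hypothesis and the geometric inequality with constant `δ`. -/
structure IsAdmissibleFamily {n : ℕ} (δ : ℝ)
    (P : (ℝ → EuclideanSpace ℝ (Fin (n + 1))) → Set ℝ → Prop) : Prop where
  continuous : ∀ {ζ J}, P ζ J → Continuous ζ
  measurableSet : ∀ {ζ J}, P ζ J → MeasurableSet J
  volume_ne_top : ∀ {ζ J}, P ζ J → volume J ≠ ∞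
  differentiableOn : ∀ {ζ J}, P ζ J → DifferentiableOn ℝ ζ J
  injOn : ∀ {ζ J}, P ζ J → Set.InjOn (curveSum ζ) {t | StrictMono t ∧ ∀ j, t j ∈ J}
  jacobian : ∀ {ζ J}, P ζ J → J.Nontrivial → ∀ t : Fin (n + 1) → ℝ, (∀ j, t j ∈ J) →
    δ * |vandermondeProduct t| ≤ |curveSumJacobian ζ J t|
  translateSum : ∀ {ζ J}, P ζ J → ∀ κ : Fin n → ℝ, StrictMono (baseTuple 0 κ) →
    P (translateSum ζ κ) (baseSet J κ)

/-- The restricted weak type bound with `|E|^{1 - Du}` and `|A|^{1 - u}`, `D = (n + 1)(n + 2)/2`. -/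
def RestrictedBound {n : ℕ} (P : (ℝ → EuclideanSpace ℝ (Fin (n + 1))) → Set ℝ → Prop)
    (N u K : ℝ) : Prop :=
  ∀ ⦃ζ J⦄, P ζ J → ∀ ⦃E : Set ℝ⦄, E ⊆ J → MeasurableSet E → ∀ ⦃g : ℝ → ℂ⦄, Measurable g →
    (∀ t, ‖g t‖ ≤ E.indicator 1 t) → ∀ ⦃A : Set (EuclideanSpace ℝ (Fin (n + 1)))⦄,
    MeasurableSet A →
    ∫⁻ x in A, ‖curveExtension ζ g x‖ₑ ≤ ENNReal.ofReal (K * N ^ u) *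
      volume E ^ (1 - (n + 1) * (n + 2) / 2 * u) * volume A ^ (1 - u)

theorem integrable_of_norm_le_indicator {X : Type*} [MeasurableSpace X] {μ : Measure X} {E : Set X}
    (hE : MeasurableSet E) (hfin : μ E ≠ ∞) {g : X → ℂ} (hg : Measurable g)
    (hgE : ∀ t, ‖g t‖ ≤ E.indicator 1 t) : Integrable g μ := by
  have h1 : Integrable (E.indicator (1 : X → ℝ)) μ :=
    (integrable_indicator_iff hE).2 (integrableOn_const hfin)
  exact h1.mono' hg.aestronglyMeasurable (.of_forall hgE)

theorem enorm_curveExtension_le {d : ℕ} {ζ : ℝ → EuclideanSpace ℝ (Fin d)} {E : Set ℝ}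
    (hE : MeasurableSet E) {g : ℝ → ℂ} (hgE : ∀ t, ‖g t‖ ≤ E.indicator 1 t)
    (x : EuclideanSpace ℝ (Fin d)) : ‖curveExtension ζ g x‖ₑ ≤ volume E := by
  refine (enorm_integral_le_lintegral_enorm _).trans ?_
  rw [← lintegral_indicator_one hE]
  refine lintegral_mono fun t => ?_
  rw [← ofReal_norm, norm_mul, norm_exp_neg_I_mul_ofReal, one_mul]
  refine (ENNReal.ofReal_le_ofReal (hgE t)).trans (le_of_eq ?_)
  by_cases h : t ∈ E <;> simp [h]

/-- The start of the iteration: the extension is bounded pointwise by `volume E`. -/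
theorem restrictedBound_zero {n : ℕ} {P : (ℝ → EuclideanSpace ℝ (Fin (n + 1))) → Set ℝ → Prop}
    (N : ℝ) : RestrictedBound P N 0 1 := by
  intro ζ J _ E _ hE g _ hgE A _
  calc _ ≤ ∫⁻ _x in A, volume E := lintegral_mono fun x => enorm_curveExtension_le hE hgE x
    _ = _ := by simp

/-- Interpolation between two restricted bounds. -/
theorem RestrictedBound.interpolate {n : ℕ}
    {P : (ℝ → EuclideanSpace ℝ (Fin (n + 1))) → Set ℝ → Prop} {N u₀ u₁ K₀ K₁ θ : ℝ}
    (hN : 0 < N) (hK₀ : 0 < K₀) (hK₁ : 0 < K₁) (h₀ : RestrictedBound P N u₀ K₀)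
    (h₁ : RestrictedBound P N u₁ K₁) (hθ0 : 0 ≤ θ) (hθ1 : θ ≤ 1)
    (hu₀ : (n + 1) * (n + 2) / 2 * u₀ ≤ 1) (hu₁ : (n + 1) * (n + 2) / 2 * u₁ ≤ 1)
    (hu₀' : u₀ ≤ 1) (hu₁' : u₁ ≤ 1) :
    RestrictedBound P N ((1 - θ) * u₀ + θ * u₁) (K₀ ^ (1 - θ) * K₁ ^ θ) := by
  intro ζ J hζ E hEJ hE g hg hgE A hA
  have hθ' : 0 ≤ 1 - θ := by linarith
  -- Both bounds concern the same integral, whose powers `1 - θ` and `θ` multiply back to it; no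
  -- interpolation of operators is involved.
  have a₀ := ENNReal.rpow_le_rpow (h₀ hζ hEJ hE hg hgE hA) hθ'
  have a₁ := ENNReal.rpow_le_rpow (h₁ hζ hEJ hE hg hgE hA) hθ0
  have a := mul_le_mul' a₀ a₁
  rw [← ENNReal.rpow_add_of_nonneg _ _ hθ' hθ0, sub_add_cancel, ENNReal.rpow_one] at a
  refine a.trans (le_of_eq ?_)
  rw [ENNReal.mul_rpow_of_nonneg _ _ hθ', ENNReal.mul_rpow_of_nonneg _ _ hθ',
    ENNReal.mul_rpow_of_nonneg _ _ hθ0, ENNReal.mul_rpow_of_nonneg _ _ hθ0,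
    ← ENNReal.rpow_mul, ← ENNReal.rpow_mul, ← ENNReal.rpow_mul, ← ENNReal.rpow_mul,
    ENNReal.ofReal_rpow_of_nonneg (by positivity) hθ',
    ENNReal.ofReal_rpow_of_nonneg (by positivity) hθ0]
  have e1 : ENNReal.ofReal (K₀ ^ (1 - θ) * K₁ ^ θ * N ^ ((1 - θ) * u₀ + θ * u₁)) =
      ENNReal.ofReal ((K₀ * N ^ u₀) ^ (1 - θ)) * ENNReal.ofReal ((K₁ * N ^ u₁) ^ θ) := by
    rw [← ENNReal.ofReal_mul (by positivity), Real.mul_rpow hK₀.le (by positivity),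
      Real.mul_rpow hK₁.le (by positivity), ← Real.rpow_mul hN.le, ← Real.rpow_mul hN.le,
      Real.rpow_add hN, mul_comm u₀, mul_comm u₁]
    congr 1
    ring
  have e2 : volume E ^ (1 - (n + 1) * (n + 2) / 2 * ((1 - θ) * u₀ + θ * u₁)) =
      volume E ^ ((1 - (n + 1) * (n + 2) / 2 * u₀) * (1 - θ)) *
      volume E ^ ((1 - (n + 1) * (n + 2) / 2 * u₁) * θ) := by
    rw [← ENNReal.rpow_add_of_nonneg _ _ (mul_nonneg (by linarith) hθ')
      (mul_nonneg (by linarith) hθ0)]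
    congr 1
    ring
  have e3 : volume A ^ (1 - ((1 - θ) * u₀ + θ * u₁)) =
      volume A ^ ((1 - u₀) * (1 - θ)) * volume A ^ ((1 - u₁) * θ) := by
    rw [← ENNReal.rpow_add_of_nonneg _ _ (mul_nonneg (by linarith) hθ')
      (mul_nonneg (by linarith) hθ0)]
    congr 1
    ring
  rw [e1, e2, e3]
  ring

theorem vandermondeProduct_baseTuple {n : ℕ} (s : ℝ) (κ : Fin n → ℝ) :
    vandermondeProduct (baseTuple s κ) = vandermondeProduct (baseTuple 0 κ) := by
  simp [vandermondeProduct, baseTuple]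

theorem strictMono_baseTuple_iff {n : ℕ} (s : ℝ) (κ : Fin n → ℝ) :
    StrictMono (baseTuple s κ) ↔ StrictMono (baseTuple 0 κ) := by
  simp [StrictMono, baseTuple]

theorem measurable_vandermondeProduct (d : ℕ) :
    Measurable (vandermondeProduct : (Fin d → ℝ) → ℝ) := by
  unfold vandermondeProduct
  fun_prop

theorem norm_prod_le_indicator {d : ℕ} {E : Set ℝ} {g : ℝ → ℂ} (hgE : ∀ t, ‖g t‖ ≤ E.indicator 1 t)
    (t : Fin d → ℝ) : ‖∏ j, g (t j)‖ ≤ {t : Fin d → ℝ | ∀ j, t j ∈ E}.indicator 1 t := by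
  have h1 : ∀ s, ‖g s‖ ≤ 1 := fun s => (hgE s).trans (by by_cases h : s ∈ E <;> simp [h])
  rw [norm_prod]
  by_cases h : ∀ j, t j ∈ E
  · rw [Set.indicator_of_mem (by exact h)]
    exact Finset.prod_le_one (fun _ _ => norm_nonneg _) fun j _ => h1 _
  · rw [Set.indicator_of_notMem (by exact h)]
    push Not at h
    obtain ⟨j, hj⟩ := h
    refine (Finset.prod_eq_zero (Finset.mem_univ j) ?_).le
    exact le_antisymm ((hgE _).trans (by simp [hj])) (norm_nonneg _)

/-! ### The near and far regions of the space of tuples -/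

/-- The part of the `(n + 1)`-fold product where the Vandermonde product is at most `ρ`. -/
theorem setLIntegral_tupleExtension_near_le {n : ℕ} {δ : ℝ}
    {P : (ℝ → EuclideanSpace ℝ (Fin (n + 1))) → Set ℝ → Prop} (hP : IsAdmissibleFamily δ P)
    {N u K : ℝ} (hR : RestrictedBound P N u K) {b e : ℝ} (hb0 : 0 ≤ b) (hb1 : b < 1) (he : 1 < e)
    (hu0 : 0 ≤ u) (hu1 : (n + 1) * (n + 2) / 2 * u ≤ 1) (heu : e * ((n + 1) * (n + 2) / 2 * u) ≤ b)
    {ζ : ℝ → EuclideanSpace ℝ (Fin (n + 1))} {J : Set ℝ} (hζ : P ζ J) {E : Set ℝ} (hEJ : E ⊆ J)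
    (hE : MeasurableSet E) {α : ℝ} (hα : 0 < α) (hEα : volume E = ENNReal.ofReal α)
    {g : ℝ → ℂ} (hg : Measurable g) (hgE : ∀ t, ‖g t‖ ≤ E.indicator 1 t)
    {A : Set (EuclideanSpace ℝ (Fin (n + 1)))} (hA : MeasurableSet A) {ρ : ℝ} (hρ : 0 < ρ) :
    ∫⁻ x in A, ‖tupleExtension ζ {t | StrictMono t ∧ vandermondeProduct t ≤ ρ}
        (fun t => ∏ j, g (t j)) x‖ₑ ≤
      ENNReal.ofReal (K * N ^ u) * volume A ^ (1 - u) * (ENNReal.ofReal (ρ ^ (2 * b / (n + 1))) *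
        ENNReal.ofReal ((n + 1) * (((2 / (1 - b) + 1) ^ n) ^ (1 - (n + 1) * (n + 2) / 2 * u) *
        ((2 / (1 - b) + 2 / (e - 1)) ^ n) ^ ((n + 1) * (n + 2) / 2 * u)) *
          α ^ (1 - (n + 1) * (n + 2) / 2 * u + n * (1 - b)))) := by
  have hζm := (hP.continuous hζ).measurable
  have hEfin : volume E ≠ ∞ := by rw [hEα]; exact ENNReal.ofReal_ne_top
  set τ : ℝ := 2 * b / (n + 1) with hτ
  have hτ0 : 0 ≤ τ := by positivity
  set w : ℝ := (n + 1) * (n + 2) / 2 * u with hw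
  have hw0 : 0 ≤ w := by positivity
  set Ω : Set (Fin (n + 1) → ℝ) := {t | StrictMono t ∧ vandermondeProduct t ≤ ρ} with hΩ
  have hΩm : MeasurableSet Ω := (measurableSet_strictMono _).inter
    (measurableSet_le (measurable_vandermondeProduct _) measurable_const)
  have hinv : ∀ s κ, baseTuple s κ ∈ Ω ↔ baseTuple 0 κ ∈ Ω := fun s κ =>
    and_congr (strictMono_baseTuple_iff s κ) (by rw [vandermondeProduct_baseTuple])
  have hΩ0 : MeasurableSet {κ : Fin n → ℝ | baseTuple 0 κ ∈ Ω} :=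
    (measurable_baseTuple.comp measurable_prodMk_right : Measurable fun κ : Fin n → ℝ =>
      baseTuple 0 κ) hΩm
  refine (setLIntegral_enorm_tupleExtension_le hζm hg
    (integrable_of_norm_le_indicator hE hEfin hg hgE) hΩm hinv A).trans ?_
  calc _ ≤ ∫⁻ κ in {κ : Fin n → ℝ | baseTuple 0 κ ∈ Ω},
        (ENNReal.ofReal (K * N ^ u) * volume A ^ (1 - u)) * (ENNReal.ofReal (ρ ^ τ) *
          (volume (baseSet E κ) ^ (1 - w) * starSum b (baseTuple 0 κ))) := by
        refine setLIntegral_mono' hΩ0 fun κ hκ => ?_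
        have hκ' : StrictMono (baseTuple 0 κ) ∧ vandermondeProduct (baseTuple 0 κ) ≤ ρ := hκ
        have hv := vandermondeProduct_pos hκ'.1
        -- The slice at gaps `κ` is the extension operator of another member of the family, applied
        -- to a function supported in `baseSet E κ`, so the bound to be improved applies to it.
        have h1 := hR (hP.translateSum hζ κ hκ'.1) (E := baseSet E κ)
          (fun s hs j => hEJ (hs j)) (measurableSet_baseSet hE κ)
          (g := fun s => ∏ j, g (baseTuple s κ j))
          (Finset.measurable_prod _ fun j _ => hg.comp
            ((measurable_pi_apply j).comp (measurable_baseTuple.comp measurable_prodMk_left)))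
          (fun s => norm_prod_le_indicator hgE (baseTuple s κ)) hA
        refine h1.trans ?_
        -- Since `v ≤ ρ` on the slice, `1 ≤ (ρ/v)^τ`. The inserted factor gains the power of `ρ` and
        -- makes the integral over `κ` converge.
        have h2 : 1 ≤ ENNReal.ofReal (ρ ^ τ) * starSum b (baseTuple 0 κ) := by
          refine le_trans ?_ (mul_le_mul_right (vandermondeProduct_rpow_neg_le_starSum hκ'.1) _)
          rw [← ENNReal.ofReal_mul (by positivity), ← ENNReal.ofReal_one]
          refine ENNReal.ofReal_le_ofReal ?_
          rw [Real.rpow_neg hv.le, ← div_eq_mul_inv, one_le_div (by positivity)]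
          exact Real.rpow_le_rpow hv.le hκ'.2 hτ0
        calc ENNReal.ofReal (K * N ^ u) * volume (baseSet E κ) ^ (1 - w) * volume A ^ (1 - u)
            = ENNReal.ofReal (K * N ^ u) * volume (baseSet E κ) ^ (1 - w) *
                volume A ^ (1 - u) * 1 :=
              (mul_one _).symm
          _ ≤ ENNReal.ofReal (K * N ^ u) * volume (baseSet E κ) ^ (1 - w) * volume A ^ (1 - u) *
              (ENNReal.ofReal (ρ ^ τ) * starSum b (baseTuple 0 κ)) := by gcongr
          _ = _ := by ring
    _ ≤ ∫⁻ κ : Fin n → ℝ,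
        (ENNReal.ofReal (K * N ^ u) * volume A ^ (1 - u)) * (ENNReal.ofReal (ρ ^ τ) *
          (volume (baseSet E κ) ^ (1 - w) * starSum b (baseTuple 0 κ))) :=
        setLIntegral_le_lintegral _ _
    _ = (ENNReal.ofReal (K * N ^ u) * volume A ^ (1 - u)) * (ENNReal.ofReal (ρ ^ τ) *
        ∫⁻ κ : Fin n → ℝ, volume (baseSet E κ) ^ (1 - w) * starSum b (baseTuple 0 κ)) := by
        have hm : Measurable fun κ : Fin n → ℝ =>
            volume (baseSet E κ) ^ (1 - w) * starSum b (baseTuple 0 κ) :=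
          ((measurable_volume_baseSet hE).pow_const _).mul ((measurable_starSum b).comp
            (measurable_baseTuple.comp measurable_prodMk_right))
        rw [lintegral_const_mul _ (hm.const_mul _), lintegral_const_mul _ hm]
    _ ≤ _ := by
        gcongr
        exact lintegral_volume_baseSet_rpow_mul_starSum_le hα hb1 he hw0 hu1 heu hE hEα

/-- The `L²` bound for the product restricted to a set of tuples in `E`. -/
theorem setLIntegral_tupleExtension_le_of_subset {n : ℕ} {δ : ℝ} (hδ : 0 < δ)
    {P : (ℝ → EuclideanSpace ℝ (Fin (n + 1))) → Set ℝ → Prop} (hP : IsAdmissibleFamily δ P)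
    {ζ : ℝ → EuclideanSpace ℝ (Fin (n + 1))} {J : Set ℝ} (hζ : P ζ J) {E : Set ℝ} (hEJ : E ⊆ J)
    (hE : MeasurableSet E) (hE0 : volume E ≠ 0)
    {g : ℝ → ℂ} (hg : Measurable g) (hgE : ∀ t, ‖g t‖ ≤ E.indicator 1 t)
    {Ω : Set (Fin (n + 1) → ℝ)} (hΩm : MeasurableSet Ω) (hΩs : ∀ t ∈ Ω, StrictMono t)
    (hΩE : ∀ t ∈ Ω, ∀ j, t j ∈ E) (A : Set (EuclideanSpace ℝ (Fin (n + 1)))) :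
    ∫⁻ x in A, ‖tupleExtension ζ Ω (fun t => ∏ j, g (t j)) x‖ₑ ≤
      (ENNReal.ofReal ((2 * Real.pi) ^ (n + 1) / δ) *
        ∫⁻ t in Ω, ENNReal.ofReal ((vandermondeProduct t)⁻¹)) ^ (1 / 2 : ℝ) *
      volume A ^ (1 / 2 : ℝ) := by
  have hζm := (hP.continuous hζ).measurable
  have hEfin : volume E ≠ ∞ := ne_top_of_le_ne_top (hP.volume_ne_top hζ) (measure_mono hEJ)
  -- The Jacobian inequality is available only on an interval with more than one point; here `J`
  -- contains a set of positive measure.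
  have hJ : J.Nontrivial := by
    by_contra h
    rw [Set.not_nontrivial_iff] at h
    exact hE0 (measure_mono_null hEJ (h.measure_zero volume))
  have hgi := integrable_of_norm_le_indicator hE hEfin hg hgE
  have hFm : Measurable fun t : Fin (n + 1) → ℝ => ∏ j, g (t j) := by fun_prop
  have h2 := lintegral_enorm_tupleExtension_sq_le (hP.differentiableOn hζ) hΩm
    (fun t ht j => hEJ (hΩE t ht j)) hΩs
    (fun s hs t ht h => hP.injOn hζ ⟨hΩs s hs, fun j => hEJ (hΩE s hs j)⟩
      ⟨hΩs t ht, fun j => hEJ (hΩE t ht j)⟩ h) hδ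
    (fun t ht => hP.jacobian hζ hJ t fun j => hEJ (hΩE t ht j))
    (F := fun t => ∏ j, g (t j)) (Integrable.fintype_prod fun _ => hgi).integrableOn
    (fun t => (norm_prod_le_indicator hgE t).trans
      (Set.indicator_le_self' (by simp) t))
  have hm := measurable_tupleExtension hζm hFm Ω
  have h3 := ENNReal.lintegral_mul_norm_pow_le (μ := volume.restrict A)
    (f := fun x => ‖tupleExtension ζ Ω (fun t => ∏ j, g (t j)) x‖ₑ ^ 2) (g := fun _ => 1)
    (hm.enorm.pow_const 2).aemeasurable aemeasurable_const (p := 1 / 2) (q := 1 / 2)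
    (by norm_num) (by norm_num) (by norm_num)
  have e : ∀ x : ℝ≥0∞, (x ^ 2) ^ (1 / 2 : ℝ) * 1 ^ (1 / 2 : ℝ) = x := by
    intro x
    rw [ENNReal.one_rpow, mul_one, ← ENNReal.rpow_natCast, ← ENNReal.rpow_mul]
    norm_num
  simp only [e, setLIntegral_one] at h3
  refine h3.trans ?_
  gcongr
  exact (setLIntegral_le_lintegral _ _).trans h2

/-! ### Choice of the cut and the bootstrapping step -/

/-- Balancing the bounds `X ρ^τ` and `Y ρ^{-(1-τ)/2}`. -/
theorem exists_rpow_balance {X Y τ : ℝ} (hX : 0 < X) (hY : 0 < Y) (hτ : 0 ≤ τ) :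
    ∃ ρ : ℝ, 0 < ρ ∧
      X * ρ ^ τ = X ^ (1 - 2 * τ / (1 + τ)) * Y ^ (2 * τ / (1 + τ)) ∧
      Y * ρ ^ ((τ - 1) / 2) = X ^ (1 - 2 * τ / (1 + τ)) * Y ^ (2 * τ / (1 + τ)) := by
  have h1 : 0 < 1 + τ := by linarith
  -- The solution of `X ρ^τ = Y ρ^{(τ-1)/2}`.
  refine ⟨(Y / X) ^ (2 / (1 + τ)), by positivity, ?_, ?_⟩
  · rw [← Real.rpow_mul (by positivity), Real.div_rpow hY.le hX.le,
      show 2 / (1 + τ) * τ = 2 * τ / (1 + τ) by ring, Real.rpow_sub hX, Real.rpow_one]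
    ring
  · rw [← Real.rpow_mul (by positivity), Real.div_rpow hY.le hX.le,
      show 2 / (1 + τ) * ((τ - 1) / 2) = 2 * τ / (1 + τ) - 1 by field_simp; ring,
      Real.rpow_sub hY, Real.rpow_one, Real.rpow_sub hX, Real.rpow_one,
      Real.rpow_sub hX, Real.rpow_one]
    field_simp

theorem volume_rpow_mul_eq_top {n : ℕ} {E : Set ℝ} (hE : volume E ≠ 0)
    {A : Set (EuclideanSpace ℝ (Fin (n + 1)))} (hA : volume A = ∞) {K r s : ℝ} (hK : 0 < K)
    (hr : 0 ≤ r) (hs : 0 < s) :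
    ENNReal.ofReal K * volume E ^ r * volume A ^ s = ∞ := by
  rw [hA, ENNReal.top_rpow_of_pos hs]
  refine ENNReal.mul_top (mul_ne_zero (by simpa using hK) ?_)
  rw [Ne, ENNReal.rpow_eq_zero_iff]
  push Not
  exact ⟨fun h => absurd h hE, fun _ => hr⟩

/-- A restricted bound may be checked for sets of positive finite measure. -/
theorem restrictedBound_of_pos {n : ℕ} {δ : ℝ}
    {P : (ℝ → EuclideanSpace ℝ (Fin (n + 1))) → Set ℝ → Prop} (hP : IsAdmissibleFamily δ P)
    {N u K : ℝ} (hN : 0 < N) (hK : 0 < K) (hu1 : (n + 1) * (n + 2) / 2 * u ≤ 1) (hu : u < 1)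
    (h : ∀ ⦃ζ J⦄, P ζ J → ∀ ⦃E : Set ℝ⦄, E ⊆ J → MeasurableSet E → ∀ ⦃g : ℝ → ℂ⦄, Measurable g →
      (∀ t, ‖g t‖ ≤ E.indicator 1 t) → ∀ ⦃A : Set (EuclideanSpace ℝ (Fin (n + 1)))⦄,
      MeasurableSet A → ∀ α β : ℝ, 0 < α → 0 < β → volume E = ENNReal.ofReal α →
      volume A = ENNReal.ofReal β →
      ∫⁻ x in A, ‖curveExtension ζ g x‖ₑ ≤ ENNReal.ofReal (K * N ^ u *
        α ^ (1 - (n + 1) * (n + 2) / 2 * u) * β ^ (1 - u))) :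
    RestrictedBound P N u K := by
  intro ζ J hζ E hEJ hE g hg hgE A hA
  have hEfin : volume E ≠ ∞ := ne_top_of_le_ne_top (hP.volume_ne_top hζ) (measure_mono hEJ)
  by_cases hE0 : volume E = 0
  · have : ∀ x, ‖curveExtension ζ g x‖ₑ = 0 := fun x =>
      le_antisymm (hE0 ▸ enorm_curveExtension_le hE hgE x) zero_le
    simp [this]
  by_cases hA0 : volume A = 0
  · rw [Measure.restrict_eq_zero.2 hA0]
    simp
  by_cases hAt : volume A = ∞
  · rw [volume_rpow_mul_eq_top hE0 hAt (by positivity) (by linarith) (by linarith)]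
    exact le_top
  have hα : 0 < (volume E).toReal := ENNReal.toReal_pos hE0 hEfin
  have hβ : 0 < (volume A).toReal := ENNReal.toReal_pos hA0 hAt
  refine (h hζ hEJ hE hg hgE hA _ _ hα hβ (ENNReal.ofReal_toReal hEfin).symm
    (ENNReal.ofReal_toReal hAt).symm).trans (le_of_eq ?_)
  rw [ENNReal.ofReal_mul (by positivity), ENNReal.ofReal_mul (by positivity),
    ← ENNReal.ofReal_rpow_of_pos hα, ← ENNReal.ofReal_rpow_of_pos hβ,
    ENNReal.ofReal_toReal hEfin, ENNReal.ofReal_toReal hAt]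

/-- The near set must be translation invariant in order to be sliced, so it is not cut down to `E`.
The far set is cut, because injectivity and the Jacobian bound hold only for entries in `J`. The cut
costs nothing: the product of the `g (t j)` vanishes unless all entries lie in `E`. -/
theorem tupleExtension_eq_add {n : ℕ} {ζ : ℝ → EuclideanSpace ℝ (Fin (n + 1))} (hζ : Measurable ζ)
    {E : Set ℝ} {g : ℝ → ℂ} (hg : Integrable g)
    (hgE : ∀ t, ‖g t‖ ≤ E.indicator 1 t) (ρ : ℝ) (x : EuclideanSpace ℝ (Fin (n + 1))) :
    tupleExtension ζ {t | StrictMono t} (fun t => ∏ j, g (t j)) x =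
      tupleExtension ζ {t | StrictMono t ∧ vandermondeProduct t ≤ ρ} (fun t => ∏ j, g (t j)) x +
      tupleExtension ζ {t | (StrictMono t ∧ ρ < vandermondeProduct t) ∧ ∀ j, t j ∈ E}
        (fun t => ∏ j, g (t j)) x := by
  have hi : Integrable fun t : Fin (n + 1) → ℝ =>
      Complex.exp (-(Complex.I * ((inner ℝ x (curveSum ζ t) : ℝ) : ℂ))) * ∏ j, g (t j) :=
    integrable_exp_mul (Integrable.fintype_prod fun _ => hg) x (measurable_curveSum hζ)
  have hS := measurableSet_strictMono (n + 1)
  have hv := measurable_vandermondeProduct (n + 1)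
  have h1 : MeasurableSet {t : Fin (n + 1) → ℝ | StrictMono t ∧ ρ < vandermondeProduct t} :=
    hS.inter (measurableSet_lt measurable_const hv)
  have hu : {t : Fin (n + 1) → ℝ | StrictMono t} =
      {t | StrictMono t ∧ vandermondeProduct t ≤ ρ} ∪
      {t | StrictMono t ∧ ρ < vandermondeProduct t} := by
    ext t
    simp only [Set.mem_ofPred_eq, Set.mem_union, ← and_or_left]
    simp [le_or_gt]
  have hd : Disjoint {t : Fin (n + 1) → ℝ | StrictMono t ∧ vandermondeProduct t ≤ ρ}
      {t | StrictMono t ∧ ρ < vandermondeProduct t} := by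
    rw [Set.disjoint_left]
    exact fun t h h' => absurd h.2 (not_le.2 h'.2)
  unfold tupleExtension
  rw [hu, setIntegral_union hd h1 hi.integrableOn hi.integrableOn]
  congr 1
  refine setIntegral_eq_of_subset_of_forall_sdiff_eq_zero h1 (fun t ht => ht.1) ?_
  intro t ht
  have h2 : ¬ ∀ j, t j ∈ E := fun h => ht.2 ⟨ht.1, h⟩
  have h3 := norm_prod_le_indicator hgE t
  rw [Set.indicator_of_notMem (by exact h2)] at h3
  rw [norm_le_zero_iff.1 h3, mul_zero]

/-- With `τ = 2b/(n+1)`, write `1/v = v^{τ-1} v^{-τ}`: the first factor is at most `ρ^{τ-1}` in this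
region, the second at most the star sum. -/
theorem setLIntegral_far_le {n : ℕ} {b α ρ : ℝ} (hα : 0 < α) (hb0 : 0 ≤ b) (hb1 : b < 1)
    (hbn : 2 * b / (n + 1) ≤ 1) {E : Set ℝ} (hE : MeasurableSet E)
    (hEα : volume E = ENNReal.ofReal α) (hρ : 0 < ρ) :
    ∫⁻ t in {t : Fin (n + 1) → ℝ | (StrictMono t ∧ ρ < vandermondeProduct t) ∧ ∀ j, t j ∈ E},
      ENNReal.ofReal ((vandermondeProduct t)⁻¹) ≤
      ENNReal.ofReal (ρ ^ (2 * b / (n + 1) - 1) *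
        ((n + 1) * (2 / (1 - b) + 1) ^ n * α ^ (1 + n * (1 - b)))) := by
  set τ : ℝ := 2 * b / (n + 1) with hτ
  have hΩ : MeasurableSet
      {t : Fin (n + 1) → ℝ | (StrictMono t ∧ ρ < vandermondeProduct t) ∧ ∀ j, t j ∈ E} :=
    ((measurableSet_strictMono _).inter (measurableSet_lt measurable_const
      (measurable_vandermondeProduct _))).inter (measurableSet_tuple_mem hE)
  calc _ ≤ ∫⁻ t in {t : Fin (n + 1) → ℝ | (StrictMono t ∧ ρ < vandermondeProduct t) ∧
          ∀ j, t j ∈ E}, ENNReal.ofReal (ρ ^ (τ - 1)) * starSum b t := by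
        refine setLIntegral_mono' hΩ fun t ht => ?_
        have hv := vandermondeProduct_pos ht.1.1
        refine le_trans ?_ (mul_le_mul_right (vandermondeProduct_rpow_neg_le_starSum ht.1.1) _)
        rw [← ENNReal.ofReal_mul (by positivity)]
        refine ENNReal.ofReal_le_ofReal ?_
        calc (vandermondeProduct t)⁻¹
            = vandermondeProduct t ^ (τ - 1) * vandermondeProduct t ^ (-τ) := by
              rw [← Real.rpow_add hv, ← Real.rpow_neg_one]; congr 1; ring
          _ ≤ ρ ^ (τ - 1) * vandermondeProduct t ^ (-τ) := by
              refine mul_le_mul_of_nonneg_right ?_ (by positivity)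
              exact Real.rpow_le_rpow_of_nonpos hρ ht.1.2.le (by linarith)
    _ = ENNReal.ofReal (ρ ^ (τ - 1)) * ∫⁻ t in {t : Fin (n + 1) → ℝ |
          (StrictMono t ∧ ρ < vandermondeProduct t) ∧ ∀ j, t j ∈ E}, starSum b t :=
        lintegral_const_mul _ (measurable_starSum b)
    _ ≤ ENNReal.ofReal (ρ ^ (τ - 1)) * ∫⁻ t in {t : Fin (n + 1) → ℝ | ∀ j, t j ∈ E},
          starSum b t := by
        gcongr
        exact fun h => h.2
    _ ≤ _ := by
        rw [ENNReal.ofReal_mul (by positivity)]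
        gcongr
        exact setLIntegral_starSum_le hα hb0 hb1 hE hEα

theorem setLIntegral_enorm_le_rpow {X : Type*} [MeasurableSpace X] {μ : Measure X} {f : X → ℂ}
    (hf : Measurable f) {d : ℕ} (hd : d ≠ 0) (A : Set X) :
    ∫⁻ x in A, ‖f x‖ₑ ∂μ ≤
      (∫⁻ x in A, ‖f x‖ₑ ^ d ∂μ) ^ (1 / d : ℝ) * μ A ^ (1 - 1 / d : ℝ) := by
  have hd1 : (1:ℝ) ≤ d := by exact_mod_cast Nat.one_le_iff_ne_zero.2 hd
  have h := ENNReal.lintegral_mul_norm_pow_le (μ := μ.restrict A) (f := fun x => ‖f x‖ₑ ^ d)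
    (g := fun _ => 1) (hf.enorm.pow_const d).aemeasurable aemeasurable_const
    (p := 1 / d) (q := 1 - 1 / d) (by positivity)
    (by rw [sub_nonneg, div_le_one (by linarith)]; exact hd1) (by ring)
  have e : ∀ x : ℝ≥0∞, (x ^ d) ^ (1 / d : ℝ) * 1 ^ (1 - 1 / d : ℝ) = x := by
    intro x
    rw [ENNReal.one_rpow, mul_one, ← ENNReal.rpow_natCast, ← ENNReal.rpow_mul,
      mul_one_div_cancel (by linarith), ENNReal.rpow_one]
  simpa only [e, setLIntegral_one] using h

/-- Bookkeeping of exponents after balancing, the `d`-th root and Hölder on `A`. If `u₁` denotes the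
new exponent of `N`, that of `β` is `1 - u₁` for any `θ`; that of `α` is `1 - D u₁` precisely
because `θ (d + 2b) = 4b`. -/
theorem drury_rpow_identity {K₁ N u α β Cn Cf M b d : ℝ} {n : ℕ} (hK : 0 < K₁) (hN : 0 < N)
    (hα : 0 < α) (hβ : 0 < β) (hCn : 0 < Cn) (hCf : 0 < Cf) (hM : 0 < M) (hb : 0 < b)
    (hd : d = n + 1) :
    (M * ((K₁ * N ^ u * β ^ (1 - u) * (Cn * α ^ (1 - (n + 1) * (n + 2) / 2 * u + n * (1 - b)))) ^
        (1 - 2 * (2 * b / d) / (1 + 2 * b / d)) *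
      ((N * (Cf * α ^ (1 + n * (1 - b)))) ^ (1 / 2 : ℝ) * β ^ (1 / 2 : ℝ)) ^
        (2 * (2 * b / d) / (1 + 2 * b / d)))) ^ (1 / d) * β ^ (1 - 1 / d) =
    (M * ((K₁ * Cn) ^ (1 - 2 * (2 * b / d) / (1 + 2 * b / d)) *
        (Cf ^ (1 / 2 : ℝ)) ^ (2 * (2 * b / d) / (1 + 2 * b / d)))) ^ (1 / d) *
      N ^ (((1 - 2 * (2 * b / d) / (1 + 2 * b / d)) * u +
          2 * (2 * b / d) / (1 + 2 * b / d) / 2) / d) *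
      α ^ (1 - (n + 1) * (n + 2) / 2 *
        (((1 - 2 * (2 * b / d) / (1 + 2 * b / d)) * u +
          2 * (2 * b / d) / (1 + 2 * b / d) / 2) / d)) *
      β ^ (1 - ((1 - 2 * (2 * b / d) / (1 + 2 * b / d)) * u +
          2 * (2 * b / d) / (1 + 2 * b / d) / 2) / d) := by
  have hd0 : 0 < d := by rw [hd]; positivity
  obtain ⟨θ, hθ⟩ : ∃ θ, θ = 2 * (2 * b / d) / (1 + 2 * b / d) := ⟨_, rfl⟩
  rw [← hθ]
  have hθb : θ * (d + 2 * b) = 4 * b := by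
    rw [hθ]; field_simp; ring
  have e1 : (K₁ * N ^ u * β ^ (1 - u) *
      (Cn * α ^ (1 - (n + 1) * (n + 2) / 2 * u + n * (1 - b)))) ^ (1 - θ)
      = (K₁ * Cn) ^ (1 - θ) * N ^ (u * (1 - θ)) * β ^ ((1 - u) * (1 - θ)) *
        α ^ ((1 - (n + 1) * (n + 2) / 2 * u + n * (1 - b)) * (1 - θ)) := by
    rw [show K₁ * N ^ u * β ^ (1 - u) *
      (Cn * α ^ (1 - (n + 1) * (n + 2) / 2 * u + n * (1 - b))) =
      (K₁ * Cn) * N ^ u * β ^ (1 - u) *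
      α ^ (1 - (n + 1) * (n + 2) / 2 * u + n * (1 - b)) by ring,
      Real.mul_rpow (by positivity) (by positivity), Real.mul_rpow (by positivity) (by positivity),
      Real.mul_rpow (by positivity) (by positivity), ← Real.rpow_mul hN.le, ← Real.rpow_mul hβ.le,
      ← Real.rpow_mul hα.le]
  have e2 : ((N * (Cf * α ^ (1 + n * (1 - b)))) ^ (1 / 2 : ℝ) * β ^ (1 / 2 : ℝ)) ^ θ =
      (Cf ^ (1 / 2 : ℝ)) ^ θ * N ^ (1 / 2 * θ) * β ^ (1 / 2 * θ) *
        α ^ ((1 + n * (1 - b)) * (1 / 2 * θ)) := by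
    rw [Real.mul_rpow hN.le (by positivity), Real.mul_rpow hCf.le (by positivity),
      Real.mul_rpow (by positivity) (by positivity), Real.mul_rpow (by positivity) (by positivity),
      Real.mul_rpow (by positivity) (by positivity), ← Real.rpow_mul hN.le, ← Real.rpow_mul hβ.le,
      ← Real.rpow_mul hα.le, ← Real.rpow_mul hα.le]
    ring_nf
  rw [e1, e2]
  set Q := (K₁ * Cn) ^ (1 - θ) with hQ
  set R := (Cf ^ (1 / 2 : ℝ)) ^ θ with hR
  have hQ0 : 0 < Q := by positivity
  have hR0 : 0 < R := by positivity
  have e3 : M * (Q * N ^ (u * (1 - θ)) * β ^ ((1 - u) * (1 - θ)) *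
        α ^ ((1 - (n + 1) * (n + 2) / 2 * u + n * (1 - b)) * (1 - θ)) *
      (R * N ^ (1 / 2 * θ) * β ^ (1 / 2 * θ) * α ^ ((1 + n * (1 - b)) * (1 / 2 * θ)))) =
      (M * (Q * R)) * N ^ (u * (1 - θ) + 1 / 2 * θ) * β ^ ((1 - u) * (1 - θ) + 1 / 2 * θ) *
      α ^ ((1 - (n + 1) * (n + 2) / 2 * u + n * (1 - b)) * (1 - θ) +
        (1 + n * (1 - b)) * (1 / 2 * θ)) := by
    rw [Real.rpow_add hN, Real.rpow_add hβ, Real.rpow_add hα]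
    ring
  rw [e3, Real.mul_rpow (by positivity) (by positivity),
    Real.mul_rpow (by positivity) (by positivity), Real.mul_rpow (by positivity) (by positivity),
    ← Real.rpow_mul hN.le, ← Real.rpow_mul hβ.le, ← Real.rpow_mul hα.le]
  have f1 : (u * (1 - θ) + 1 / 2 * θ) * (1 / d) = ((1 - θ) * u + θ / 2) / d := by ring
  have f2 : ((1 - (n + 1) * (n + 2) / 2 * u + n * (1 - b)) * (1 - θ) +
        (1 + n * (1 - b)) * (1 / 2 * θ)) * (1 / d) =
      1 - (n + 1) * (n + 2) / 2 * (((1 - θ) * u + θ / 2) / d) := by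
    rw [mul_one_div, div_eq_iff hd0.ne', sub_mul, mul_assoc ((n + 1) * (n + 2) / 2 : ℝ),
      div_mul_cancel₀ _ hd0.ne', hd]
    rw [hd] at hθb
    linear_combination (n / 4 : ℝ) * hθb
  have f3 : ((1 - u) * (1 - θ) + 1 / 2 * θ) * (1 / d) + (1 - 1 / d) =
      1 - ((1 - θ) * u + θ / 2) / d := by
    field_simp; ring
  rw [f1, f2, ← f3, Real.rpow_add hβ]
  ring

/-- Drury's bootstrapping step. -/
theorem RestrictedBound.bootstrap {n : ℕ} (hn : 1 ≤ n) {b e u K₀ : ℝ} (hb0 : 0 < b) (hb1 : b < 1)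
    (he : 1 < e) (hu0 : 0 ≤ u) (hu1 : (n + 1) * (n + 2) / 2 * u ≤ 1)
    (heu : e * ((n + 1) * (n + 2) / 2 * u) ≤ b) (hK₀ : 0 < K₀) {u₁ : ℝ}
    (hu₁ : u₁ = ((1 - 2 * (2 * b / (n + 1)) / (1 + 2 * b / (n + 1))) * u +
      2 * (2 * b / (n + 1)) / (1 + 2 * b / (n + 1)) / 2) / (n + 1))
    (hu₁1 : u₁ < 1) (hu₁D : (n + 1) * (n + 2) / 2 * u₁ ≤ 1) :
    ∃ K₁ : ℝ, 0 < K₁ ∧ ∀ {δ : ℝ}, 0 < δ →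
      ∀ {P : (ℝ → EuclideanSpace ℝ (Fin (n + 1))) → Set ℝ → Prop}, IsAdmissibleFamily δ P →
      RestrictedBound P ((2 * Real.pi) ^ (n + 1) / δ) u K₀ →
      RestrictedBound P ((2 * Real.pi) ^ (n + 1) / δ) u₁ K₁ := by
  have hb : 0 < 1 - b := by linarith
  have he' : 0 < e - 1 := by linarith
  set Cn : ℝ := (n + 1) * (((2 / (1 - b) + 1) ^ n) ^ (1 - (n + 1) * (n + 2) / 2 * u) *
        ((2 / (1 - b) + 2 / (e - 1)) ^ n) ^ ((n + 1) * (n + 2) / 2 * u)) with hCn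
  set Cf : ℝ := (n + 1) * (2 / (1 - b) + 1) ^ n with hCf
  have hCn0 : 0 < Cn := by positivity
  have hCf0 : 0 < Cf := by positivity
  -- `d!` from the symmetrisation, `2` from the two regions, which contribute equally after
  -- balancing.
  set M : ℝ := 2 * (Nat.factorial (n + 1) : ℝ) with hM
  have hM0 : 0 < M := by positivity
  set τ : ℝ := 2 * b / (n + 1) with hτ
  have hτ0 : 0 < τ := by positivity
  -- This makes `v ^ (τ - 1)` nonincreasing in the far region, and is where `n ≥ 1` enters.
  have hτ1 : τ ≤ 1 := by
    rw [hτ, div_le_one (by positivity)]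
    have : (1:ℝ) ≤ n := by exact_mod_cast hn
    linarith
  refine ⟨(M * ((K₀ * Cn) ^ (1 - 2 * τ / (1 + τ)) *
        (Cf ^ (1 / 2 : ℝ)) ^ (2 * τ / (1 + τ)))) ^ (1 / (n + 1 : ℝ)), by positivity, ?_⟩
  intro δ hδ P hP hR
  set N : ℝ := (2 * Real.pi) ^ (n + 1) / δ with hN
  have hN0 : 0 < N := by positivity
  refine restrictedBound_of_pos hP hN0 (by positivity) hu₁D hu₁1 ?_
  intro ζ J hζ E hEJ hE g hg hgE A hA α β hα hβ hEα hAβ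
  have hζm := (hP.continuous hζ).measurable
  have hEfin : volume E ≠ ∞ := by rw [hEα]; exact ENNReal.ofReal_ne_top
  have hE0 : volume E ≠ 0 := by rw [hEα]; simpa using hα
  have hgi := integrable_of_norm_le_indicator hE hEfin hg hgE
  set X : ℝ := K₀ * N ^ u * β ^ (1 - u) *
    (Cn * α ^ (1 - (n + 1) * (n + 2) / 2 * u + n * (1 - b))) with hX
  set Y : ℝ := (N * (Cf * α ^ (1 + n * (1 - b)))) ^ (1 / 2 : ℝ) * β ^ (1 / 2 : ℝ) with hY
  have hX0 : 0 < X := by positivity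
  have hY0 : 0 < Y := by positivity
  obtain ⟨ρ, hρ, hρX, hρY⟩ := exists_rpow_balance hX0 hY0 hτ0.le
  set Z : ℝ := X ^ (1 - 2 * τ / (1 + τ)) * Y ^ (2 * τ / (1 + τ)) with hZ
  have hZ0 : 0 < Z := by positivity
  set Ω₁ : Set (Fin (n + 1) → ℝ) := {t | StrictMono t ∧ vandermondeProduct t ≤ ρ} with hΩ₁
  set Ω₂ : Set (Fin (n + 1) → ℝ) :=
    {t | (StrictMono t ∧ ρ < vandermondeProduct t) ∧ ∀ j, t j ∈ E} with hΩ₂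
  have hΩ₂m : MeasurableSet Ω₂ :=
    ((measurableSet_strictMono _).inter (measurableSet_lt measurable_const
      (measurable_vandermondeProduct _))).inter (measurableSet_tuple_mem hE)
  have hFm : Measurable fun t : Fin (n + 1) → ℝ => ∏ j, g (t j) := by fun_prop
  have h1 : ∫⁻ x in A, ‖tupleExtension ζ Ω₁ (fun t => ∏ j, g (t j)) x‖ₑ ≤ ENNReal.ofReal Z := by
    refine (setLIntegral_tupleExtension_near_le hP hR hb0.le hb1 he hu0 hu1 heu hζ hEJ hE hα hEα hg
      hgE hA hρ).trans (le_of_eq ?_)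
    rw [← hρX, hAβ, ENNReal.ofReal_rpow_of_pos hβ, ← ENNReal.ofReal_mul (by positivity),
      ← ENNReal.ofReal_mul (by positivity), ← ENNReal.ofReal_mul (by positivity)]
    congr 1
    rw [hX]
    ring
  have h2 : ∫⁻ x in A, ‖tupleExtension ζ Ω₂ (fun t => ∏ j, g (t j)) x‖ₑ ≤ ENNReal.ofReal Z := by
    refine (setLIntegral_tupleExtension_le_of_subset hδ hP hζ hEJ hE hE0 hg hgE hΩ₂m
      (fun t ht => ht.1.1) (fun t ht => ht.2) A).trans ?_
    have h3 := setLIntegral_far_le (n := n) hα hb0.le hb1 hτ1 hE hEα hρ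
    calc _ ≤ (ENNReal.ofReal N * ENNReal.ofReal (ρ ^ (τ - 1) *
        (Cf * α ^ (1 + n * (1 - b))))) ^ (1 / 2 : ℝ) * volume A ^ (1 / 2 : ℝ) := by gcongr
      _ = ENNReal.ofReal Z := by
        rw [← hρY, hAβ, ENNReal.ofReal_rpow_of_pos hβ, ← ENNReal.ofReal_mul (by positivity),
          ENNReal.ofReal_rpow_of_pos (by positivity), ← ENNReal.ofReal_mul (by positivity)]
        congr 1
        rw [hY, show N * (ρ ^ (τ - 1) * (Cf * α ^ (1 + n * (1 - b)))) =
          (N * (Cf * α ^ (1 + n * (1 - b)))) * ρ ^ (τ - 1) by ring,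
          Real.mul_rpow (by positivity) (by positivity), ← Real.rpow_mul hρ.le,
          show (τ - 1) * (1 / 2) = (τ - 1) / 2 by ring]
        ring
  have h3 : ∫⁻ x in A, ‖curveExtension ζ g x‖ₑ ^ (n + 1) ≤ ENNReal.ofReal (M * Z) := by
    have hpt : ∀ x, ‖curveExtension ζ g x‖ₑ ^ (n + 1) ≤ ENNReal.ofReal (Nat.factorial (n + 1)) *
        (‖tupleExtension ζ Ω₁ (fun t => ∏ j, g (t j)) x‖ₑ +
          ‖tupleExtension ζ Ω₂ (fun t => ∏ j, g (t j)) x‖ₑ) := by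
      intro x
      rw [← enorm_pow, curveExtension_pow_eq hζm hgi, tupleExtension_eq_add hζm hgi hgE ρ,
        enorm_mul]
      refine mul_le_mul' (le_of_eq ?_) (enorm_add_le _ _)
      rw [← ofReal_norm]
      simp
    calc _ ≤ ∫⁻ x in A, ENNReal.ofReal (Nat.factorial (n + 1)) *
        (‖tupleExtension ζ Ω₁ (fun t => ∏ j, g (t j)) x‖ₑ +
          ‖tupleExtension ζ Ω₂ (fun t => ∏ j, g (t j)) x‖ₑ) := lintegral_mono hpt
      _ = ENNReal.ofReal (Nat.factorial (n + 1)) *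
        ((∫⁻ x in A, ‖tupleExtension ζ Ω₁ (fun t => ∏ j, g (t j)) x‖ₑ) +
          ∫⁻ x in A, ‖tupleExtension ζ Ω₂ (fun t => ∏ j, g (t j)) x‖ₑ) := by
          have m1 := (measurable_tupleExtension hζm hFm Ω₁).enorm
          rw [lintegral_const_mul' _ _ ENNReal.ofReal_ne_top, lintegral_add_left m1]
      _ ≤ ENNReal.ofReal (Nat.factorial (n + 1)) * (ENNReal.ofReal Z + ENNReal.ofReal Z) := by
          gcongr
      _ = _ := by
          rw [← ENNReal.ofReal_add hZ0.le hZ0.le, ← ENNReal.ofReal_mul (by positivity)]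
          congr 1
          rw [hM]
          ring
  -- The estimate so far is for the `d`-th power; Hölder on `A` returns to the first.
  have h4 := setLIntegral_enorm_le_rpow (μ := volume) (measurable_curveExtension hζm hg)
    (Nat.succ_ne_zero n) A
  refine h4.trans ?_
  have hq : (0:ℝ) ≤ 1 - 1 / ((n + 1 : ℕ) : ℝ) := by
    rw [sub_nonneg, div_le_one (by positivity)]
    push_cast
    linarith [(Nat.cast_nonneg n : (0:ℝ) ≤ n)]
  calc _ ≤ ENNReal.ofReal (M * Z) ^ (1 / ((n + 1 : ℕ) : ℝ)) *
        volume A ^ (1 - 1 / ((n + 1 : ℕ) : ℝ)) := by gcongr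
    _ = _ := by
        rw [hAβ, ENNReal.ofReal_rpow_of_pos (by positivity), ENNReal.ofReal_rpow_of_pos hβ,
          ← ENNReal.ofReal_mul (by positivity)]
        congr 1
        push_cast
        rw [hu₁]
        exact drury_rpow_identity hK₀ hN0 hα hβ hCn0 hCf0 hM0 hb0 rfl

/-! ### Dimension one, and the iteration in higher dimensions -/

/-- In dimension one the Vandermonde product is empty, hence equal to `1`. With the cut at `1/2`
every tuple is far, and Plancherel alone gives the endpoint `u = 1/2`. -/
theorem restrictedBound_half_of_one_dim {δ : ℝ} (hδ : 0 < δ)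
    {P : (ℝ → EuclideanSpace ℝ (Fin (0 + 1))) → Set ℝ → Prop} (hP : IsAdmissibleFamily δ P) :
    RestrictedBound P ((2 * Real.pi) ^ (0 + 1) / δ) (1 / 2) (2 ^ (1 / 2 : ℝ)) := by
  set N : ℝ := (2 * Real.pi) ^ (0 + 1) / δ with hN
  have hN0 : 0 < N := by positivity
  refine restrictedBound_of_pos hP hN0 (by positivity) (by norm_num) (by norm_num) ?_
  intro ζ J hζ E hEJ hE g hg hgE A hA α β hα hβ hEα hAβ
  have hζm := (hP.continuous hζ).measurable
  have hEfin : volume E ≠ ∞ := by rw [hEα]; exact ENNReal.ofReal_ne_top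
  have hE0 : volume E ≠ 0 := by rw [hEα]; simpa using hα
  have hgi := integrable_of_norm_le_indicator hE hEfin hg hgE
  have hv : ∀ t : Fin (0 + 1) → ℝ, vandermondeProduct t = 1 := by
    intro t
    simp [vandermondeProduct]
  set Ω : Set (Fin (0 + 1) → ℝ) :=
    {t | (StrictMono t ∧ 1 / 2 < vandermondeProduct t) ∧ ∀ j, t j ∈ E} with hΩ
  have hΩm : MeasurableSet Ω :=
    ((measurableSet_strictMono _).inter (measurableSet_lt measurable_const
      (measurable_vandermondeProduct _))).inter (measurableSet_tuple_mem hE)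
  have hempty : {t : Fin (0 + 1) → ℝ | StrictMono t ∧ vandermondeProduct t ≤ 1 / 2} = ∅ := by
    ext t
    simp only [hv, Set.mem_ofPred_eq, Set.mem_empty_iff_false, iff_false, not_and, not_le]
    norm_num
  have h1 : ∀ x, curveExtension ζ g x = tupleExtension ζ Ω (fun t => ∏ j, g (t j)) x := by
    intro x
    have := curveExtension_pow_eq hζm hgi x
    rw [tupleExtension_eq_add hζm hgi hgE (1 / 2) x, hempty, ← hΩ] at this
    have h0 : tupleExtension ζ ∅ (fun t => ∏ j, g (t j)) x = 0 := by simp [tupleExtension]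
    rw [h0] at this
    simpa using this
  simp_rw [h1]
  refine (setLIntegral_tupleExtension_le_of_subset hδ hP hζ hEJ hE hE0 hg hgE hΩm
    (fun t ht => ht.1.1) (fun t ht => ht.2) A).trans ?_
  have h3 := setLIntegral_far_le (n := 0) (b := 0) (ρ := 1 / 2) hα le_rfl (by norm_num)
    (by norm_num) hE hEα (by norm_num)
  calc _ ≤ (ENNReal.ofReal N * ENNReal.ofReal (2 * α)) ^ (1 / 2 : ℝ) *
        volume A ^ (1 / 2 : ℝ) := by
        gcongr
        refine h3.trans (ENNReal.ofReal_le_ofReal (le_of_eq ?_))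
        norm_num [Real.rpow_neg_one]
    _ = _ := by
        rw [hAβ, ENNReal.ofReal_rpow_of_pos hβ, ← ENNReal.ofReal_mul hN0.le,
          ENNReal.ofReal_rpow_of_pos (by positivity), ← ENNReal.ofReal_mul (by positivity)]
        congr 1
        rw [show N * (2 * α) = 2 * N * α by ring, Real.mul_rpow (by positivity) hα.le,
          Real.mul_rpow (by norm_num) hN0.le]
        norm_num

/-- The exponents are the orbit of `0` under the affine map `u ↦ ((1 - θ) u + θ/2)/(n + 1)`, which
has fixed point `us` and ratio `(1 - θ)/(n + 1)`. The constant may grow with `m` but depends neither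
on `δ` nor on the family. -/
theorem exists_restrictedBound_iterate {n : ℕ} (hn : 1 ≤ n) {b : ℝ} (hb1 : b < 1)
    (hbD : ((n + 1) * (n + 2) / 2 : ℝ) / ((n + 1) * (n + 2) / 2 + 1) < b) {θ us : ℝ}
    (hθ : θ = 2 * (2 * b / (n + 1)) / (1 + 2 * b / (n + 1))) (hus : us * (n + θ) = θ / 2)
    (husD : ((n + 1) * (n + 2) / 2 + 1) * us ≤ 1) (m : ℕ) :
    ∃ K : ℝ, 0 < K ∧ ∀ {δ : ℝ}, 0 < δ →
      ∀ {P : (ℝ → EuclideanSpace ℝ (Fin (n + 1))) → Set ℝ → Prop}, IsAdmissibleFamily δ P →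
      RestrictedBound P ((2 * Real.pi) ^ (n + 1) / δ) (us * (1 - ((1 - θ) / (n + 1)) ^ m)) K := by
  have hn1 : (1:ℝ) ≤ n := by exact_mod_cast hn
  obtain ⟨D, hD⟩ : ∃ D : ℝ, D = (n + 1) * (n + 2) / 2 := ⟨_, rfl⟩
  have hD0 : 3 ≤ D := by rw [hD]; nlinarith
  rw [← hD] at husD hbD
  have hb0 : 0 < b := lt_trans (by positivity) hbD
  set τ : ℝ := 2 * b / (n + 1) with hτ
  have hτ0 : 0 < τ := by positivity
  have hτ1 : τ ≤ 1 := by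
    rw [hτ, div_le_one (by positivity)]
    linarith
  have hθ0 : 0 < θ := by rw [hθ]; positivity
  have hθ1 : θ ≤ 1 := by rw [hθ, div_le_one (by positivity)]; linarith
  have hus0 : 0 < us := by
    have : 0 < us * (n + θ) := by rw [hus]; positivity
    exact pos_of_mul_pos_left this (by positivity)
  set q : ℝ := (1 - θ) / (n + 1) with hq
  have hq0 : 0 ≤ q := div_nonneg (by linarith) (by positivity)
  have hq1 : q ≤ 1 := by rw [hq, div_le_one (by positivity)]; linarith
  have hpow : ∀ m : ℕ, 0 ≤ us * (1 - q ^ m) ∧ us * (1 - q ^ m) ≤ us := by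
    intro m
    have h1 : q ^ m ≤ 1 := pow_le_one₀ hq0 hq1
    have h2 : 0 ≤ q ^ m := pow_nonneg hq0 m
    exact ⟨mul_nonneg hus0.le (by linarith), by nlinarith⟩
  induction m with
  | zero => exact ⟨1, one_pos, fun _ P _ => by simpa using restrictedBound_zero _⟩
  | succ m ih =>
    obtain ⟨K, hK, hR⟩ := ih
    obtain ⟨hm0, hm1⟩ := hpow m
    obtain ⟨hm0', hm1'⟩ := hpow (m + 1)
    have hDm : (D + 1) * (us * (1 - q ^ m)) ≤ 1 :=
      (mul_le_mul_of_nonneg_left hm1 (by linarith)).trans husD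
    have hDm' : (D + 1) * (us * (1 - q ^ (m + 1))) ≤ 1 :=
      (mul_le_mul_of_nonneg_left hm1' (by linarith)).trans husD
    -- All exponents of the orbit are at most `us ≤ 1/(D+1)`, so `e = b(D+1)/D` satisfies `e D u ≤
    -- b`; `e > 1` is exactly `b > D/(D+1)`.
    obtain ⟨K₁, hK₁, hR₁⟩ := RestrictedBound.bootstrap hn (b := b) (e := b * (D + 1) / D)
      (u := us * (1 - q ^ m)) (u₁ := us * (1 - q ^ (m + 1))) hb0 hb1
      (by
        rw [lt_div_iff₀ (by linarith), one_mul]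
        rwa [div_lt_iff₀ (by linarith)] at hbD) hm0 (by rw [← hD]; linarith)
      (by
        rw [← hD]
        calc b * (D + 1) / D * (D * (us * (1 - q ^ m)))
            = b * ((D + 1) * (us * (1 - q ^ m))) := by field_simp
          _ ≤ b * 1 := by gcongr
          _ = b := mul_one b) hK
      (by
        rw [← hτ, ← hθ, eq_div_iff (by positivity), pow_succ]
        have : q * (n + 1) = 1 - θ := by rw [hq]; field_simp
        linear_combination hus - us * q ^ m * this)
      (by nlinarith) (by rw [← hD]; linarith)
    exact ⟨K₁, hK₁, fun hδ P hP => hR₁ hδ hP (hR hδ hP)⟩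

/-- The restricted bound in the full open range of exponents. -/
theorem exists_restrictedBound {n : ℕ} {u : ℝ} (hu0 : 0 ≤ u)
    (hu : ((n + 1) * (n + 2) / 2 + 1) * u < 1) :
    ∃ K : ℝ, 0 < K ∧ ∀ {δ : ℝ}, 0 < δ →
      ∀ {P : (ℝ → EuclideanSpace ℝ (Fin (n + 1))) → Set ℝ → Prop}, IsAdmissibleFamily δ P →
      RestrictedBound P ((2 * Real.pi) ^ (n + 1) / δ) u K := by
  -- A bound at any `v ≥ u` suffices: interpolation with the trivial bound at `0` comes back to `u`.
  suffices h : ∃ v : ℝ, u ≤ v ∧ 0 < v ∧ (n + 1) * (n + 2) / 2 * v ≤ 1 ∧ v ≤ 1 ∧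
      ∃ K : ℝ, 0 < K ∧ ∀ {δ : ℝ}, 0 < δ →
      ∀ {P : (ℝ → EuclideanSpace ℝ (Fin (n + 1))) → Set ℝ → Prop}, IsAdmissibleFamily δ P →
      RestrictedBound P ((2 * Real.pi) ^ (n + 1) / δ) v K by
    obtain ⟨v, huv, hv0, hvD, hv1, K, hK, hR⟩ := h
    refine ⟨1 ^ (1 - u / v) * K ^ (u / v), by positivity, fun {δ} hδ P hP => ?_⟩
    have := RestrictedBound.interpolate (θ := u / v) (by positivity) one_pos hK
      (restrictedBound_zero (P := P) _) (hR hδ hP) (by positivity) ((div_le_one hv0).2 huv)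
      (by simp) hvD (by simp) hv1
    rwa [mul_zero, zero_add, div_mul_cancel₀ _ hv0.ne'] at this
  rcases Nat.eq_zero_or_pos n with rfl | hn
  · refine ⟨1 / 2, ?_, by norm_num, by norm_num, by norm_num, 2 ^ (1 / 2 : ℝ), by positivity,
      fun hδ P hP => restrictedBound_half_of_one_dim hδ hP⟩
    norm_num at hu
    linarith
  have hn1 : (1:ℝ) ≤ n := by exact_mod_cast hn
  obtain ⟨D, hD⟩ : ∃ D : ℝ, D = (n + 1) * (n + 2) / 2 := ⟨_, rfl⟩
  have hD0 : 3 ≤ D := by rw [hD]; nlinarith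
  rw [← hD] at hu
  -- the fixed point of the bootstrapping map, as a function of `b`
  set U : ℝ → ℝ := fun b => 2 * b / (n * (n + 1) + 2 * b * (n + 2)) with hU
  -- At `b = 1` the fixed point is the critical exponent. The value `b = 1` itself is excluded by
  -- the divergence of `|y|^{-1}`, so continuity supplies a `b < 1` with fixed point still above
  -- `u`.
  have hU1 : (D + 1) * U 1 = 1 := by
    rw [hU, hD]; field_simp; ring
  have hUc : ContinuousAt U 1 :=
    ContinuousAt.div (by fun_prop) (by fun_prop) (by positivity)
  have huU : u < U 1 := by
    have : (D + 1) * u < (D + 1) * U 1 := by rw [hU1]; exact hu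
    exact lt_of_mul_lt_mul_left this (by linarith)
  have ev1 : ∀ᶠ b in nhdsWithin 1 (Set.Iio 1), u < U b :=
    (hUc.eventually (lt_mem_nhds huU)).filter_mono nhdsWithin_le_nhds
  have ev2 : ∀ᶠ b in nhdsWithin (1:ℝ) (Set.Iio 1), D / (D + 1) < b :=
    (lt_mem_nhds (by rw [div_lt_one (by linarith)]; linarith)).filter_mono nhdsWithin_le_nhds
  have ev3 : ∀ᶠ b in nhdsWithin (1:ℝ) (Set.Iio 1), b < 1 := self_mem_nhdsWithin
  obtain ⟨b, hub, hbD, hb1⟩ := (ev1.and (ev2.and ev3)).exists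
  have hb0 : 0 < b := lt_trans (by positivity) hbD
  obtain ⟨θ, hθ⟩ : ∃ θ : ℝ, θ = 2 * (2 * b / (n + 1)) / (1 + 2 * b / (n + 1)) := ⟨_, rfl⟩
  have hθ' : θ = 4 * b / (n + 1 + 2 * b) := by rw [hθ]; field_simp; ring
  have hfix : U b * (n + θ) = θ / 2 := by
    rw [hU, hθ']; field_simp; ring
  have hUb0 : 0 < U b := lt_of_le_of_lt hu0 hub
  have hUD : (D + 1) * U b ≤ 1 := by
    rw [hU, hD, ← mul_div_assoc, div_le_one (by positivity)]
    nlinarith [mul_nonneg (by positivity : (0:ℝ) ≤ n * (n + 1)) (by linarith : 0 ≤ 1 - b)]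
  have hθ0 : 0 < θ := by rw [hθ]; positivity
  have hθ1 : θ ≤ 1 := by rw [hθ', div_le_one (by positivity)]; linarith
  set q : ℝ := (1 - θ) / (n + 1) with hq
  have hq0 : 0 ≤ q := div_nonneg (by linarith) (by positivity)
  have hq1 : q < 1 := by rw [hq, div_lt_one (by positivity)]; linarith
  have hlim : Filter.Tendsto (fun m : ℕ => U b * (1 - q ^ m)) Filter.atTop (nhds (U b * (1 - 0))) :=
    (tendsto_const_nhds.sub (tendsto_pow_atTop_nhds_zero_of_lt_one hq0 hq1)).const_mul _
  have hlim2 : ∀ᶠ m : ℕ in Filter.atTop, u < U b * (1 - q ^ m) :=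
    hlim.eventually (lt_mem_nhds (by simpa using hub))
  obtain ⟨m, hm⟩ := hlim2.exists
  have hqm : 0 ≤ q ^ m := pow_nonneg hq0 m
  have hle : U b * (1 - q ^ m) ≤ U b := by nlinarith
  have hle2 : (D + 1) * (U b * (1 - q ^ m)) ≤ 1 :=
    (mul_le_mul_of_nonneg_left hle (by linarith)).trans hUD
  refine ⟨U b * (1 - q ^ m), hm.le, lt_of_le_of_lt hu0 hm, ?_, ?_, ?_⟩
  · rw [← hD]; nlinarith
  · nlinarith
  · exact exists_restrictedBound_iterate hn hb1 (by rw [← hD]; exact hbD) hθ hfix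
      (by rw [← hD]; exact hUD) m

/-! ### From restricted weak type to a weak type restriction bound by duality -/

/-- Testing on the level set itself gives `s ν(A) ≤ c ν(A)^{1-u}`. The measure of the level set may
be infinite, so the test is made on a subset of finite measure that still exceeds the claimed bound.
-/
theorem measure_lt_norm_le_of_setLIntegral_le {X : Type*} [MeasurableSpace X] {ν : Measure X}
    [SigmaFinite ν] {f : X → ℂ} (hf : Measurable f) {c u : ℝ} (hc : 0 ≤ c) (hu0 : 0 < u)
    (h : ∀ A, MeasurableSet A → ∫⁻ x in A, ‖f x‖ₑ ∂ν ≤ ENNReal.ofReal c * ν A ^ (1 - u))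
    {s : ℝ} (hs : 0 < s) : ν {x | s < ‖f x‖} ≤ ENNReal.ofReal ((c / s) ^ (1 / u)) := by
  by_contra hlt
  push Not at hlt
  have hSm : MeasurableSet {x | s < ‖f x‖} := measurableSet_lt measurable_const hf.norm
  obtain ⟨T, hTm, hTS, hT, hTfin⟩ := Measure.exists_subset_measure_lt_top hSm hlt
  set β : ℝ := (ν T).toReal with hβ
  have hTβ : ν T = ENNReal.ofReal β := (ENNReal.ofReal_toReal hTfin.ne).symm
  rw [hTβ] at hT
  have hβ1 : (c / s) ^ (1 / u) < β := ((ENNReal.ofReal_lt_ofReal_iff'.1 hT)).1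
  have hβ0 : 0 < β := lt_of_le_of_lt (by positivity) hβ1
  have h1 : ENNReal.ofReal s * ν T ≤ ∫⁻ x in T, ‖f x‖ₑ ∂ν := by
    rw [← setLIntegral_const]
    refine setLIntegral_mono' hTm fun x hx => ?_
    rw [← ofReal_norm]
    exact ENNReal.ofReal_le_ofReal (le_of_lt (hTS hx))
  have h2 := h1.trans (h T hTm)
  rw [hTβ, ENNReal.ofReal_rpow_of_pos hβ0, ← ENNReal.ofReal_mul hs.le, ← ENNReal.ofReal_mul hc,
    ENNReal.ofReal_le_ofReal_iff (by positivity), Real.rpow_sub hβ0, Real.rpow_one,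
    ← mul_div_assoc, le_div_iff₀ (by positivity)] at h2
  have h3 : s * β ^ u ≤ c := by
    have : (s * β ^ u) * β ≤ c * β := by linarith
    exact le_of_mul_le_mul_right this hβ0
  have h4 : c / s < β ^ u := by
    have := Real.rpow_lt_rpow (by positivity) hβ1 hu0
    rwa [← Real.rpow_mul (by positivity), one_div_mul_cancel hu0.ne', Real.rpow_one] at this
  rw [div_lt_iff₀ hs] at h4
  linarith

/-- In the layer cake formula the levels stop at `α`, and `r₂ < r₁` makes `s ^ (r₁ - r₂ - 1)`
integrable at `0`. -/
theorem lintegral_enorm_rpow_le_of_measure_lt_le {X : Type*} [MeasurableSpace X] {ν : Measure X}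
    {f : X → ℂ} (hf : Measurable f) {c α r₁ r₂ : ℝ} (hc : 0 ≤ c) (hα : 0 < α) (hr₂ : 0 < r₂)
    (hr : r₂ < r₁) (hfα : ∀ x, ‖f x‖ ≤ α)
    (h : ∀ s : ℝ, 0 < s → ν {x | s < ‖f x‖} ≤ ENNReal.ofReal ((c / s) ^ r₂)) :
    ∫⁻ x, ‖f x‖ₑ ^ r₁ ∂ν ≤ ENNReal.ofReal (r₁ / (r₁ - r₂) * c ^ r₂ * α ^ (r₁ - r₂)) := by
  have hr₁ : 0 < r₁ := hr₂.trans hr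
  have e : ∀ x, ‖f x‖ₑ ^ r₁ = ENNReal.ofReal (‖f x‖ ^ r₁) := fun x => by
    rw [← ofReal_norm, ENNReal.ofReal_rpow_of_nonneg (norm_nonneg _) hr₁.le]
  simp_rw [e]
  rw [lintegral_rpow_eq_lintegral_meas_lt_mul ν (.of_forall fun x => norm_nonneg _)
    hf.norm.aemeasurable hr₁, ← Set.Ioc_union_Ioi_eq_Ioi hα.le,
    lintegral_union measurableSet_Ioi (Set.Ioc_disjoint_Ioi le_rfl)]
  have h1 : ∫⁻ t in Set.Ioi α, ν {x | t < ‖f x‖} * ENNReal.ofReal (t ^ (r₁ - 1)) = 0 := by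
    rw [setLIntegral_congr_fun (g := fun _ => 0) measurableSet_Ioi fun t ht => ?_]
    · simp
    · have : {x | t < ‖f x‖} = ∅ := by
        ext x
        simpa using (hfα x).trans (le_of_lt ht)
      simp [this]
  have h2 : ∫⁻ t in Set.Ioc 0 α, ν {x | t < ‖f x‖} * ENNReal.ofReal (t ^ (r₁ - 1)) ≤
      ∫⁻ t in Set.Ioc 0 α, ENNReal.ofReal (c ^ r₂) *
        ENNReal.ofReal (t ^ (-(1 - (r₁ - r₂)))) := by
    refine setLIntegral_mono' measurableSet_Ioc fun t ht => ?_
    have ht0 : 0 < t := ht.1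
    refine (mul_le_mul_left (h t ht.1) _).trans (le_of_eq ?_)
    rw [← ENNReal.ofReal_mul (by positivity), ← ENNReal.ofReal_mul (by positivity)]
    congr 1
    rw [Real.div_rpow hc ht0.le, div_mul_eq_mul_div, mul_div_assoc, ← Real.rpow_sub ht0]
    congr 2
    ring
  rw [h1, add_zero]
  calc _ ≤ ENNReal.ofReal r₁ * ∫⁻ t in Set.Ioc 0 α, ENNReal.ofReal (c ^ r₂) *
        ENNReal.ofReal (t ^ (-(1 - (r₁ - r₂)))) := by gcongr
    _ = _ := by
      have hpos : 0 < r₁ - r₂ := by linarith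
      rw [lintegral_const_mul _ (by fun_prop), lintegral_Ioc_rpow_neg hα (by linarith),
        ← ENNReal.ofReal_mul (by positivity), ← ENNReal.ofReal_mul (by positivity)]
      congr 1
      rw [show 1 - (1 - (r₁ - r₂)) = r₁ - r₂ by ring]
      ring

theorem measurable_fourierHat {d : ℕ} {f : EuclideanSpace ℝ (Fin d) → ℂ} (hf : Measurable f) :
    Measurable (fourierHat f) := by
  have hm : Measurable fun z : EuclideanSpace ℝ (Fin d) × EuclideanSpace ℝ (Fin d) =>
      Complex.exp (-(Complex.I * ((inner ℝ z.2 z.1 : ℝ) : ℂ))) * f z.2 :=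
    (measurable_uncurry_exp_inner measurable_snd measurable_fst).mul (hf.comp measurable_snd)
  exact hm.stronglyMeasurable.integral_prod_right'.measurable

theorem enorm_fourierHat_le {d : ℕ} (f : EuclideanSpace ℝ (Fin d) → ℂ)
    (ξ : EuclideanSpace ℝ (Fin d)) : ‖fourierHat f ξ‖ₑ ≤ ∫⁻ x, ‖f x‖ₑ := by
  refine (enorm_integral_le_lintegral_enorm _).trans (lintegral_mono fun x => ?_)
  rw [← ofReal_norm, norm_mul, norm_exp_neg_I_mul_ofReal, one_mul, ofReal_norm]

theorem integral_mul_fourierHat_eq {d : ℕ} {ζ : ℝ → EuclideanSpace ℝ (Fin d)} (hζ : Measurable ζ)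
    {f : EuclideanSpace ℝ (Fin d) → ℂ} (hf : Integrable f) {g : ℝ → ℂ} (hg : Integrable g) :
    ∫ t, g t * fourierHat f (ζ t) = ∫ x, f x * curveExtension ζ g x := by
  have hi : Integrable (fun z : ℝ × EuclideanSpace ℝ (Fin d) =>
      Complex.exp (-(Complex.I * ((inner ℝ z.2 (ζ z.1) : ℝ) : ℂ))) * (g z.1 * f z.2))
      (volume.prod volume) := by
    refine (hg.mul_prod hf).bdd_mul (c := 1)
      (measurable_uncurry_exp_inner measurable_snd (hζ.comp measurable_fst)).aestronglyMeasurable ?_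
    exact .of_forall fun t => (norm_exp_neg_I_mul_ofReal _).le
  calc ∫ t, g t * fourierHat f (ζ t) = ∫ t, ∫ x,
        Complex.exp (-(Complex.I * ((inner ℝ x (ζ t) : ℝ) : ℂ))) * (g t * f x) := by
        refine integral_congr_ae (.of_forall fun t => ?_)
        simp only [fourierHat]
        rw [← integral_const_mul]
        refine integral_congr_ae (.of_forall fun x => ?_)
        simp only
        ring
    _ = ∫ x, ∫ t, Complex.exp (-(Complex.I * ((inner ℝ x (ζ t) : ℝ) : ℂ))) * (g t * f x) :=
        integral_integral_swap hi
    _ = _ := by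
        refine integral_congr_ae (.of_forall fun x => ?_)
        simp only [curveExtension]
        rw [← integral_const_mul]
        refine integral_congr_ae (.of_forall fun x => ?_)
        simp only
        ring

/-- Duality between the restriction and the extension operator. -/
theorem exists_setLIntegral_fourierHat_le {d : ℕ} {ζ : ℝ → EuclideanSpace ℝ (Fin d)}
    (hζ : Measurable ζ) {f : EuclideanSpace ℝ (Fin d) → ℂ} (hfm : Measurable f)
    (hf : Integrable f) {E : Set ℝ} (hE : MeasurableSet E) (hEfin : volume E ≠ ∞) :
    ∃ g : ℝ → ℂ, Measurable g ∧ (∀ t, ‖g t‖ ≤ E.indicator 1 t) ∧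
      ∫⁻ t in E, ‖fourierHat f (ζ t)‖ₑ ≤ ∫⁻ x, ‖f x‖ₑ * ‖curveExtension ζ g x‖ₑ := by
  set W : ℝ → ℂ := fun t => fourierHat f (ζ t) with hW
  have hWm : Measurable W := (measurable_fourierHat hfm).comp hζ
  -- The conjugate phase of `W`, so that `g W = |W|` on `E`; where `W = 0` the convention `0 / 0 =
  -- 0` gives `g = 0`, which is harmless.
  set g : ℝ → ℂ := E.indicator fun t => (starRingEnd ℂ) (W t) / (‖W t‖ : ℂ) with hg
  have hgm : Measurable g := by
    refine Measurable.indicator ?_ hE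
    exact (Complex.continuous_conj.measurable.comp hWm).div
      (Complex.measurable_ofReal.comp hWm.norm)
  have hgE : ∀ t, ‖g t‖ ≤ E.indicator 1 t := by
    intro t
    by_cases ht : t ∈ E
    · simp only [hg, Set.indicator_of_mem ht, norm_div, RCLike.norm_conj, Complex.norm_real,
        norm_norm, Pi.one_apply]
      exact div_self_le_one _
    · simp [hg, ht]
  refine ⟨g, hgm, hgE, ?_⟩
  have hgi := integrable_of_norm_le_indicator hE hEfin hgm hgE
  have hgW : ∀ t, g t * W t = ((E.indicator (fun t => ‖W t‖) t : ℝ) : ℂ) := by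
    intro t
    by_cases ht : t ∈ E
    · simp only [hg, Set.indicator_of_mem ht]
      by_cases h0 : W t = 0
      · simp [h0]
      · have : (‖W t‖ : ℂ) ≠ 0 := by simpa using h0
        rw [div_mul_eq_mul_div, mul_comm, Complex.mul_conj', div_eq_iff this, sq]
    · simp [hg, ht]
  have hbd : ∀ t, ‖W t‖ ≤ (∫⁻ x, ‖f x‖ₑ).toReal := fun t => by
    rw [← toReal_enorm]
    exact ENNReal.toReal_mono hf.2.ne (enorm_fourierHat_le f _)
  have hWi : IntegrableOn (fun t => ‖W t‖) E := by
    refine Measure.integrableOn_of_bounded (M := (∫⁻ x, ‖f x‖ₑ).toReal) hEfin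
      hWm.norm.aestronglyMeasurable (.of_forall fun t => ?_)
    rw [norm_norm]
    exact hbd t
  have h1 : ∫⁻ t in E, ‖W t‖ₑ = ‖∫ t, g t * W t‖ₑ := by
    simp_rw [hgW]
    rw [integral_complex_ofReal, integral_indicator hE, ← ofReal_norm, Complex.norm_real,
      Real.norm_of_nonneg (integral_nonneg fun t => norm_nonneg _),
      ofReal_integral_eq_lintegral_ofReal hWi (.of_forall fun t => norm_nonneg _)]
    simp_rw [ofReal_norm]
  calc ∫⁻ t in E, ‖W t‖ₑ = ‖∫ x, f x * curveExtension ζ g x‖ₑ := by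
        rw [h1, integral_mul_fourierHat_eq hζ hf hgi]
    _ ≤ ∫⁻ x, ‖f x * curveExtension ζ g x‖ₑ := enorm_integral_le_lintegral_enorm _
    _ = _ := by simp_rw [enorm_mul]

/-- The weak type bound for the restriction operator, tested on a set `E`. -/
theorem exists_setLIntegral_fourierHat_le_rpow {n : ℕ} {u : ℝ} (hu0 : 0 < u)
    (hu : ((n + 1) * (n + 2) / 2 + 1) * u < 1) :
    ∃ C : ℝ, 0 < C ∧ ∀ {δ : ℝ}, 0 < δ →
      ∀ {P : (ℝ → EuclideanSpace ℝ (Fin (n + 1))) → Set ℝ → Prop}, IsAdmissibleFamily δ P →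
      ∀ {ζ J}, P ζ J → ∀ {E : Set ℝ}, E ⊆ J → MeasurableSet E →
      ∀ {f : EuclideanSpace ℝ (Fin (n + 1)) → ℂ}, Measurable f → Integrable f →
      ∫⁻ t in E, ‖fourierHat f (ζ t)‖ₑ ≤
        ENNReal.ofReal (C * ((2 * Real.pi) ^ (n + 1) / δ) ^ u) *
          volume E ^ (1 - (n + 1) * (n + 2) / 2 * u) *
          (∫⁻ x, ‖f x‖ₑ ^ (1 / (1 - u))) ^ (1 - u) := by
  obtain ⟨D, hD⟩ : ∃ D : ℝ, D = (n + 1) * (n + 2) / 2 := ⟨_, rfl⟩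
  have hD0 : 0 < D := by rw [hD]; positivity
  rw [← hD] at hu
  have hu' : u < 1 / (D + 1) := by rw [lt_div_iff₀ (by linarith)]; linarith
  -- The strict gap `u < v` pays for the passage from weak to strong type: the bound at `v` controls
  -- the levels below `α`, and the sup bound excludes those above.
  obtain ⟨v, huv, hv⟩ := exists_between hu'
  have hv0 : 0 < v := hu0.trans huv
  have hv' : (D + 1) * v < 1 := by rw [lt_div_iff₀ (by linarith)] at hv; linarith
  obtain ⟨K, hK, hR⟩ := exists_restrictedBound (n := n) hv0.le (by rw [← hD]; exact hv')
  set r₁ : ℝ := 1 / u with hr₁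
  set r₂ : ℝ := 1 / v with hr₂
  have hr : r₂ < r₁ := one_div_lt_one_div_of_lt hu0 huv
  have hr0 : 0 < r₂ := by positivity
  have hrr : 0 < r₁ - r₂ := by linarith
  have hu1 : u < 1 := by nlinarith
  refine ⟨(r₁ / (r₁ - r₂) * K ^ r₂) ^ u, by positivity, ?_⟩
  intro δ hδ P hP ζ J hζ E hEJ hE f hfm hf
  set N : ℝ := (2 * Real.pi) ^ (n + 1) / δ with hN
  have hN0 : 0 < N := by positivity
  have hζm := (hP.continuous hζ).measurable
  have hEfin : volume E ≠ ∞ := ne_top_of_le_ne_top (hP.volume_ne_top hζ) (measure_mono hEJ)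
  by_cases hE0 : volume E = 0
  · rw [Measure.restrict_eq_zero.2 hE0]
    simp
  set α : ℝ := (volume E).toReal with hα
  have hα0 : 0 < α := ENNReal.toReal_pos hE0 hEfin
  have hEα : volume E = ENNReal.ofReal α := (ENNReal.ofReal_toReal hEfin).symm
  obtain ⟨g, hgm, hgE, hle⟩ := exists_setLIntegral_fourierHat_le hζm hfm hf hE hEfin
  have hXm := measurable_curveExtension hζm hgm
  set c : ℝ := K * N ^ v * α ^ (1 - D * v) with hc
  have hc0 : 0 < c := by positivity
  have hbound : ∀ A : Set (EuclideanSpace ℝ (Fin (n + 1))), MeasurableSet A →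
      ∫⁻ x in A, ‖curveExtension ζ g x‖ₑ ≤ ENNReal.ofReal c * volume A ^ (1 - v) := by
    intro A hA
    refine (hR hδ hP hζ hEJ hE hgm hgE hA).trans (le_of_eq ?_)
    rw [← hD, hEα, ENNReal.ofReal_rpow_of_pos hα0, ← ENNReal.ofReal_mul (by positivity)]
  have hsup : ∀ x, ‖curveExtension ζ g x‖ ≤ α := fun x => by
    rw [← toReal_enorm]
    exact ENNReal.toReal_mono hEfin (enorm_curveExtension_le hE hgE x)
  have hstrong := lintegral_enorm_rpow_le_of_measure_lt_le (ν := volume) hXm hc0.le hα0 hr0 hr hsup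
    (fun s hs => measure_lt_norm_le_of_setLIntegral_le hXm hc0.le hv0 hbound hs)
  have hH := ENNReal.lintegral_mul_norm_pow_le
    (μ := (volume : Measure (EuclideanSpace ℝ (Fin (n + 1)))))
    (f := fun x => ‖f x‖ₑ ^ (1 / (1 - u))) (g := fun x => ‖curveExtension ζ g x‖ₑ ^ r₁)
    (hfm.enorm.pow_const _).aemeasurable (hXm.enorm.pow_const _).aemeasurable
    (p := 1 - u) (q := u) (by linarith) hu0.le (by ring)
  have e1 : ∀ x : ℝ≥0∞, (x ^ (1 / (1 - u))) ^ (1 - u) = x := fun x => by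
    rw [← ENNReal.rpow_mul, one_div_mul_cancel (by linarith), ENNReal.rpow_one]
  have e2 : ∀ x : ℝ≥0∞, (x ^ r₁) ^ u = x := fun x => by
    rw [← ENNReal.rpow_mul, hr₁, one_div_mul_cancel hu0.ne', ENNReal.rpow_one]
  simp only [e1, e2] at hH
  refine (hle.trans hH).trans ?_
  rw [mul_comm]
  refine mul_le_mul_left ?_ _
  refine (ENNReal.rpow_le_rpow hstrong hu0.le).trans (le_of_eq ?_)
  rw [← hD, hEα, ENNReal.ofReal_rpow_of_pos (by positivity), ENNReal.ofReal_rpow_of_pos hα0,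
    ← ENNReal.ofReal_mul (by positivity)]
  congr 1
  have f1 : c ^ r₂ = K ^ r₂ * N * α ^ (r₂ - D) := by
    rw [hc, Real.mul_rpow (by positivity) (by positivity), Real.mul_rpow hK.le (by positivity),
      ← Real.rpow_mul hN0.le, ← Real.rpow_mul hα0.le, hr₂, mul_one_div_cancel hv0.ne',
      Real.rpow_one, show (1 - D * v) * (1 / v) = 1 / v - D by field_simp]
  rw [f1, show r₁ / (r₁ - r₂) * (K ^ r₂ * N * α ^ (r₂ - D)) * α ^ (r₁ - r₂) =
    (r₁ / (r₁ - r₂) * K ^ r₂) * N * (α ^ (r₂ - D) * α ^ (r₁ - r₂)) by ring,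
    ← Real.rpow_add hα0, Real.mul_rpow (by positivity) (by positivity),
    Real.mul_rpow (by positivity) hN0.le, ← Real.rpow_mul hα0.le]
  congr 2
  rw [show r₂ - D + (r₁ - r₂) = r₁ - D by ring, sub_mul, hr₁, one_div_mul_cancel hu0.ne']

/-! ### Marcinkiewicz interpolation with the `L¹ → L^∞` bound -/

theorem fourierHat_add {d : ℕ} {f g : EuclideanSpace ℝ (Fin d) → ℂ} (hf : Integrable f)
    (hg : Integrable g) (ξ : EuclideanSpace ℝ (Fin d)) :
    fourierHat (f + g) ξ = fourierHat f ξ + fourierHat g ξ := by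
  simp only [fourierHat, Pi.add_apply, mul_add]
  rw [integral_add]
  · simpa only [id, real_inner_comm] using integrable_exp_mul hf ξ measurable_id
  · simpa only [id, real_inner_comm] using integrable_exp_mul hg ξ measurable_id

/-- The part of the function `f` where `‖f‖ ≤ l`. -/
noncomputable def lowPart {X : Type*} (f : X → ℂ) (l : ℝ) : X → ℂ := {x | ‖f x‖ ≤ l}.indicator f

/-- Where `|f| > l` one has `|f| ≤ l^{1-p} |f|^p`, so the discarded part has `L¹` norm at most
`l^{1-p}` and its transform is bounded by this everywhere. -/
theorem enorm_fourierHat_sub_lowPart_le {d : ℕ} {f : EuclideanSpace ℝ (Fin d) → ℂ}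
    (hfm : Measurable f) (hf : Integrable f) {p l : ℝ} (hp : 1 ≤ p) (hl : 0 < l)
    (hf1 : ∫⁻ x, ‖f x‖ₑ ^ p ≤ 1) (ξ : EuclideanSpace ℝ (Fin d)) :
    ‖fourierHat f ξ‖ ≤ ‖fourierHat (lowPart f l) ξ‖ + l ^ (1 - p) := by
  have hS : MeasurableSet {x | ‖f x‖ ≤ l} := measurableSet_le hfm.norm measurable_const
  have hadd : f = lowPart f l + {x | ‖f x‖ ≤ l}ᶜ.indicator f :=
    (Set.indicator_self_add_compl _ f).symm
  have hhi : ‖fourierHat ({x | ‖f x‖ ≤ l}ᶜ.indicator f) ξ‖ ≤ l ^ (1 - p) := by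
    rw [← ENNReal.ofReal_le_ofReal_iff (by positivity), ofReal_norm]
    refine (enorm_fourierHat_le _ _).trans ?_
    calc ∫⁻ x, ‖{x | ‖f x‖ ≤ l}ᶜ.indicator f x‖ₑ
        ≤ ∫⁻ x, ENNReal.ofReal (l ^ (1 - p)) * ‖f x‖ₑ ^ p := by
          refine lintegral_mono fun x => ?_
          by_cases hx : ‖f x‖ ≤ l
          · rw [Set.indicator_of_notMem (by simpa using hx)]
            simp
          · have hx' : l < ‖f x‖ := not_le.1 hx
            have hx0 : 0 < ‖f x‖ := hl.trans hx'
            rw [Set.indicator_of_mem (by simpa using hx), ← ofReal_norm,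
              ENNReal.ofReal_rpow_of_pos hx0, ← ENNReal.ofReal_mul (by positivity)]
            refine ENNReal.ofReal_le_ofReal ?_
            calc ‖f x‖ = ‖f x‖ ^ (1 - p) * ‖f x‖ ^ p := by
                  rw [← Real.rpow_add hx0, sub_add_cancel, Real.rpow_one]
              _ ≤ l ^ (1 - p) * ‖f x‖ ^ p := by
                  refine mul_le_mul_of_nonneg_right ?_ (by positivity)
                  exact Real.rpow_le_rpow_of_nonpos hl hx'.le (by linarith)
      _ = ENNReal.ofReal (l ^ (1 - p)) * ∫⁻ x, ‖f x‖ₑ ^ p :=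
          lintegral_const_mul _ (hfm.enorm.pow_const _)
      _ ≤ ENNReal.ofReal (l ^ (1 - p)) * 1 := by gcongr
      _ = _ := mul_one _
  have e : fourierHat f ξ = fourierHat (lowPart f l) ξ +
      fourierHat ({x | ‖f x‖ ≤ l}ᶜ.indicator f) ξ :=
    (congrArg (fourierHat · ξ) hadd).trans
      (fourierHat_add (hf.indicator hS) (hf.indicator hS.compl) ξ)
  rw [e]
  exact (norm_add_le _ _).trans (by gcongr)

theorem lintegral_lowPart_rpow_le {X : Type*} [MeasurableSpace X] {μ : Measure X} {f : X → ℂ}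
    (hfm : Measurable f) {p p₁ l : ℝ} (hp : 0 < p) (hpp : p ≤ p₁) (hl : 0 < l)
    (hf1 : ∫⁻ x, ‖f x‖ₑ ^ p ∂μ ≤ 1) :
    ∫⁻ x, ‖lowPart f l x‖ₑ ^ p₁ ∂μ ≤ ENNReal.ofReal (l ^ (p₁ - p)) := by
  calc ∫⁻ x, ‖lowPart f l x‖ₑ ^ p₁ ∂μ
      ≤ ∫⁻ x, ENNReal.ofReal (l ^ (p₁ - p)) * ‖f x‖ₑ ^ p ∂μ := by
        refine lintegral_mono fun x => ?_
        by_cases hx : ‖f x‖ ≤ l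
        · rw [lowPart, Set.indicator_of_mem (by exact hx), ← ofReal_norm,
            ENNReal.ofReal_rpow_of_nonneg (norm_nonneg _) (by linarith),
            ENNReal.ofReal_rpow_of_nonneg (norm_nonneg _) hp.le,
            ← ENNReal.ofReal_mul (by positivity)]
          refine ENNReal.ofReal_le_ofReal ?_
          calc ‖f x‖ ^ p₁ = ‖f x‖ ^ (p₁ - p) * ‖f x‖ ^ p := by
                rw [← Real.rpow_add_of_nonneg (norm_nonneg _) (by linarith) hp.le, sub_add_cancel]
            _ ≤ l ^ (p₁ - p) * ‖f x‖ ^ p := by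
                refine mul_le_mul_of_nonneg_right ?_ (by positivity)
                exact Real.rpow_le_rpow (norm_nonneg _) hx (by linarith)
        · rw [lowPart, Set.indicator_of_notMem (by exact hx), enorm_zero,
            ENNReal.zero_rpow_of_pos (by linarith)]
          exact zero_le
    _ = ENNReal.ofReal (l ^ (p₁ - p)) * ∫⁻ x, ‖f x‖ₑ ^ p ∂μ :=
        lintegral_const_mul _ (hfm.enorm.pow_const _)
    _ ≤ ENNReal.ofReal (l ^ (p₁ - p)) * 1 := by gcongr
    _ = _ := mul_one _

/-- The estimate for the level sets of the restriction in the interpolation argument. -/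
theorem measure_lt_norm_fourierHat_le {d : ℕ} {ζ : ℝ → EuclideanSpace ℝ (Fin d)} (hζ : Measurable ζ)
    {ν : Measure ℝ} [SigmaFinite ν] {D u u₁ c : ℝ} (hD : 0 < D) (hu0 : 0 < u) (huu : u < u₁)
    (hu₁ : (D + 1) * u₁ < 1) (hc : 0 < c)
    (hweak : ∀ f : EuclideanSpace ℝ (Fin d) → ℂ, Measurable f → Integrable f →
      ∀ A, MeasurableSet A → ∫⁻ t in A, ‖fourierHat f (ζ t)‖ₑ ∂ν ≤
        ENNReal.ofReal c * ν A ^ (1 - D * u₁) * (∫⁻ x, ‖f x‖ₑ ^ (1 / (1 - u₁))) ^ (1 - u₁))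
    {f : EuclideanSpace ℝ (Fin d) → ℂ} (hfm : Measurable f) (hf : Integrable f)
    (hf1 : ∫⁻ x, ‖f x‖ₑ ^ (1 / (1 - u)) ≤ 1) {s : ℝ} (hs : 0 < s) :
    ν {t | s < ‖fourierHat f (ζ t)‖} ≤
      ENNReal.ofReal (c ^ (1 / (D * u₁)) * (s / 2) ^ (-(1 / (D * u₁))) *
        (s / 2) ^ (-((u₁ - u) / (u * (1 - u₁)) * ((1 - u₁) / (D * u₁) - 1)))) *
      ∫⁻ x, ‖lowPart f ((s / 2) ^ (-((1 - u) / u))) x‖ₑ ^ (1 / (1 - u₁)) := by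
  have hu₁0 : 0 < u₁ := hu0.trans huu
  have hu₁1 : u₁ < 1 := by nlinarith
  have hu1 : u < 1 := huu.trans hu₁1
  have h1u : 0 < 1 - u := by linarith
  have h1u₁ : 0 < 1 - u₁ := by linarith
  have hs2 : 0 < s / 2 := by positivity
  -- This height makes the discarded part contribute at most `l ^ (1 - p) = s/2`, so level `s` is
  -- exceeded only where the low part exceeds `s/2`.
  set l : ℝ := (s / 2) ^ (-((1 - u) / u)) with hl
  have hl0 : 0 < l := by positivity
  set p : ℝ := 1 / (1 - u) with hp
  set p₁ : ℝ := 1 / (1 - u₁) with hp₁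
  have hp1 : 1 ≤ p := by rw [hp, le_div_iff₀ h1u]; linarith
  have hpp : p ≤ p₁ := one_div_le_one_div_of_le h1u₁ (by linarith)
  have hlp : l ^ (1 - p) = s / 2 := by
    rw [hl, ← Real.rpow_mul hs2.le, show -((1 - u) / u) * (1 - p) = 1 by
      rw [hp]; field_simp; ring, Real.rpow_one]
  set κ : ℝ := (1 - u₁) / (D * u₁) with hκ
  -- `κ` is the ratio of the target exponent `1/(D u₁)` to the source exponent `p₁`; `κ ≥ 1` amounts
  -- to `(D + 1) u₁ ≤ 1`.
  have hκ1 : 1 ≤ κ := by rw [hκ, le_div_iff₀ (by positivity)]; linarith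
  set F : ℝ≥0∞ := ∫⁻ x, ‖lowPart f l x‖ₑ ^ p₁ with hF
  have hFle : F ≤ ENNReal.ofReal (l ^ (p₁ - p)) :=
    lintegral_lowPart_rpow_le hfm (by linarith) hpp hl0 hf1
  have hFfin : F ≠ ∞ := ne_top_of_le_ne_top ENNReal.ofReal_ne_top hFle
  have hS : MeasurableSet {x | ‖f x‖ ≤ l} := measurableSet_le hfm.norm measurable_const
  have hlowm : Measurable (lowPart f l) := hfm.indicator hS
  have hlowi : Integrable (lowPart f l) := hf.indicator hS
  set cF : ℝ := c * F.toReal ^ (1 - u₁) with hcF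
  have hcF0 : 0 ≤ cF := by positivity
  have hD1 : 0 < D * u₁ := by positivity
  have hb := measure_lt_norm_le_of_setLIntegral_le (ν := ν) (c := cF) (u := D * u₁)
    ((measurable_fourierHat hlowm).comp hζ) hcF0 hD1
    (fun A hA => by
      refine (hweak _ hlowm hlowi A hA).trans (le_of_eq ?_)
      rw [hcF, ENNReal.ofReal_mul hc.le,
        ← ENNReal.ofReal_rpow_of_nonneg ENNReal.toReal_nonneg h1u₁.le,
        ENNReal.ofReal_toReal hFfin]
      ring) hs2
  have hsub : {t | s < ‖fourierHat f (ζ t)‖} ⊆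
      {t | s / 2 < ‖(fourierHat (lowPart f l) ∘ ζ) t‖} := by
    intro t ht
    have h1 := enorm_fourierHat_sub_lowPart_le hfm hf hp1 hl0 hf1 (ζ t)
    have h2 : s < ‖fourierHat f (ζ t)‖ := ht
    rw [hlp] at h1
    change s / 2 < ‖fourierHat (lowPart f l) (ζ t)‖
    linarith
  refine (measure_mono hsub).trans (hb.trans ?_)
  have hFr : F = ENNReal.ofReal F.toReal := (ENNReal.ofReal_toReal hFfin).symm
  rw [hFr, ← ENNReal.ofReal_mul (by positivity)]
  refine ENNReal.ofReal_le_ofReal ?_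
  set y : ℝ := F.toReal with hy
  have hy0 : 0 ≤ y := ENNReal.toReal_nonneg
  have hyl : y ≤ l ^ (p₁ - p) := by
    rw [hy]
    exact ENNReal.toReal_le_of_le_ofReal (by positivity) hFle
  have e1 : (cF / (s / 2)) ^ (1 / (D * u₁)) =
      c ^ (1 / (D * u₁)) * (s / 2) ^ (-(1 / (D * u₁))) * y ^ κ := by
    rw [hcF, Real.div_rpow (by positivity) hs2.le, Real.mul_rpow hc.le (by positivity),
      ← Real.rpow_mul hy0, Real.rpow_neg hs2.le, mul_one_div, ← hκ]
    ring
  -- All but one power of `y` are replaced by the a priori bound `l ^ (p₁ - p)`. The estimate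
  -- becomes linear in the integral of the low part, so Tonelli can be applied when integrating over
  -- `s`.
  have e2 : y ^ κ ≤ (s / 2) ^ (-((u₁ - u) / (u * (1 - u₁)) * (κ - 1))) * y := by
    calc y ^ κ = y ^ (κ - 1) * y := by
          nth_rw 3 [← Real.rpow_one y]
          rw [← Real.rpow_add_of_nonneg hy0 (by linarith) zero_le_one, sub_add_cancel]
      _ ≤ (l ^ (p₁ - p)) ^ (κ - 1) * y := by
          gcongr
      _ = _ := by
          rw [hl, ← Real.rpow_mul hs2.le, ← Real.rpow_mul hs2.le]
          congr 2
          rw [hp, hp₁]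
          field_simp
          ring
  rw [e1]
  calc _ ≤ c ^ (1 / (D * u₁)) * (s / 2) ^ (-(1 / (D * u₁))) *
        ((s / 2) ^ (-((u₁ - u) / (u * (1 - u₁)) * (κ - 1))) * y) := by gcongr
    _ = _ := by ring

/-- Tonelli: for `f x ≠ 0` the low part of height `(s/2)^{-a}` keeps the point `x` exactly while `s
≤ 2 |f x|^{-1/a}`. Integrating `(s/2)^{η-1}` up to there lowers the exponent `p₁` to `p₁ - η/a = p`.
-/
theorem lintegral_rpow_mul_lowPart {X : Type*} [MeasurableSpace X] {μ : Measure X} [SFinite μ]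
    {f : X → ℂ} (hfm : Measurable f) {a η p p₁ : ℝ} (ha : 0 < a) (hη : 0 < η) (hp₁ : 0 < p₁)
    (hp : p₁ - η / a = p) (hp0 : 0 < p) :
    ∫⁻ s in Set.Ioi (0:ℝ), ENNReal.ofReal ((s / 2) ^ (η - 1)) *
      ∫⁻ x, ‖lowPart f ((s / 2) ^ (-a)) x‖ₑ ^ p₁ ∂μ =
    ENNReal.ofReal (2 / η) * ∫⁻ x, ‖f x‖ₑ ^ p ∂μ := by
  have hm : Measurable fun z : ℝ × X => ENNReal.ofReal ((z.1 / 2) ^ (η - 1)) *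
      ‖lowPart f ((z.1 / 2) ^ (-a)) z.2‖ₑ ^ p₁ := by
    have h1 : Measurable fun z : ℝ × X => lowPart f ((z.1 / 2) ^ (-a)) z.2 := by
      have hset : MeasurableSet {z : ℝ × X | ‖f z.2‖ ≤ (z.1 / 2) ^ (-a)} :=
        measurableSet_le (hfm.norm.comp measurable_snd) (by fun_prop)
      exact (hfm.comp measurable_snd).indicator hset
    have h2 : Measurable fun z : ℝ × X => ENNReal.ofReal ((z.1 / 2) ^ (η - 1)) := by fun_prop
    exact h2.mul (h1.enorm.pow_const _)
  have e1 : ∀ s : ℝ, ENNReal.ofReal ((s / 2) ^ (η - 1)) *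
      ∫⁻ x, ‖lowPart f ((s / 2) ^ (-a)) x‖ₑ ^ p₁ ∂μ =
      ∫⁻ x, ENNReal.ofReal ((s / 2) ^ (η - 1)) * ‖lowPart f ((s / 2) ^ (-a)) x‖ₑ ^ p₁ ∂μ :=
    fun s => (lintegral_const_mul' _ _ ENNReal.ofReal_ne_top).symm
  simp_rw [e1]
  rw [lintegral_lintegral_swap hm.aemeasurable, ← lintegral_const_mul' _ _ ENNReal.ofReal_ne_top]
  refine lintegral_congr fun x => ?_
  rcases (norm_nonneg (f x)).eq_or_lt with h0 | h0
  · have hz : f x = 0 := norm_eq_zero.1 h0.symm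
    have : ∀ l, lowPart f l x = 0 := fun l => by
      by_cases h : x ∈ {x | ‖f x‖ ≤ l}
      · rw [lowPart, Set.indicator_of_mem h, hz]
      · exact Set.indicator_of_notMem h _
    simp [this, hz, ENNReal.zero_rpow_of_pos hp₁, ENNReal.zero_rpow_of_pos hp0]
  set y : ℝ := ‖f x‖ with hy
  set S : ℝ := 2 * y ^ (-(1 / a)) with hS
  have hS0 : 0 < S := by positivity
  have hiff : ∀ s : ℝ, 0 < s → (y ≤ (s / 2) ^ (-a) ↔ s ≤ S) := by
    intro s hs
    have hs2 : 0 < s / 2 := by positivity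
    have h1 := Real.le_rpow_inv_iff_of_neg hs2 h0 (show -a < 0 by linarith)
    rw [← h1, hS, show -(1 / a) = (-a)⁻¹ by rw [inv_neg, one_div], div_le_iff₀ two_pos, mul_comm]
  have e2 : ∫⁻ s in Set.Ioi (0:ℝ), ENNReal.ofReal ((s / 2) ^ (η - 1)) *
      ‖lowPart f ((s / 2) ^ (-a)) x‖ₑ ^ p₁ =
      ∫⁻ s in Set.Ioc 0 S, ENNReal.ofReal (2 ^ (1 - η) * y ^ p₁) *
        ENNReal.ofReal (s ^ (-(1 - η))) := by
    rw [← Set.Ioc_union_Ioi_eq_Ioi hS0.le,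
      lintegral_union measurableSet_Ioi (Set.Ioc_disjoint_Ioi le_rfl)]
    have z : ∫⁻ s in Set.Ioi S, ENNReal.ofReal ((s / 2) ^ (η - 1)) *
        ‖lowPart f ((s / 2) ^ (-a)) x‖ₑ ^ p₁ = 0 := by
      rw [setLIntegral_congr_fun (g := fun _ => 0) measurableSet_Ioi fun s hs => ?_]
      · simp
      · have hs' : S < s := hs
        have : ¬ ‖f x‖ ≤ (s / 2) ^ (-a) := fun h =>
          absurd ((hiff s (hS0.trans hs')).1 h) (not_le.2 hs')
        beta_reduce
        rw [lowPart, Set.indicator_of_notMem (by exact this), enorm_zero,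
          ENNReal.zero_rpow_of_pos hp₁, mul_zero]
    rw [z, add_zero]
    refine setLIntegral_congr_fun measurableSet_Ioc fun s hs => ?_
    have hs0 : 0 < s := hs.1
    have : ‖f x‖ ≤ (s / 2) ^ (-a) := (hiff s hs.1).2 hs.2
    rw [lowPart, Set.indicator_of_mem (by exact this), ← ofReal_norm, ← hy,
      ENNReal.ofReal_rpow_of_pos h0, ← ENNReal.ofReal_mul (by positivity),
      ← ENNReal.ofReal_mul (by positivity)]
    congr 1
    rw [Real.div_rpow hs0.le two_pos.le, show -(1 - η) = η - 1 by ring,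
      show 1 - η = -(η - 1) by ring, Real.rpow_neg two_pos.le]
    ring
  rw [e2, lintegral_const_mul _ (by fun_prop), lintegral_Ioc_rpow_neg hS0 (by linarith),
    ← ofReal_norm, ← hy, ENNReal.ofReal_rpow_of_pos h0, ← ENNReal.ofReal_mul (by positivity),
    ← ENNReal.ofReal_mul (by positivity)]
  congr 1
  rw [show 1 - (1 - η) = η by ring, hS, Real.mul_rpow two_pos.le (by positivity),
    ← Real.rpow_mul h0.le, Real.rpow_sub two_pos, Real.rpow_one, ← hp, Real.rpow_sub h0,
    show -(1 / a) * η = -(η / a) by ring, Real.rpow_neg h0.le]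
  field_simp

/-- Marcinkiewicz interpolation between the trivial `L¹ → L^∞` bound and a weak type bound. -/
theorem lintegral_enorm_fourierHat_rpow_le {d : ℕ} {ζ : ℝ → EuclideanSpace ℝ (Fin d)}
    (hζ : Measurable ζ) {ν : Measure ℝ} [SigmaFinite ν] {D u u₁ c : ℝ} (hD : 0 < D) (hu0 : 0 < u)
    (huu : u < u₁) (hu₁ : (D + 1) * u₁ < 1) (hc : 0 < c)
    (hweak : ∀ f : EuclideanSpace ℝ (Fin d) → ℂ, Measurable f → Integrable f →
      ∀ A, MeasurableSet A → ∫⁻ t in A, ‖fourierHat f (ζ t)‖ₑ ∂ν ≤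
        ENNReal.ofReal c * ν A ^ (1 - D * u₁) * (∫⁻ x, ‖f x‖ₑ ^ (1 / (1 - u₁))) ^ (1 - u₁))
    {f : EuclideanSpace ℝ (Fin d) → ℂ} (hfm : Measurable f) (hf : Integrable f)
    (hf1 : ∫⁻ x, ‖f x‖ₑ ^ (1 / (1 - u)) ≤ 1) :
    ∫⁻ t, ‖fourierHat f (ζ t)‖ₑ ^ (1 / (D * u)) ∂ν ≤
      ENNReal.ofReal (1 / (D * u) * 2 ^ (1 / (D * u) - 1) *
        (2 / ((u₁ - u) / (u * (1 - u₁)))) * c ^ (1 / (D * u₁))) := by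
  have hu₁0 : 0 < u₁ := hu0.trans huu
  have hu₁1 : u₁ < 1 := by nlinarith
  have h1u : 0 < 1 - u := by linarith
  have h1u₁ : 0 < 1 - u₁ := by linarith
  have hdiff : 0 < u₁ - u := by linarith
  set q : ℝ := 1 / (D * u) with hq
  set q₁ : ℝ := 1 / (D * u₁) with hq₁
  set η : ℝ := (u₁ - u) / (u * (1 - u₁)) with hη
  have hq0 : 0 < q := by positivity
  have hη0 : 0 < η := by positivity
  have hWm : Measurable fun t => fourierHat f (ζ t) := (measurable_fourierHat hfm).comp hζ
  have e : ∀ t, ‖fourierHat f (ζ t)‖ₑ ^ q = ENNReal.ofReal (‖fourierHat f (ζ t)‖ ^ q) := fun t => by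
    rw [← ofReal_norm, ENNReal.ofReal_rpow_of_nonneg (norm_nonneg _) hq0.le]
  simp_rw [e]
  rw [lintegral_rpow_eq_lintegral_meas_lt_mul ν (.of_forall fun x => norm_nonneg _)
    hWm.norm.aemeasurable hq0]
  have hlow := lintegral_rpow_mul_lowPart (μ := volume) hfm (a := (1 - u) / u) (η := η)
    (p := 1 / (1 - u)) (p₁ := 1 / (1 - u₁)) (by positivity) hη0 (by positivity)
    (by rw [hη]; field_simp; ring) (by positivity)
  calc _ ≤ ENNReal.ofReal q * ∫⁻ s in Set.Ioi (0:ℝ), ENNReal.ofReal (2 ^ (q - 1) * c ^ q₁) *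
        (ENNReal.ofReal ((s / 2) ^ (η - 1)) *
          ∫⁻ x, ‖lowPart f ((s / 2) ^ (-((1 - u) / u))) x‖ₑ ^ (1 / (1 - u₁))) := by
        gcongr ENNReal.ofReal q * ?_
        refine setLIntegral_mono' measurableSet_Ioi fun s hs => ?_
        have hs0 : 0 < s := hs
        have hs2 : 0 < s / 2 := by positivity
        refine (mul_le_mul_left (measure_lt_norm_fourierHat_le hζ hD hu0 huu hu₁ hc hweak hfm hf
          hf1 hs0) _).trans (le_of_eq ?_)
        rw [mul_right_comm, ← mul_assoc, ← ENNReal.ofReal_mul (by positivity),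
          ← ENNReal.ofReal_mul (by positivity)]
        congr 2
        rw [show s ^ (q - 1) = 2 ^ (q - 1) * (s / 2) ^ (q - 1) by
          rw [← Real.mul_rpow two_pos.le hs2.le]; congr 1; ring]
        -- The target exponent `q = 1/(Du)` is the one for which the powers of `s` combine to `η -
        -- 1`, as Tonelli requires.
        have e3 : (s / 2) ^ (η - 1) = (s / 2) ^ (-q₁) *
            (s / 2) ^ (-(η * ((1 - u₁) / (D * u₁) - 1))) * (s / 2) ^ (q - 1) := by
          rw [← Real.rpow_add hs2, ← Real.rpow_add hs2]
          congr 1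
          rw [hη, hq, hq₁]
          field_simp
          ring
        rw [e3]
        ring
    _ = ENNReal.ofReal q * (ENNReal.ofReal (2 ^ (q - 1) * c ^ q₁) *
          (ENNReal.ofReal (2 / η) * ∫⁻ x, ‖f x‖ₑ ^ (1 / (1 - u)))) := by
        rw [lintegral_const_mul' _ _ ENNReal.ofReal_ne_top, hlow]
    _ ≤ ENNReal.ofReal q * (ENNReal.ofReal (2 ^ (q - 1) * c ^ q₁) *
          (ENNReal.ofReal (2 / η) * 1)) := by gcongr
    _ = _ := by
        rw [mul_one, ← ENNReal.ofReal_mul (by positivity), ← ENNReal.ofReal_mul (by positivity)]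
        congr 1
        ring

/-! ### Homogeneity, the estimate on admissible families, extension by density -/

theorem fourierHat_const_mul {d : ℕ} (f : EuclideanSpace ℝ (Fin d) → ℂ) (z : ℂ)
    (ξ : EuclideanSpace ℝ (Fin d)) :
    fourierHat (fun x => z * f x) ξ = z * fourierHat f ξ := by
  simp only [fourierHat, ← integral_const_mul]
  congr 1 with x
  ring

theorem fourierHat_congr_ae {d : ℕ} {f g : EuclideanSpace ℝ (Fin d) → ℂ} (hfg : f =ᵐ[volume] g)
    (ξ : EuclideanSpace ℝ (Fin d)) : fourierHat f ξ = fourierHat g ξ := by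
  refine integral_congr_ae ?_
  filter_upwards [hfg] with x hx
  rw [hx]

/-- A bound for normalised functions gives the homogeneous bound. -/
theorem eLpNorm_fourierHat_le_of_normalised {d : ℕ} {ζ : ℝ → EuclideanSpace ℝ (Fin d)}
    {ν : Measure ℝ} {p q : ℝ} (hp : 0 < p) {K : ℝ≥0∞}
    (h : ∀ f : EuclideanSpace ℝ (Fin d) → ℂ, Measurable f → Integrable f →
      ∫⁻ x, ‖f x‖ₑ ^ p ≤ 1 → (∫⁻ t, ‖fourierHat f (ζ t)‖ₑ ^ q ∂ν) ^ (1 / q) ≤ K)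
    (hq : 0 < q) {f : EuclideanSpace ℝ (Fin d) → ℂ} (hfm : Measurable f) (hf : Integrable f)
    (hfp : ∫⁻ x, ‖f x‖ₑ ^ p ≠ ∞) :
    (∫⁻ t, ‖fourierHat f (ζ t)‖ₑ ^ q ∂ν) ^ (1 / q) ≤ K * (∫⁻ x, ‖f x‖ₑ ^ p) ^ (1 / p) := by
  set M := (∫⁻ x, ‖f x‖ₑ ^ p) ^ (1 / p) with hM
  have hMtop : M ≠ ∞ := ENNReal.rpow_ne_top_of_nonneg (by positivity) hfp
  have hMp : M ^ p = ∫⁻ x, ‖f x‖ₑ ^ p := by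
    rw [hM, ← ENNReal.rpow_mul, one_div_mul_cancel hp.ne', ENNReal.rpow_one]
  rcases eq_or_ne M 0 with hM0 | hM0
  · have h0 : f =ᵐ[volume] fun _ => 0 := by
      have h1 : ∫⁻ x, ‖f x‖ₑ ^ p = 0 := by rw [← hMp, hM0, ENNReal.zero_rpow_of_pos hp]
      rw [lintegral_eq_zero_iff (by fun_prop)] at h1
      filter_upwards [h1] with x hx
      simpa [ENNReal.rpow_eq_zero_iff, hp, hp.le.not_gt] using hx
    have h2 : ∀ t, fourierHat f (ζ t) = 0 := fun t => by
      rw [fourierHat_congr_ae h0]; simp [fourierHat]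
    simp [h2, hq]
  · have hMr : 0 < M.toReal := ENNReal.toReal_pos hM0 hMtop
    set z : ℂ := ((M.toReal⁻¹ : ℝ) : ℂ) with hz
    have hzn : ‖z‖ₑ = M⁻¹ := by
      rw [hz, ← ofReal_norm, Complex.norm_real, Real.norm_of_nonneg (by positivity),
        ENNReal.ofReal_inv_of_pos hMr, ENNReal.ofReal_toReal hMtop]
    have h1 := h (fun x => z * f x) (hfm.const_mul z) (hf.const_mul z) (by
      simp only [enorm_mul, hzn, ENNReal.mul_rpow_of_nonneg _ _ hp.le]
      rw [lintegral_const_mul _ (by fun_prop), ← hMp, ← ENNReal.mul_rpow_of_nonneg _ _ hp.le,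
        ENNReal.inv_mul_cancel hM0 hMtop, ENNReal.one_rpow])
    simp only [fourierHat_const_mul, enorm_mul, hzn, ENNReal.mul_rpow_of_nonneg _ _ hq.le] at h1
    rw [lintegral_const_mul' _ _ (ENNReal.rpow_ne_top_of_nonneg hq.le (by simpa using hM0)),
      ENNReal.mul_rpow_of_nonneg _ _ (by positivity), ← ENNReal.rpow_mul,
      mul_one_div_cancel hq.ne', ENNReal.rpow_one] at h1
    calc _ = M * (M⁻¹ * (∫⁻ t, ‖fourierHat f (ζ t)‖ₑ ^ q ∂ν) ^ (1 / q)) := by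
          rw [← mul_assoc, ENNReal.mul_inv_cancel hM0 hMtop, one_mul]
      _ ≤ M * K := by gcongr
      _ = K * M := mul_comm _ _

/-- The restriction estimate for the members of an admissible family. -/
theorem exists_eLpNorm_fourierHat_le {n : ℕ} {u : ℝ} (hu0 : 0 < u)
    (hu : (((n : ℝ) + 1) * (n + 2) / 2 + 1) * u < 1) :
    ∃ C : ℝ, 0 < C ∧ ∀ {δ : ℝ}, 0 < δ →
      ∀ {P : (ℝ → EuclideanSpace ℝ (Fin (n + 1))) → Set ℝ → Prop}, IsAdmissibleFamily δ P →
      ∀ {ζ : ℝ → EuclideanSpace ℝ (Fin (n + 1))} {J : Set ℝ}, P ζ J →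
      ∀ {f : EuclideanSpace ℝ (Fin (n + 1)) → ℂ}, Measurable f → Integrable f →
      ∀ {p q : ℝ≥0∞}, p ≠ 0 → p ≠ ∞ → q ≠ 0 → q ≠ ∞ → p.toReal = 1 / (1 - u) →
      q.toReal = 1 / (((n : ℝ) + 1) * (n + 2) / 2 * u) → MemLp f p volume →
      eLpNorm (fun t => fourierHat f (ζ t)) q (volume.restrict J) ≤
        ENNReal.ofReal (C * ((2 * Real.pi) ^ (n + 1) / δ) ^ u) * eLpNorm f p volume := by
  set D : ℝ := ((n : ℝ) + 1) * (n + 2) / 2 with hD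
  have hDpos : 0 < D := by positivity
  obtain ⟨u₁, huu, hu₁⟩ : ∃ u₁, u < u₁ ∧ (D + 1) * u₁ < 1 := by
    have : u < 1 / (D + 1) := by rw [lt_div_iff₀ (by positivity)]; linarith
    obtain ⟨u₁, h1, h2⟩ := exists_between this
    exact ⟨u₁, h1, by rw [lt_div_iff₀ (by positivity)] at h2; linarith⟩
  have hu₁0 : 0 < u₁ := hu0.trans huu
  have hu₁1 : u₁ < 1 := by nlinarith
  obtain ⟨C, hC, hweak⟩ := exists_setLIntegral_fourierHat_le_rpow (n := n) hu₁0 hu₁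
  set T : ℝ := 1 / (D * u) * 2 ^ (1 / (D * u) - 1) * (2 / ((u₁ - u) / (u * (1 - u₁)))) with hT
  have hTpos : 0 < T := by
    have h1 : 0 < u₁ - u := by linarith
    have h2 : 0 < 1 - u₁ := by linarith
    positivity
  clear_value T
  refine ⟨T ^ (D * u) * C ^ (u / u₁), by positivity, ?_⟩
  intro δ hδ P hP ζ J hζ f hfm hf p q hp0 hp hq0 hq hpr hqr hfp
  set N : ℝ := (2 * Real.pi) ^ (n + 1) / δ with hN
  have hNpos : 0 < N := by positivity
  have hu1 : u < 1 := huu.trans hu₁1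
  have hppos : 0 < 1 / (1 - u) := one_div_pos.2 (sub_pos.2 hu1)
  have hqpos : 0 < 1 / (D * u) := by positivity
  have : IsFiniteMeasure (volume.restrict J) :=
    isFiniteMeasure_restrict.2 (hP.volume_ne_top hζ)
  rw [eLpNorm_eq_lintegral_rpow_enorm_toReal hq0 hq, eLpNorm_eq_lintegral_rpow_enorm_toReal hp0 hp,
    hpr, hqr]
  refine eLpNorm_fourierHat_le_of_normalised hppos ?_ hqpos hfm hf ?_
  · intro g hgm hg hg1
    have key := lintegral_enorm_fourierHat_rpow_le (hP.continuous hζ).measurable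
      (ν := volume.restrict J) (c := C * N ^ u₁) hDpos hu0 huu hu₁ (by positivity) (by
        intro g hgm hg A hA
        rw [Measure.restrict_restrict hA, Measure.restrict_apply hA]
        exact hweak hδ hP hζ Set.inter_subset_right (hA.inter (hP.measurableSet hζ)) hgm hg)
      hgm hg hg1
    refine (ENNReal.rpow_le_rpow key (by positivity)).trans_eq ?_
    rw [one_div_one_div, ENNReal.ofReal_rpow_of_pos (by positivity)]
    congr 1
    -- `N` enters as `(N ^ u₁) ^ (u / u₁) = N ^ u`, so the auxiliary exponent `u₁` affects only the
    -- constant.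
    rw [← hT, Real.mul_rpow (by positivity) (by positivity), ← Real.rpow_mul (by positivity),
      Real.mul_rpow (by positivity) (by positivity), ← Real.rpow_mul (by positivity),
      show 1 / (D * u₁) * (D * u) = u / u₁ by field_simp,
      show u₁ * (u / u₁) = u by field_simp]
    ring
  · have := lintegral_rpow_enorm_lt_top_of_eLpNorm_lt_top hp0 hp hfp.2
    rw [hpr] at this
    exact this.ne

theorem eLpNorm_top_fourierHat_le {d : ℕ} (ζ : ℝ → EuclideanSpace ℝ (Fin d)) (ν : Measure ℝ)
    (f : EuclideanSpace ℝ (Fin d) → ℂ) :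
    eLpNorm (fun t => fourierHat f (ζ t)) ∞ ν ≤ eLpNorm f 1 volume := by
  rw [eLpNorm_exponent_top, eLpNorm_one_eq_lintegral_enorm]
  exact essSup_le_of_ae_le _ (Filter.Eventually.of_forall fun t => enorm_fourierHat_le f (ζ t))

/-- An a priori estimate on `L¹ ∩ L^p` extends to `L^p` by density. -/
theorem fourierRestrictionBound_of_eLpNorm_le {d : ℕ} {p q : ℝ≥0∞} [hp1 : Fact (1 ≤ p)]
    [hq1 : Fact (1 ≤ q)] (hp : p ≠ ∞) {ζ : ℝ → EuclideanSpace ℝ (Fin d)} (hζ : Measurable ζ)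
    {J : Set ℝ} {B : ℝ} (hB : 0 ≤ B)
    (h : ∀ f : EuclideanSpace ℝ (Fin d) → ℂ, Measurable f → Integrable f → MemLp f p volume →
      eLpNorm (fun t => fourierHat f (ζ t)) q (volume.restrict J) ≤
        ENNReal.ofReal B * eLpNorm f p volume) :
    FourierRestrictionBound p q ζ J B := by
  let S : Submodule ℂ (Lp ℂ p (volume : Measure (EuclideanSpace ℝ (Fin d)))) :=
    { carrier := {f | Integrable f volume}
      add_mem' := fun {f g} hf hg => (hf.add hg).congr (Lp.coeFn_add f g).symm
      zero_mem' := (integrable_zero _ _ _).congr (Lp.coeFn_zero ℂ p volume).symm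
      smul_mem' := fun z f hf => (hf.smul z).congr (Lp.coeFn_smul z f).symm }
  have hmeas : ∀ f : Lp ℂ p (volume : Measure (EuclideanSpace ℝ (Fin d))), Measurable f :=
    fun f => (Lp.stronglyMeasurable f).measurable
  have hbound : ∀ f : S, eLpNorm (fun t => fourierHat f.1 (ζ t)) q (volume.restrict J) ≤
      ENNReal.ofReal B * eLpNorm f.1 p volume :=
    fun f => h f.1 (hmeas f.1) f.2 (Lp.memLp f.1)
  have hmem : ∀ f : S, MemLp (fun t => fourierHat f.1 (ζ t)) q (volume.restrict J) := fun f =>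
    ⟨((measurable_fourierHat (hmeas f.1)).comp hζ).aestronglyMeasurable,
      (hbound f).trans_lt (ENNReal.mul_lt_top ENNReal.ofReal_lt_top (Lp.memLp f.1).2)⟩
  let T : S →ₗ[ℂ] Lp ℂ q ((volume : Measure ℝ).restrict J) :=
    { toFun := fun f => (hmem f).toLp _
      map_add' := fun f g => by
        rw [← MemLp.toLp_add]
        refine MemLp.toLp_congr _ _ (Filter.Eventually.of_forall fun t => ?_)
        change fourierHat _ (ζ t) = fourierHat f.1 (ζ t) + fourierHat g.1 (ζ t)
        rw [← fourierHat_add f.2 g.2]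
        exact fourierHat_congr_ae (Lp.coeFn_add f.1 g.1) _
      map_smul' := fun z f => by
        rw [RingHom.id_apply, ← MemLp.toLp_const_smul]
        refine MemLp.toLp_congr _ _ (Filter.Eventually.of_forall fun t => ?_)
        change fourierHat _ (ζ t) = z * fourierHat f.1 (ζ t)
        rw [← fourierHat_const_mul]
        exact fourierHat_congr_ae (Lp.coeFn_smul z f.1) _ }
  -- Schwartz functions are integrable, hence lie in `S`, and are dense in `L^p` because `p` is
  -- finite.
  have hdense : DenseRange S.subtype := by
    refine (SchwartzMap.denseRange_toLpCLM (F := ℂ) (E := EuclideanSpace ℝ (Fin d))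
      (μ := volume) hp).mono ?_
    rintro _ ⟨φ, rfl⟩
    exact ⟨⟨φ.toLp p volume, φ.integrable.congr (φ.coeFn_toLp p volume).symm⟩, rfl⟩
  have hnorm : ∀ f : S, ‖T f‖ ≤ B * ‖S.subtype f‖ := fun f => by
    change ‖(hmem f).toLp _‖ ≤ B * ‖f.1‖
    rw [Lp.norm_toLp, Lp.norm_def, ← ENNReal.toReal_ofReal hB, ← ENNReal.toReal_mul]
    exact ENNReal.toReal_mono
      (ENNReal.mul_ne_top ENNReal.ofReal_ne_top (Lp.memLp f.1).2.ne) (hbound f)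
  refine ⟨(T.extendOfNorm S.subtype).toLinearMap, fun f hf => ?_, fun f => ?_⟩
  · have h1 := LinearMap.extendOfNorm_eq hdense ⟨B, hnorm⟩ (⟨f, hf⟩ : S)
    have h2 : T.extendOfNorm S.subtype f = (hmem ⟨f, hf⟩).toLp _ := h1
    change ⇑(T.extendOfNorm S.subtype f) =ᵐ[_] _
    rw [h2]
    exact MemLp.coeFn_toLp _
  · exact LinearMap.norm_extendOfNorm_apply_le hdense B hnorm f

theorem FourierRestrictionBound.congr {d : ℕ} {p q : ℝ≥0∞} {ζ ζ' : ℝ → EuclideanSpace ℝ (Fin d)}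
    {J : Set ℝ} (hJ : MeasurableSet J) (hζ : Set.EqOn ζ ζ' J) {B : ℝ}
    (h : FourierRestrictionBound p q ζ J B) : FourierRestrictionBound p q ζ' J B := by
  obtain ⟨R, h1, h2⟩ := h
  refine ⟨R, fun f hf => ?_, h2⟩
  filter_upwards [h1 f hf, ae_restrict_mem hJ] with t ht htJ
  rw [ht, hζ htJ]

/-! ### Offspring curves form an admissible family -/

/-- A curve on `[a, b]`, extended to the real line by constants. -/
noncomputable def clampCurve {d : ℕ} (γ : ℝ → EuclideanSpace ℝ (Fin d)) (a b : ℝ) (t : ℝ) :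
    EuclideanSpace ℝ (Fin d) :=
  γ (max a (min b t))

theorem clampCurve_of_mem {d : ℕ} {γ : ℝ → EuclideanSpace ℝ (Fin d)} {a b t : ℝ}
    (ht : t ∈ Set.Icc a b) : clampCurve γ a b t = γ t := by
  rw [clampCurve, min_eq_right ht.2, max_eq_right ht.1]

theorem continuous_clampCurve {d : ℕ} {γ : ℝ → EuclideanSpace ℝ (Fin d)} {a b : ℝ} (hab : a ≤ b)
    (hγ : ContinuousOn γ (Set.Icc a b)) : Continuous (clampCurve γ a b) :=
  hγ.comp_continuous (by fun_prop) fun t => ⟨le_max_left _ _, max_le hab (min_le_left _ _)⟩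

theorem add_mem_Icc_of_mem_offspringInterval {m : ℕ} {a b t : ℝ} {h : Fin (m + 1) → ℝ}
    (hh : Monotone h) (ht : t ∈ offspringInterval a b h) (j : Fin (m + 1)) :
    t + h j ∈ Set.Icc a b := by
  have h0 := hh (Fin.zero_le j)
  have h1 := hh (Fin.le_last j)
  obtain ⟨h2, h3⟩ := ht
  constructor <;> linarith

theorem offspringCurve_clampCurve_eqOn {d m : ℕ} (γ : ℝ → EuclideanSpace ℝ (Fin d)) (a b : ℝ)
    {h : Fin (m + 1) → ℝ} (hh : Monotone h) :
    Set.EqOn (offspringCurve (clampCurve γ a b) h) (offspringCurve γ h)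
      (offspringInterval a b h) := by
  intro t ht
  simp only [offspringCurve]
  congr 1
  exact Finset.sum_congr rfl fun j _ =>
    clampCurve_of_mem (add_mem_Icc_of_mem_offspringInterval hh ht j)

theorem differentiableOn_offspringCurve {d m : ℕ} {γ : ℝ → EuclideanSpace ℝ (Fin d)} {a b : ℝ}
    (hγ : DifferentiableOn ℝ γ (Set.Icc a b)) {h : Fin (m + 1) → ℝ} (hh : Monotone h) :
    DifferentiableOn ℝ (offspringCurve γ h) (offspringInterval a b h) := by
  have hterm : ∀ j, DifferentiableOn ℝ (fun t => γ (t + h j)) (offspringInterval a b h) := fun j =>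
    hγ.comp (differentiableOn_id.add_const (h j)) fun t ht =>
      add_mem_Icc_of_mem_offspringInterval hh ht j
  exact (DifferentiableOn.fun_sum fun j _ => hterm j).const_smul ((m : ℝ) + 1)⁻¹

theorem continuous_offspringCurve {d m : ℕ} {γ : ℝ → EuclideanSpace ℝ (Fin d)}
    (hγ : Continuous γ) (h : Fin (m + 1) → ℝ) : Continuous (offspringCurve γ h) := by
  unfold offspringCurve
  fun_prop

/-- A finite nonempty family of reals, listed in increasing order. -/
theorem exists_monotone_reindex {ι : Type*} [Fintype ι] [Nonempty ι] (g : ι → ℝ) :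
    ∃ (M : ℕ) (e : Fin (M + 1) ≃ ι), Monotone (g ∘ e) := by
  obtain ⟨M, hM⟩ : ∃ M, Fintype.card ι = M + 1 :=
    Nat.exists_eq_succ_of_ne_zero Fintype.card_ne_zero
  let e₀ : Fin (M + 1) ≃ ι := (Fintype.equivFinOfCardEq hM).symm
  exact ⟨M, (Tuple.sort (g ∘ e₀)).trans e₀, Tuple.monotone_sort (g ∘ e₀)⟩

/-- Sums of translates of an offspring curve are multiples of offspring curves. -/
theorem exists_offspring_translateSum {n m : ℕ} {h : Fin (m + 1) → ℝ}
    (hh : IsOffspringParameter h) {κ : Fin n → ℝ} (hκ : StrictMono (baseTuple 0 κ)) :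
    ∃ (M : ℕ) (h' : Fin (M + 1) → ℝ), IsOffspringParameter h' ∧
      (∀ (γ : ℝ → EuclideanSpace ℝ (Fin (n + 1))),
        translateSum (offspringCurve γ h) κ = fun t => ((n : ℝ) + 1) • offspringCurve γ h' t) ∧
      ∀ a b, baseSet (offspringInterval a b h) κ = offspringInterval a b h' := by
  -- The parameters of the new curve are all sums of a gap and an old parameter; the first gap is
  -- `0`.
  let g : Fin (n + 1) × Fin (m + 1) → ℝ := fun x => baseTuple 0 κ x.1 + h x.2
  have hκ0 : baseTuple 0 κ 0 = 0 := by simp [baseTuple]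
  have hg0 : ∀ x, h 0 ≤ g x := fun x => by
    have h1 := hκ.monotone (Fin.zero_le x.1)
    have h2 := hh.2 (Fin.zero_le x.2)
    rw [hκ0] at h1
    change h 0 ≤ baseTuple 0 κ x.1 + h x.2
    linarith
  have hg1 : ∀ x, g x ≤ g (Fin.last n, Fin.last m) := fun x =>
    add_le_add (hκ.monotone (Fin.le_last _)) (hh.2 (Fin.le_last _))
  obtain ⟨M, e, he⟩ := exists_monotone_reindex g
  have hcard : (M : ℝ) + 1 = ((n : ℝ) + 1) * (m + 1) := by
    have := Fintype.card_congr e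
    simp only [Fintype.card_prod, Fintype.card_fin] at this
    exact_mod_cast this
  -- Only the extreme parameters determine the interval: the least is still `h 0`, the greatest is
  -- the sum of the last gap and the last old parameter.
  have hfirst : g (e 0) = h 0 := by
    refine le_antisymm ?_ (hg0 _)
    have h1 := he (Fin.zero_le (e.symm (0, 0)))
    simpa [g, hκ0] using h1
  have hlast : g (e (Fin.last M)) = g (Fin.last n, Fin.last m) := by
    refine le_antisymm (hg1 _) ?_
    have h1 := he (Fin.le_last (e.symm (Fin.last n, Fin.last m)))
    simpa using h1
  have hbase : ∀ s j, baseTuple s κ j = s + baseTuple 0 κ j := fun s j => by simp [baseTuple]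
  refine ⟨M, g ∘ e, ⟨?_, he⟩, fun γ => ?_, fun a b => ?_⟩
  · exact hh.1.trans (hg0 _)
  · funext t
    have hn : (n : ℝ) + 1 ≠ 0 := by positivity
    have h1 : ∑ j, γ (t + (g ∘ e) j) = ∑ i, ∑ j, γ (baseTuple t κ i + h j) := by
      rw [← Fintype.sum_prod_type', ← Equiv.sum_comp e]
      refine Finset.sum_congr rfl fun j _ => ?_
      rw [hbase, add_assoc]
      rfl
    simp only [translateSum, curveSum, offspringCurve]
    rw [h1, hcard, ← Finset.smul_sum, smul_smul, mul_inv, mul_inv_cancel_left₀ hn]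
  · ext s
    simp only [baseSet, Set.mem_ofPred_eq, offspringInterval, Set.mem_Icc, Function.comp_apply,
      hfirst, hlast]
    constructor
    · intro hs
      have h0 := (hs 0).1
      have h1 := (hs (Fin.last n)).2
      rw [hbase] at h0 h1
      rw [hκ0] at h0
      refine ⟨by linarith, ?_⟩
      change s ≤ b - (baseTuple 0 κ (Fin.last n) + h (Fin.last m))
      linarith
    · rintro ⟨h0, h1⟩ j
      change s ≤ b - (baseTuple 0 κ (Fin.last n) + h (Fin.last m)) at h1
      have h2 := hκ.monotone (Fin.zero_le j)
      have h3 := hκ.monotone (Fin.le_last j)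
      rw [hκ0] at h2
      rw [hbase]
      constructor <;> linarith

/-- The multiples of the offspring curves of `γ` on `[a, b]`, extended by constants. -/
def offspringFamily {d : ℕ} (γ : ℝ → EuclideanSpace ℝ (Fin d)) (a b : ℝ)
    (ζ : ℝ → EuclideanSpace ℝ (Fin d)) (J : Set ℝ) : Prop :=
  ∃ (r : ℝ) (m : ℕ) (h : Fin (m + 1) → ℝ), 1 ≤ r ∧ IsOffspringParameter h ∧
    (ζ = fun t => r • offspringCurve (clampCurve γ a b) h t) ∧ J = offspringInterval a b h

theorem curveSum_congr {d : ℕ} {ζ ζ' : ℝ → EuclideanSpace ℝ (Fin d)} {J : Set ℝ}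
    (hζ : Set.EqOn ζ ζ' J) {t : Fin d → ℝ} (ht : ∀ j, t j ∈ J) :
    curveSum ζ t = curveSum ζ' t :=
  Finset.sum_congr rfl fun j _ => hζ (ht j)

theorem curveSum_const_smul {d : ℕ} (ζ : ℝ → EuclideanSpace ℝ (Fin d)) (r : ℝ) (t : Fin d → ℝ) :
    curveSum (fun s => r • ζ s) t = r • curveSum ζ t := by
  simp [curveSum, Finset.smul_sum]

theorem curveSumJacobian_congr {d : ℕ} {ζ ζ' : ℝ → EuclideanSpace ℝ (Fin d)} {J : Set ℝ}
    (hζ : Set.EqOn ζ ζ' J) {t : Fin d → ℝ} (ht : ∀ j, t j ∈ J) :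
    curveSumJacobian ζ J t = curveSumJacobian ζ' J t := by
  simp only [curveSumJacobian, fun j => derivWithin_congr hζ (hζ (ht j))]

theorem curveSumJacobian_const_smul {d : ℕ} {ζ : ℝ → EuclideanSpace ℝ (Fin d)} {J : Set ℝ}
    (hζ : DifferentiableOn ℝ ζ J) (r : ℝ) {t : Fin d → ℝ} (ht : ∀ j, t j ∈ J) :
    curveSumJacobian (fun s => r • ζ s) J t = r ^ d * curveSumJacobian ζ J t := by
  have h1 : (Matrix.of fun i j : Fin d => derivWithin (fun s => r • ζ s) J (t j) i) =
      r • Matrix.of fun i j : Fin d => derivWithin ζ J (t j) i := by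
    ext i j
    simp [derivWithin_fun_const_smul r (hζ _ (ht j))]
  rw [curveSumJacobian, h1, Matrix.det_smul, Fintype.card_fin, curveSumJacobian]

/-- A sum of translates is `n + 1` times an average, so the family must contain multiples.
Restricting to factors `r ≥ 1` keeps the same `δ`, as the Jacobian is multiplied by `r ^ (n + 1) ≥
1`. Clamping makes the curves continuous on the whole line and changes nothing on the offspring
interval. -/
theorem isAdmissibleFamily_offspringFamily {n : ℕ} {γ : ℝ → EuclideanSpace ℝ (Fin (n + 1))}
    {a b δ : ℝ} (hab : a ≤ b) (hγ : DifferentiableOn ℝ γ (Set.Icc a b))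
    (hinj : ∀ (m : ℕ) (h : Fin (m + 1) → ℝ), IsOffspringParameter h →
      Set.InjOn (curveSum (offspringCurve γ h))
        {t | StrictMono t ∧ ∀ j, t j ∈ offspringInterval a b h})
    (hjac : ∀ (m : ℕ) (h : Fin (m + 1) → ℝ), IsOffspringParameter h →
      (offspringInterval a b h).Nontrivial →
      ∀ t : Fin (n + 1) → ℝ, (∀ j, t j ∈ offspringInterval a b h) →
        δ * |vandermondeProduct t| ≤
          |curveSumJacobian (offspringCurve γ h) (offspringInterval a b h) t|) :
    IsAdmissibleFamily δ (offspringFamily γ a b) where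
  continuous := by
    rintro _ _ ⟨r, m, h, hr, hh, rfl, rfl⟩
    exact (continuous_offspringCurve (continuous_clampCurve hab hγ.continuousOn) h).const_smul r
  measurableSet := by
    rintro _ _ ⟨r, m, h, hr, hh, rfl, rfl⟩
    exact measurableSet_Icc
  volume_ne_top := by
    rintro _ _ ⟨r, m, h, hr, hh, rfl, rfl⟩
    exact measure_Icc_lt_top.ne
  differentiableOn := by
    rintro _ _ ⟨r, m, h, hr, hh, rfl, rfl⟩
    exact ((differentiableOn_offspringCurve hγ hh.2).congr
      (offspringCurve_clampCurve_eqOn γ a b hh.2)).const_smul r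
  injOn := by
    rintro _ _ ⟨r, m, h, hr, hh, rfl, rfl⟩ s hs t ht hst
    have hr0 : r ≠ 0 := by linarith
    rw [curveSum_const_smul, curveSum_const_smul] at hst
    have h1 := smul_right_injective _ hr0 hst
    have hE := offspringCurve_clampCurve_eqOn γ a b hh.2
    rw [curveSum_congr hE hs.2, curveSum_congr hE ht.2] at h1
    exact hinj m h hh hs ht h1
  jacobian := by
    rintro _ _ ⟨r, m, h, hr, hh, rfl, rfl⟩ hJ t ht
    have hE := offspringCurve_clampCurve_eqOn γ a b hh.2
    rw [curveSumJacobian_const_smul ((differentiableOn_offspringCurve hγ hh.2).congr hE) r ht,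
      curveSumJacobian_congr hE ht, abs_mul]
    refine (hjac m h hh hJ t ht).trans (le_mul_of_one_le_left (abs_nonneg _) ?_)
    exact (one_le_pow₀ hr).trans (le_abs_self _)
  translateSum := by
    rintro _ _ ⟨r, m, h, hr, hh, rfl, rfl⟩ κ hκ
    obtain ⟨M, h', hh', hcurve, hint⟩ := exists_offspring_translateSum hh hκ
    refine ⟨r * (n + 1), M, h', ?_, hh', ?_, hint a b⟩
    · have : (0 : ℝ) ≤ n := Nat.cast_nonneg n
      nlinarith
    · funext t
      have h1 := congrFun (hcurve (clampCurve γ a b)) t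
      simp only [translateSum] at h1 ⊢
      rw [curveSum_const_smul, h1, smul_smul]

/-! ### Exponents and conclusion -/

/-- The real-variable form of the exponent relations, for `p > 1`. -/
theorem restriction_exponents {n : ℕ} {p p' q : ℝ≥0∞} (hp1 : 1 < p)
    (hp : p < (((n + 1 : ℕ) : ℝ≥0∞) ^ 2 + (n + 1 : ℕ) + 2) /
      (((n + 1 : ℕ) : ℝ≥0∞) ^ 2 + (n + 1 : ℕ)))
    (hpp' : p.HolderConjugate p')
    (hq : q = 2 * p' / (((n + 1 : ℕ) : ℝ≥0∞) ^ 2 + (n + 1 : ℕ))) :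
    0 < (p'⁻¹).toReal ∧ (((n : ℝ) + 1) * (n + 2) / 2 + 1) * (p'⁻¹).toReal < 1 ∧
      p.toReal = 1 / (1 - (p'⁻¹).toReal) ∧
      q.toReal = 1 / (((n : ℝ) + 1) * (n + 2) / 2 * (p'⁻¹).toReal) := by
  have hptop : p ≠ ∞ := hp.ne_top
  have hsum : p⁻¹ + p'⁻¹ = 1 := hpp'.inv_add_inv_eq_one
  have hp0 : p ≠ 0 := (zero_lt_one.trans hp1).ne'
  have hp'0 : p' ≠ 0 := fun h => by simp [h] at hsum
  have hinv : p.toReal⁻¹ + p'⁻¹.toReal = 1 := by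
    rw [← ENNReal.toReal_inv, ← ENNReal.toReal_add (by simpa) (by simpa), hsum, ENNReal.toReal_one]
  have hpr : 1 < p.toReal := by
    simpa using (ENNReal.toReal_lt_toReal ENNReal.one_ne_top hptop).2 hp1
  have hplt : p.toReal < (((n : ℝ) + 1) * (n + 2) + 2) / (((n : ℝ) + 1) * (n + 2)) := by
    have hne : (((n + 1 : ℕ) : ℝ≥0∞) ^ 2 + (n + 1 : ℕ) + 2) /
        (((n + 1 : ℕ) : ℝ≥0∞) ^ 2 + (n + 1 : ℕ)) ≠ ∞ :=
      ENNReal.div_ne_top (by finiteness) (by positivity)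
    have h1 := (ENNReal.toReal_lt_toReal hptop hne).2 hp
    rw [ENNReal.toReal_div, ENNReal.toReal_add (by finiteness) (by finiteness),
      ENNReal.toReal_add (by finiteness) (by finiteness), ENNReal.toReal_pow,
      ENNReal.toReal_natCast] at h1
    convert h1 using 1
    push_cast
    norm_num
    ring
  set u := p'⁻¹.toReal with hu
  have hp0r : 0 < p.toReal := by linarith
  have hpu : p.toReal⁻¹ = 1 - u := by linarith
  have hu0 : 0 < u := by
    have := inv_lt_one_of_one_lt₀ hpr
    linarith
  refine ⟨hu0, ?_, ?_, ?_⟩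
  · have hpos : (0 : ℝ) < ((n : ℝ) + 1) * (n + 2) := by positivity
    rw [lt_div_iff₀ hpos] at hplt
    have h1 : p.toReal * (1 - u) = 1 := by rw [← hpu, mul_inv_cancel₀ hp0r.ne']
    have h2 : 0 < 1 - u := by rw [← hpu]; positivity
    nlinarith [mul_lt_mul_of_pos_right hplt h2]
  · rw [← hpu, one_div, inv_inv]
  · rw [hq, ENNReal.toReal_div, ENNReal.toReal_mul,
      ENNReal.toReal_add (by finiteness) (by finiteness), ENNReal.toReal_pow,
      ENNReal.toReal_natCast, hu, ENNReal.toReal_inv]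
    push_cast
    have : p'.toReal ≠ 0 := fun h => by simp [hu, ENNReal.toReal_inv, h] at hu0
    field_simp
    norm_num
    ring

theorem proposition2p1 (d : ℕ) (hd : 1 ≤ d)
    -- the ambient interval `[A, B]`, the constant `c` of the geometric inequality
    (A B : ℝ) (c : ℝ) (hc : 0 < c)
    -- the exponents
    (p p' q : ℝ≥0∞) (hp1 : 1 ≤ p)
    (hp : p < ((d : ℝ≥0∞) ^ 2 + d + 2) / ((d : ℝ≥0∞) ^ 2 + d))
    (hpp' : p.HolderConjugate p')
    (hq : q = 2 * p' / ((d : ℝ≥0∞) ^ 2 + d)) :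
    ∃ Cp : ℝ, 0 < Cp ∧
      ∀ γ : ℝ → EuclideanSpace ℝ (Fin d), ContDiffOn ℝ d γ (Set.Icc A B) →
      ∀ a b : ℝ, A ≤ a → a ≤ b → b ≤ B →
      ∀ k : ℤ,
        -- injectivity on ordered tuples, for every offspring curve
        (∀ (m : ℕ) (h : Fin (m + 1) → ℝ), IsOffspringParameter h →
          Set.InjOn (curveSum (offspringCurve γ h))
            {t | StrictMono t ∧ ∀ j, t j ∈ offspringInterval a b h}) →
        -- the geometric inequality, for every offspring curve
        -- (required only where `I_h` is not a single point, so that derivatives on it make sense)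
        (∀ (m : ℕ) (h : Fin (m + 1) → ℝ), IsOffspringParameter h →
          (offspringInterval a b h).Nontrivial →
          ∀ t : Fin d → ℝ, (∀ j, t j ∈ offspringInterval a b h) →
            c * (2 : ℝ) ^ (-k) * |vandermondeProduct t| ≤
              |curveSumJacobian (offspringCurve γ h) (offspringInterval a b h) t|) →
        -- the restriction inequality, uniformly over all offspring curves
        ∀ (m : ℕ) (h : Fin (m + 1) → ℝ), IsOffspringParameter h →
          FourierRestrictionBound p q (offspringCurve γ h) (offspringInterval a b h)
            ((2 : ℝ) ^ ((k : ℝ) * (p'⁻¹).toReal) * Cp) := by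
  obtain ⟨n, rfl⟩ : ∃ n, d = n + 1 := ⟨d - 1, by lia⟩
  have hptop : p ≠ ∞ := hp.ne_top
  have : Fact (1 ≤ p) := ⟨hp1⟩
  obtain ⟨C, hC, hest⟩ : ∃ C : ℝ, 0 < C ∧ 1 ≤ q ∧ ∀ {δ : ℝ}, 0 < δ →
      ∀ {P : (ℝ → EuclideanSpace ℝ (Fin (n + 1))) → Set ℝ → Prop}, IsAdmissibleFamily δ P →
      ∀ {ζ : ℝ → EuclideanSpace ℝ (Fin (n + 1))} {J : Set ℝ}, P ζ J →
      ∀ f : EuclideanSpace ℝ (Fin (n + 1)) → ℂ, Measurable f → Integrable f → MemLp f p volume →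
      eLpNorm (fun t => fourierHat f (ζ t)) q (volume.restrict J) ≤
        ENNReal.ofReal (C * ((2 * Real.pi) ^ (n + 1) / δ) ^ (p'⁻¹).toReal) *
          eLpNorm f p volume := by
    -- At `p = 1` the exponents `p'` and `q` are infinite, the power of `N` is `0`, and the bound is
    -- the trivial one from `L¹` to `L^∞`.
    rcases hp1.eq_or_lt with rfl | hp1
    · have hp' : p' = ∞ := by
        have hsum : (1 : ℝ≥0∞)⁻¹ + p'⁻¹ = 1 := hpp'.inv_add_inv_eq_one
        rw [inv_one] at hsum
        exact ENNReal.inv_eq_zero.1 ((ENNReal.add_right_inj ENNReal.one_ne_top).1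
          (hsum.trans (add_zero 1).symm))
      have hqtop : q = ∞ := by
        rw [hq, hp', ENNReal.mul_top two_ne_zero, ENNReal.top_div_of_ne_top (by finiteness)]
      subst hp' hqtop
      refine ⟨1, one_pos, le_top, fun _ _ _ ζ J _ f _ _ _ => ?_⟩
      simpa using eLpNorm_top_fourierHat_le ζ (volume.restrict J) f
    · obtain ⟨hu0, hu1, hpr, hqr⟩ := restriction_exponents hp1 hp hpp' hq
      obtain ⟨C, hC, hest⟩ := exists_eLpNorm_fourierHat_le (n := n) hu0 hu1
      set u := (p'⁻¹).toReal
      have hDu : 0 < ((n : ℝ) + 1) * (n + 2) / 2 * u := by positivity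
      have hqr1 : 1 ≤ q.toReal := by
        rw [hqr, one_le_div hDu]
        linarith
      have hqr0 : 0 < q.toReal := by linarith
      obtain ⟨hq0, hqtop⟩ := ENNReal.toReal_pos_iff.1 hqr0
      refine ⟨C, hC, ?_, fun hδ _ hP _ _ hζ f hfm hf hfp => ?_⟩
      · simpa using (ENNReal.ofReal_le_iff_le_toReal hqtop.ne).2 hqr1
      · exact hest hδ hP hζ hfm hf (zero_lt_one.trans hp1).ne' hptop hq0.ne' hqtop.ne hpr hqr hfp
  obtain ⟨hq1, hest⟩ := hest
  have : Fact (1 ≤ q) := ⟨hq1⟩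
  set u := (p'⁻¹).toReal
  refine ⟨C * ((2 * Real.pi) ^ (n + 1) / c) ^ u, by positivity, ?_⟩
  intro γ hγ a b hAa hab hbB k hinj hjac m h hh
  have hγ' : DifferentiableOn ℝ γ (Set.Icc a b) :=
    (hγ.differentiableOn (by simp)).mono (Set.Icc_subset_Icc hAa hbB)
  have hP := isAdmissibleFamily_offspringFamily hab hγ' hinj hjac
  have hmem : offspringFamily γ a b (offspringCurve (clampCurve γ a b) h)
      (offspringInterval a b h) := ⟨1, m, h, le_rfl, hh, by simp, rfl⟩
  -- With `δ = c 2^{-k}` the factor `N ^ u` splits into `2 ^ (k u)` and a constant independent of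
  -- `k`.
  have hconst : C * ((2 * Real.pi) ^ (n + 1) / (c * (2 : ℝ) ^ (-k))) ^ u =
      (2 : ℝ) ^ ((k : ℝ) * u) * (C * ((2 * Real.pi) ^ (n + 1) / c) ^ u) := by
    have h1 : (2 * Real.pi) ^ (n + 1) / (c * (2 : ℝ) ^ (-k)) =
        (2 : ℝ) ^ (k : ℝ) * ((2 * Real.pi) ^ (n + 1) / c) := by
      rw [Real.rpow_intCast, zpow_neg]
      field_simp
    rw [h1, Real.mul_rpow (by positivity) (by positivity), ← Real.rpow_mul two_pos.le]
    ring
  refine FourierRestrictionBound.congr measurableSet_Icc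
    (offspringCurve_clampCurve_eqOn γ a b hh.2) ?_
  refine fourierRestrictionBound_of_eLpNorm_le hptop (hP.continuous hmem).measurable
    (by positivity) fun f hfm hf hfp => ?_
  rw [← hconst]
  exact hest (by positivity) hP hmem f hfm hf hfp
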